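/- Let $c,\tilde c:[0,L]\to\mathbb S^2\subset\mathbb R^3$ be two continuous curves of the same length $L\le\pi$ on the unit sphere, parametrized by arc length, and let $0=s_0<s_1<\dots<s_N=L$ be such that on every open interval $(s_{j-1},s_j)$ both curves are of class $C^2$, and their unit tangents $T=c'$, $\tilde T=\tilde c'$ extend continuously to $[s_{j-1},s_j]$ (the tangents may jump at $s_1,\dots,s_{N-1}$; $N=1$ is the case without jumps). On each $(s_{j-1},s_j)$ let $$k=\langle T',\,c\times T\rangle,\qquad \tilde k=\langle \tilde T',\,\tilde c\times\tilde T\rangle$$ be the geodesic curvatures, and for $1\le j\le N-1$ let $\alpha_j,\tilde\alpha_j\in[0,\pi]$ be the turning angles at $s_j$, that is, the angle between $c'(s_j-)$ and $c'(s_j+)$ and the angle between $\tilde c'(s_j-)$ and $\tilde c'(s_j+)$. Assume that 1. $c$ is embedded: it has no self-intersections, except that $c(0)=c(L)$ is allowed ($\tilde c$ need not be embedded); 2. $c$ is convex: it lies in the closed hemisphere to the left of each of its tangent great circles, i.e. $\langle c(t),\,c(s)\times c'(s\pm)\rangle\ge 0$ for all $s,t\in[0,L]$ and every one-sided tangent $c'(s\pm)$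 of $c$ at $s$; 3. $|\tilde k(s)|\le k(s)$ for all $s\in(s_{j-1},s_j)$, $1\le j\le N$; 4. $\alpha_j\ge\tilde\alpha_j$ for all $1\le j\le N-1$. Then $$|c(0)-c(L)|\le|\tilde c(0)-\tilde c(L)|.$$ -/

import Mathlib

open Set

noncomputable section

namespace SphericalSchur

/-- Euclidean three-space, in which the unit sphere `Metric.sphere 0 1` is the standard `S²`. -/
abbrev E3 : Type := EuclideanSpace ℝ (Fin 3)

/-- The cross product of two vectors of Euclidean three-space. -/
def cross (u v : E3) : E3 :=
  WithLp.toLp 2 (crossProduct (WithLp.ofLp u) (WithLp.ofLp v))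

/-- The tangent `c'(s+)`: the derivative from the right. -/
def rightTangent (c : ℝ → E3) (s : ℝ) : E3 := derivWithin c (Ici s) s

/-- The tangent `c'(s-)`: the derivative from the left. -/
def leftTangent (c : ℝ → E3) (s : ℝ) : E3 := derivWithin c (Iic s) s

/-- The turning angle at `c(s)`: the distance in the unit sphere between the unit vectors
`c'(s-)` and `c'(s+)`, a number in `[0, π]`. -/
def turningAngle (c : ℝ → E3) (s : ℝ) : ℝ :=
  InnerProductGeometry.angle (leftTangent c s) (rightTangent c s)

/-- The geodesic curvature `⟨T', c × T⟩`, `T = c'`, of an arc-length curve on the unit sphere,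
at a parameter where the curve is twice differentiable. -/
def geodesicCurvature (c : ℝ → E3) (s : ℝ) : ℝ :=
  inner ℝ (deriv (deriv c) s) (cross (c s) (deriv c s))

/-- `0 = p 0 < p 1 < ⋯ < p N = L`. -/
structure IsPartition (L : ℝ) (N : ℕ) (p : ℕ → ℝ) : Prop where
  zero : p 0 = 0
  last : p N = L
  lt : ∀ j < N, p j < p (j + 1)

/-- A curve on the unit sphere parametrized by arc length on `[0, L]` whose tangent may jump at
the interior points of the partition: it is twice continuously differentiable with unit speed
inside each piece, and its tangent extends continuously to the ends of the piece. -/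
structure IsPiecewiseSphericalCurve (L : ℝ) (N : ℕ) (p : ℕ → ℝ) (c : ℝ → E3) : Prop where
  mem_sphere : ∀ s ∈ Icc 0 L, c s ∈ Metric.sphere (0 : E3) 1
  contDiffOn_one : ∀ j < N, ContDiffOn ℝ 1 c (Icc (p j) (p (j + 1)))
  contDiffOn_two : ∀ j < N, ContDiffOn ℝ 2 c (Ioo (p j) (p (j + 1)))
  unit_speed : ∀ j < N, ∀ s ∈ Ioo (p j) (p (j + 1)), ‖deriv c s‖ = 1

/-- The curve has no self-intersection on `[0, L]`, except that its two end points are allowed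
to coincide. -/
def IsSimple (L : ℝ) (c : ℝ → E3) : Prop :=
  ∀ s ∈ Icc 0 L, ∀ t ∈ Icc 0 L, s < t → c s = c t → s = 0 ∧ t = L

/-- The curve is convex on the sphere: it lies in the closed hemisphere to the left of each of its
tangent great circles, the one at `c(s)` in direction `T` being oriented by `c(s) × T`. At a corner
this is required for both one-sided tangents. -/
def IsConvex (L : ℝ) (c : ℝ → E3) : Prop :=
  ∀ s ∈ Icc 0 L, ∀ t ∈ Icc 0 L,
    (s < L → 0 ≤ (inner ℝ (c t) (cross (c s) (rightTangent c s)) : ℝ)) ∧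
    (0 < s → 0 ≤ (inner ℝ (c t) (cross (c s) (leftTangent c s)) : ℝ))

end SphericalSchur

end

/-!
# Schur's comparison theorem for convex curves on the sphere

Write `x`, `y` for the end points of the convex curve `c` and `x'`, `y'` for those of the less
curved curve `c'`. As in Schur's theorem in the plane, the two curves are compared by their heights
over an axis. Unless `c` lies on one great circle or `x = ± y`, choose the point `c s` of `c` farthest from the
plane of `x` and `y`. There, or at some intermediate direction if `c s` is a corner, the direction
`e` of the curve lies in that plane (`IsConvexChain.exists_pole`). Let `e'` be the corresponding
direction at `c' s`. The claim follows from `⟨x', e'⟩ ≤ ⟨x, e⟩ < ⟨y, e⟩ ≤ ⟨y', e'⟩`: the spherical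
distance of `x'` and `y'` is at least the difference of their distances from `e'`, and for `x`, `y`
and `e`, which lie on one great circle, the latter difference is the distance of `x` and `y`
(`inner_le_of_heights`).

The comparison of heights, `FrameChain.inner_end_le`, is the analytic core. At a given time, take
the coordinates of `e` in the moving frame of `c` and those of the end point of `c'` in the moving
frame of `c'`. Move the rest of `c'` to the point of `c`, and turn or reflect it there in any way
that does not increase the angle between its initial direction and the direction to the pole `e`;
`leastHeight` is the least height over `e` that its end point can have. This quantity does not
increase with time, as long as it stays above a bound below `⟨y, e⟩` given by the length of the
curve after the time `s`: this follows from `|k'| ≤ k` on the smooth arcs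
(`leastHeight_antitone_arc`), and at the corners because the first curve turns by at least as much
as the second one (`leastInner_turn_le`). At the final time it is `⟨y, e⟩`, and at the time `s` it is at most
`⟨y', e'⟩`. The bound `L ≤ π` enters because the distance travelled from `s` controls the heights
(`FrameChain.abs_arcsin_sub_le`).

The argument needs `⟨n, e⟩ ≤ 0` after the time `s`: the normals `n` of `c` stay on one side of the
pole. This is where convexity is used: points met in succession on `c` form positively oriented
triples (`IsConvexChain.det_nonneg`), hence ratios such as `⟨n, y⟩ / ⟨n, x + y⟩` are monotone along
`c` (`FrameChain.inner_n_div_le`, `FrameChain.inner_n_nonpos`). The orientation of the frames plays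
no role in the comparison of heights, so the part of the curve before `s` is treated by running
both curves backwards (`FrameChain.reverse`).

The case `x = y` is trivial. If `c` lies on one great circle, or `x = -y`, it has neither curvature nor corners
(`IsConvexChain.straight_of_planar`, `IsConvexChain.straight_of_le_inner`). Then the same holds for
`c'`, and both curves are great circle arcs of the same length.
-/

open Real Filter Topology

namespace SphericalSchur

/-! ### Two monotonicity criteria -/

theorem le_of_hasDerivAt_nonneg {F F' : ℝ → ℝ} {s t : ℝ} (hst : s ≤ t)
    (hF : ContinuousOn F (Icc s t)) (hd : ∀ x ∈ Ioo s t, HasDerivAt F (F' x) x)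
    (h0 : ∀ x ∈ Ioo s t, 0 ≤ F' x) : F s ≤ F t := by
  refine monotoneOn_of_deriv_nonneg (convex_Icc s t) hF ?_ ?_ (left_mem_Icc.2 hst)
    (right_mem_Icc.2 hst) hst
  · rw [interior_Icc]
    exact fun x hx => (hd x hx).differentiableAt.differentiableWithinAt
  · rw [interior_Icc]
    intro x hx
    rw [(hd x hx).deriv]
    exact h0 x hx

/-- A continuous function whose upper right Dini derivative is nonpositive inside an interval
does not increase along it. -/
theorem le_of_dini_nonpos {f : ℝ → ℝ} {a b : ℝ} (hab : a ≤ b) (hf : ContinuousOn f (Icc a b))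
    (hd : ∀ x ∈ Ioo a b, ∀ r > 0, ∀ᶠ z in 𝓝[>] x, f z ≤ f x + r * (z - x)) : f b ≤ f a := by
  rcases hab.eq_or_lt with rfl | hab
  · exact le_rfl
  have key : ∀ x ∈ Ioo a b, f b ≤ f x := by
    intro x hx
    refine image_le_of_liminf_slope_right_le_deriv_boundary (B := fun _ => f x) (B' := fun _ => 0)
      (hf.mono (Icc_subset_Icc_left hx.1.le)) le_rfl continuousOn_const
      (fun y _ => hasDerivWithinAt_const _ _ _) ?_ (right_mem_Icc.2 hx.2.le)
    intro y hy r hr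
    refine Eventually.frequently ?_
    filter_upwards [hd y ⟨hx.1.trans_le hy.1, hy.2⟩ (r / 2) (by linarith),
      self_mem_nhdsWithin] with z hz hyz
    have hyz : 0 < z - y := sub_pos.2 hyz
    rw [slope_def_field, div_lt_iff₀ hyz]
    nlinarith
  have hc : Tendsto f (𝓝[>] a) (𝓝 (f a)) :=
    (hf a (left_mem_Icc.2 hab.le)).mono_left
      (nhdsWithin_le_of_mem (mem_of_superset (Ioc_mem_nhdsGT hab) Ioc_subset_Icc_self))
  refine ge_of_tendsto hc ?_
  filter_upwards [Ioo_mem_nhdsGT hab] with x hx using key x hx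

theorem eventually_le_add_of_hasDerivAt {F : ℝ → ℝ} {F' x r : ℝ} (h : HasDerivAt F F' x)
    (hF : F' ≤ 0) (hr : 0 < r) : ∀ᶠ z in 𝓝[>] x, F z ≤ F x + r * (z - x) := by
  have h1 : Tendsto (slope F x) (𝓝[>] x) (𝓝 F') :=
    (hasDerivAt_iff_tendsto_slope.1 h).mono_left (nhdsWithin_mono _ fun z hz => ne_of_gt hz)
  filter_upwards [h1.eventually (gt_mem_nhds (lt_of_le_of_lt hF hr)), self_mem_nhdsWithin]
    with z hz hxz
  have hxz : 0 < z - x := sub_pos.2 hxz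
  rw [slope_def_field, div_lt_iff₀ hxz] at hz
  linarith

/-! ### The least inner product of two plane vectors -/

/-- For plane vectors `(u, v)` and `(a, b)` whose directions make the angles `θ, β ∈ [0, π]` with
the first axis, the product of their lengths with `cos (min π (θ + β))`: the least inner product
that the vectors can have after rotations that do not increase these two angles. The condition
`θ + β ≤ π` is written as `0 ≤ cos θ + cos β`, multiplied by the two lengths. -/
noncomputable def leastInner (u v a b : ℝ) : ℝ :=
  if 0 ≤ u * √(a ^ 2 + b ^ 2) + a * √(u ^ 2 + v ^ 2) then u * a - |v| * |b|
  else -(√(u ^ 2 + v ^ 2) * √(a ^ 2 + b ^ 2))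

theorem neg_mul_sqrt_le (u v a b : ℝ) :
    -(√(u ^ 2 + v ^ 2) * √(a ^ 2 + b ^ 2)) ≤ u * a - |v| * |b| := by
  have h : abs (u * a - |v| * |b|) ≤ √(u ^ 2 + v ^ 2) * √(a ^ 2 + b ^ 2) := by
    rw [← Real.sqrt_mul (by positivity)]
    refine Real.abs_le_sqrt ?_
    rw [← sq_abs v, ← sq_abs b]
    nlinarith [sq_nonneg (u * |b| + |v| * a)]
  exact (abs_le.1 h).1

theorem leastInner_le (u v a b : ℝ) : leastInner u v a b ≤ u * a - |v| * |b| := by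
  unfold leastInner
  split_ifs
  · exact le_rfl
  · exact neg_mul_sqrt_le u v a b

theorem leastInner_eq_of_zero {u v a b : ℝ}
    (h : 0 = u * √(a ^ 2 + b ^ 2) + a * √(u ^ 2 + v ^ 2)) :
    -(√(u ^ 2 + v ^ 2) * √(a ^ 2 + b ^ 2)) = u * a - |v| * |b| := by
  have hR0 := Real.sqrt_nonneg (u ^ 2 + v ^ 2)
  have hS0 := Real.sqrt_nonneg (a ^ 2 + b ^ 2)
  have hR := Real.sq_sqrt (show 0 ≤ u ^ 2 + v ^ 2 by positivity)
  have hS := Real.sq_sqrt (show 0 ≤ a ^ 2 + b ^ 2 by positivity)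
  set R := √(u ^ 2 + v ^ 2)
  set S := √(a ^ 2 + b ^ 2)
  have hu : u * S = -(a * R) := by linarith
  rcases hS0.eq_or_lt with h0 | hS0
  · have ha : a = 0 := by nlinarith [sq_nonneg a, sq_nonneg b]
    have hb : b = 0 := by nlinarith [sq_nonneg a, sq_nonneg b]
    simp [ha, hb, ← h0]
  rcases hR0.eq_or_lt with h0 | hR0
  · have ha : u = 0 := by nlinarith [sq_nonneg u, sq_nonneg v]
    have hb : v = 0 := by nlinarith [sq_nonneg u, sq_nonneg v]
    simp [ha, hb, ← h0]
  have hv : |v| * S = |b| * R := by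
    refine (pow_left_inj₀ (by positivity) (by positivity) two_ne_zero).1 ?_
    have : (u * S) ^ 2 = (a * R) ^ 2 := by rw [hu]; ring
    rw [mul_pow, mul_pow, sq_abs, sq_abs]
    nlinarith
  have : (u * a - |v| * |b|) * S = -(R * S) * S := by
    have h1 : |b| * |b| = b ^ 2 := by rw [← sq_abs b]; ring
    calc (u * a - |v| * |b|) * S = (u * S) * a - (|v| * S) * |b| := by ring
      _ = -(R * S ^ 2) := by rw [hu, hv, hS]; linear_combination -R * h1
      _ = _ := by ring
  exact (mul_right_cancel₀ hS0.ne' this).symm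

theorem continuous_leastInner :
    Continuous fun x : ℝ × ℝ × ℝ × ℝ => leastInner x.1 x.2.1 x.2.2.1 x.2.2.2 := by
  unfold leastInner
  refine Continuous.if_le (by fun_prop) (by fun_prop) (by fun_prop) (by fun_prop) ?_
  intro x hx
  exact (leastInner_eq_of_zero hx).symm

theorem leastInner_polar {R S θ β : ℝ} (hR : 0 ≤ R) (hS : 0 ≤ S) (hθ : θ ∈ Icc 0 π)
    (hβ : |β| ≤ π) :
    leastInner (R * cos θ) (R * sin θ) (S * cos β) (S * sin β) =
      R * S * cos (min π (θ + |β|)) := by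
  have hβ' : leastInner (R * cos θ) (R * sin θ) (S * cos β) (S * sin β) =
      leastInner (R * cos θ) (R * sin θ) (S * cos |β|) (S * sin |β|) := by
    rcases abs_cases β with h | h <;> rw [h.1]
    simp [leastInner]
  rw [hβ']
  have hb0 := abs_nonneg β
  generalize |β| = β at *
  have h1 : √((R * cos θ) ^ 2 + (R * sin θ) ^ 2) = R := by
    rw [show (R * cos θ) ^ 2 + (R * sin θ) ^ 2 = R ^ 2 by
      linear_combination R ^ 2 * Real.sin_sq_add_cos_sq θ, Real.sqrt_sq hR]
  have h2 : √((S * cos β) ^ 2 + (S * sin β) ^ 2) = S := by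
    rw [show (S * cos β) ^ 2 + (S * sin β) ^ 2 = S ^ 2 by
      linear_combination S ^ 2 * Real.sin_sq_add_cos_sq β, Real.sqrt_sq hS]
  have hsθ := Real.sin_nonneg_of_mem_Icc hθ
  have hsβ := Real.sin_nonneg_of_mem_Icc ⟨hb0, hβ⟩
  unfold leastInner
  rw [h1, h2, abs_of_nonneg (mul_nonneg hR hsθ), abs_of_nonneg (mul_nonneg hS hsβ)]
  have hRS := mul_nonneg hR hS
  rcases le_total (θ + β) π with h | h
  · have hc : cos (π - β) ≤ cos θ :=
      Real.cos_le_cos_of_nonneg_of_le_pi hθ.1 (by linarith) (by linarith)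
    rw [Real.cos_pi_sub] at hc
    rw [if_pos (by nlinarith), min_eq_right h, Real.cos_add]
    ring
  · have hc : cos θ ≤ cos (π - β) :=
      Real.cos_le_cos_of_nonneg_of_le_pi (by linarith) hθ.2 (by linarith)
    rw [Real.cos_pi_sub] at hc
    rw [min_eq_left h, Real.cos_pi]
    split_ifs with h3
    · have h0 : 0 = (R * S) * (cos θ + cos β) := by nlinarith
      rcases mul_eq_zero.1 h0.symm with h4 | h4
      · linear_combination (cos θ * cos β - sin θ * sin β + 1) * h4
      · have h5 : sin θ = sin β := by
          refine (abs_eq_abs.1 ((sq_eq_sq_iff_abs_eq_abs _ _).1 ?_)).elim id fun h6 => by linarith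
          rw [Real.sin_sq, Real.sin_sq, show cos θ = -cos β by linarith]; ring
        rw [h5, show cos θ = -cos β by linarith]
        linear_combination (-(R * S)) * Real.sin_sq_add_cos_sq β
    · ring

theorem exists_polar (u v : ℝ) :
    ∃ R θ : ℝ, 0 ≤ R ∧ θ ∈ Ioc (-π) π ∧ u = R * cos θ ∧ v = R * sin θ :=
  ⟨‖(⟨u, v⟩ : ℂ)‖, Complex.arg ⟨u, v⟩, norm_nonneg _, Complex.arg_mem_Ioc _,
    (Complex.norm_mul_cos_arg ⟨u, v⟩).symm, (Complex.norm_mul_sin_arg ⟨u, v⟩).symm⟩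

/-- Turning the first vector away from the axis by `α`, and the second one by an angle of absolute
value at most `α`, does not increase the least inner product. -/
theorem leastInner_turn_le {u v a b α α' : ℝ} (hα : α ∈ Ico 0 π) (hα' : |α'| ≤ α) (hv : 0 ≤ v)
    (hv' : 0 ≤ sin α * u + cos α * v) :
    leastInner (cos α * u - sin α * v) (sin α * u + cos α * v)
      (cos α' * a + sin α' * b) (-sin α' * a + cos α' * b) ≤ leastInner u v a b := by
  obtain ⟨R, θ, hR, hθ1, rfl, rfl⟩ := exists_polar u v
  obtain ⟨S, β, hS, hβ1, rfl, rfl⟩ := exists_polar a b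
  have hβ : |β| ≤ π := abs_le.2 ⟨hβ1.1.le, hβ1.2⟩
  rcases hR.eq_or_lt with rfl | hR0
  · simp [leastInner]
  have hθ : θ ∈ Icc 0 π := by
    refine ⟨?_, hθ1.2⟩
    by_contra! h
    have := Real.sin_neg_of_neg_of_neg_pi_lt h hθ1.1
    nlinarith
  have e1 : cos α * (R * cos θ) - sin α * (R * sin θ) = R * cos (θ + α) := by
    rw [Real.cos_add]; ring
  have e2 : sin α * (R * cos θ) + cos α * (R * sin θ) = R * sin (θ + α) := by
    rw [Real.sin_add]; ring
  have hθα : θ + α ≤ π := by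
    by_contra! hlt
    rw [e2] at hv'
    have : sin (θ + α - π) > 0 :=
      Real.sin_pos_of_pos_of_lt_pi (by linarith) (by linarith [hθ.2, hα.2])
    rw [Real.sin_sub_pi] at this
    nlinarith
  -- the polar angle of the turned second vector, brought back to `[0, π]`
  set γ := arccos (cos (β - α')) with hγ
  have hγ0 : γ ∈ Icc 0 π := ⟨Real.arccos_nonneg _, Real.arccos_le_pi _⟩
  have hγcos : cos γ = cos (β - α') := Real.cos_arccos (Real.neg_one_le_cos _) (Real.cos_le_one _)
  have hγsin : |sin γ| = |sin (β - α')| := by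
    refine (sq_eq_sq_iff_abs_eq_abs _ _).1 ?_
    rw [Real.sin_sq, Real.sin_sq, hγcos]
  have e3 : cos α' * (S * cos β) + sin α' * (S * sin β) = S * cos γ := by
    rw [hγcos, Real.cos_sub]; ring
  have e4 : -sin α' * (S * cos β) + cos α' * (S * sin β) = S * sin (β - α') := by
    rw [Real.sin_sub]; ring
  have e5 : leastInner (R * cos (θ + α)) (R * sin (θ + α)) (S * cos γ) (S * sin (β - α')) =
      leastInner (R * cos (θ + α)) (R * sin (θ + α)) (S * cos γ) (S * sin γ) := by
    have h1 : sin (β - α') ^ 2 = sin γ ^ 2 := (sq_eq_sq_iff_abs_eq_abs _ _).2 hγsin.symm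
    simp only [leastInner, abs_mul, mul_pow, h1, hγsin]
  rw [e1, e2, e3, e4, e5, leastInner_polar hR hS ⟨by linarith [hθ.1, hα.1], hθα⟩
    (by rw [abs_of_nonneg hγ0.1]; exact hγ0.2), leastInner_polar hR hS hθ hβ]
  have hγβ : |β| - |α'| ≤ γ := by
    rcases le_total (|β| - |α'|) 0 with h | h
    · exact h.trans hγ0.1
    · have h1 : cos (β - α') ≤ cos (|β| - |α'|) := by
        rw [Real.cos_sub, Real.cos_sub, Real.cos_abs, Real.cos_abs]
        have : sin β * sin α' ≤ sin |β| * sin |α'| := by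
          have hs1 : sin |β| = |sin β| := by
            rcases abs_cases β with h2 | h2 <;> rw [h2.1]
            · rw [abs_of_nonneg (Real.sin_nonneg_of_nonneg_of_le_pi h2.2 (by linarith))]
            · rw [Real.sin_neg, abs_of_nonpos]
              exact Real.sin_nonpos_of_nonpos_of_neg_pi_le h2.2.le (by linarith)
          have hs2 : sin |α'| = |sin α'| := by
            rcases abs_cases α' with h2 | h2 <;> rw [h2.1]
            · rw [abs_of_nonneg (Real.sin_nonneg_of_nonneg_of_le_pi h2.2 (by linarith [hα.2]))]
            · rw [Real.sin_neg, abs_of_nonpos]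
              exact Real.sin_nonpos_of_nonpos_of_neg_pi_le h2.2.le (by linarith [hα.2])
          rw [hs1, hs2, ← abs_mul]
          exact le_abs_self _
        linarith
      have h2 := Real.arccos_le_arccos h1
      rwa [Real.arccos_cos h (by linarith [abs_nonneg α'])] at h2
  refine mul_le_mul_of_nonneg_left ?_ (mul_nonneg hR hS)
  refine Real.cos_le_cos_of_nonneg_of_le_pi ?_ (min_le_left _ _)
    (min_le_min_left _ (by linarith [abs_of_nonneg hγ0.1]))
  exact le_min Real.pi_pos.le (add_nonneg hθ.1 (abs_nonneg _))

/-! ### Coordinates of a fixed vector in a moving frame -/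

/-- The coordinates `(y, u, w)` of a fixed unit vector in the moving frame `(c, T, n)` of a
spherical arc of geodesic curvature `k`, which satisfies `c' = T`, `T' = -c + k n`,
`n' = -k T`. -/
structure IsFrameCoords (a b : ℝ) (k y u w : ℝ → ℝ) : Prop where
  cont_y : ContinuousOn y (Icc a b)
  cont_u : ContinuousOn u (Icc a b)
  cont_w : ContinuousOn w (Icc a b)
  deriv_y : ∀ s ∈ Ioo a b, HasDerivAt y (u s) s
  deriv_u : ∀ s ∈ Ioo a b, HasDerivAt u (-y s + k s * w s) s
  deriv_w : ∀ s ∈ Ioo a b, HasDerivAt w (-(k s * u s)) s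
  sq_sum : ∀ s ∈ Icc a b, y s ^ 2 + u s ^ 2 + w s ^ 2 = 1

theorem IsFrameCoords.mono {a b a' b' : ℝ} {k y u w : ℝ → ℝ} (h : IsFrameCoords a b k y u w)
    (ha : a ≤ a') (hb : b' ≤ b) : IsFrameCoords a' b' k y u w where
  cont_y := h.cont_y.mono (Icc_subset_Icc ha hb)
  cont_u := h.cont_u.mono (Icc_subset_Icc ha hb)
  cont_w := h.cont_w.mono (Icc_subset_Icc ha hb)
  deriv_y s hs := h.deriv_y s (Ioo_subset_Ioo ha hb hs)
  deriv_u s hs := h.deriv_u s (Ioo_subset_Ioo ha hb hs)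
  deriv_w s hs := h.deriv_w s (Ioo_subset_Ioo ha hb hs)
  sq_sum s hs := h.sq_sum s (Icc_subset_Icc ha hb hs)

/-- The derivative of `y p - √(1 - y²) √(1 - p²)`, which is `sin (arcsin y - arccos p)`. -/
theorem hasDerivAt_mul_sub_sqrt {y p : ℝ → ℝ} {y' p' s : ℝ} (hy : HasDerivAt y y' s)
    (hp : HasDerivAt p p' s) (hy1 : 0 < 1 - y s ^ 2) (hp1 : 0 < 1 - p s ^ 2) :
    HasDerivAt (fun z => y z * p z - √(1 - y z ^ 2) * √(1 - p z ^ 2))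
      ((y' * √(1 - p s ^ 2) + p' * √(1 - y s ^ 2)) *
        (p s * √(1 - y s ^ 2) + y s * √(1 - p s ^ 2)) / (√(1 - y s ^ 2) * √(1 - p s ^ 2))) s := by
  have h1 := ((hy.pow 2).const_sub 1).sqrt hy1.ne'
  have h2 := ((hp.pow 2).const_sub 1).sqrt hp1.ne'
  have h3 := (hy.mul hp).sub (h1.mul h2)
  refine h3.congr_deriv ?_
  have hR0 := Real.sqrt_pos.2 hy1
  have hS0 := Real.sqrt_pos.2 hp1
  simp only [Pi.pow_apply]
  generalize √(1 - y s ^ 2) = R at *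
  generalize √(1 - p s ^ 2) = S at *
  field_simp
  push_cast
  ring

/-- In polar form: if the angles `θ` and `β` of `(u, v)` and `(a, |b|)` with the first axis satisfy
`0 ≤ cos θ + cos β`, that is `θ + β ≤ π`, then `0 ≤ sin (θ + β)`. -/
theorem add_mul_sqrt_nonneg_imp {u v a b : ℝ} (hv : 0 ≤ v)
    (h : 0 ≤ u * √(a ^ 2 + b ^ 2) + a * √(u ^ 2 + v ^ 2)) : 0 ≤ v * a + u * |b| := by
  have hR0 := Real.sqrt_nonneg (u ^ 2 + v ^ 2)
  have hS0 := Real.sqrt_nonneg (a ^ 2 + b ^ 2)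
  have hR := Real.sq_sqrt (show 0 ≤ u ^ 2 + v ^ 2 by positivity)
  have hS := Real.sq_sqrt (show 0 ≤ a ^ 2 + b ^ 2 by positivity)
  have hb : |b| ^ 2 = b ^ 2 := sq_abs b
  have hb0 := abs_nonneg b
  set R := √(u ^ 2 + v ^ 2)
  set S := √(a ^ 2 + b ^ 2)
  rcases le_total 0 u with hu | hu <;> rcases le_total 0 a with ha | ha
  · positivity
  · have h1 : (-a) * R ≤ u * S := by linarith
    have h2 := pow_le_pow_left₀ (mul_nonneg (by linarith) hR0) h1 2
    have h3 : (v * (-a)) ^ 2 ≤ (u * |b|) ^ 2 := by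
      simp only [mul_pow, hb, hR, hS] at h2 ⊢
      nlinarith
    have := (pow_le_pow_iff_left₀ (mul_nonneg hv (by linarith)) (by positivity) two_ne_zero).1 h3
    linarith
  · have h1 : (-u) * S ≤ a * R := by linarith
    have h2 := pow_le_pow_left₀ (mul_nonneg (by linarith) hS0) h1 2
    have h3 : ((-u) * |b|) ^ 2 ≤ (v * a) ^ 2 := by
      simp only [mul_pow, hb, hR, hS] at h2 ⊢
      nlinarith
    have := (pow_le_pow_iff_left₀ (mul_nonneg (by linarith) hb0) (by positivity) two_ne_zero).1 h3
    linarith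
  · rcases hu.eq_or_lt with rfl | hu
    · rcases ha.eq_or_lt with rfl | ha
      · simp
      · have hR' : R = 0 := by nlinarith
        have : v = 0 := by nlinarith [sq_nonneg v]
        simp [this]
    · have hR' : 0 < R := Real.sqrt_pos.2 (by nlinarith [sq_nonneg v])
      have h4 : a * R ≤ 0 := mul_nonpos_of_nonpos_of_nonneg ha hR0
      have h5 : u * S ≤ 0 := mul_nonpos_of_nonpos_of_nonneg hu.le hS0
      have hS' : S = 0 := by nlinarith
      have h6 : b ^ 2 = 0 := by nlinarith [sq_nonneg a]
      have h7 : a = 0 := by nlinarith [sq_nonneg b, sq_nonneg a]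
      have : b = 0 := by nlinarith
      simp [this, h7]

/-- The sine of the least latitude that the end point of an arc can reach: `(y, u, w)` are the
coordinates of the pole in the frame of an arc, `(p, a, b)` those of the end point of another arc
in the frame of that arc; the second arc is attached to the first one with common base point, and
turned or reflected in any way that does not increase the angle between its initial direction and
the direction to the pole. -/
noncomputable def leastHeight (y u w p a b : ℝ) : ℝ :=
  y * p + leastInner u (-w) a b

theorem leastHeight_of_neg {y u w p a b : ℝ} (h1 : y ^ 2 + u ^ 2 + w ^ 2 = 1)
    (h2 : p ^ 2 + a ^ 2 + b ^ 2 = 1) (h : u * √(1 - p ^ 2) + a * √(1 - y ^ 2) < 0) :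
    leastHeight y u w p a b = y * p - √(1 - y ^ 2) * √(1 - p ^ 2) := by
  have e1 : a ^ 2 + b ^ 2 = 1 - p ^ 2 := by linarith
  have e2 : u ^ 2 + (-w) ^ 2 = 1 - y ^ 2 := by linarith [neg_sq w]
  rw [leastHeight, leastInner, e1, e2, if_neg (not_le.2 h)]
  ring

/-- While the curvature of the first arc dominates that of the second one, the least height does
not increase along the arcs as long as it exceeds the bound `m`. -/
theorem leastHeight_antitone_arc {s t m : ℝ} (hst : s ≤ t) {k k' y u w p a b : ℝ → ℝ}
    (h : IsFrameCoords s t k y u w) (h' : IsFrameCoords s t k' p a b)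
    (hk : ∀ x ∈ Ioo s t, |k' x| ≤ k x) (hw : ∀ x ∈ Ioo s t, w x ≤ 0)
    (hm : ∀ x ∈ Ioo s t, m ≤ y x * p x - √(1 - y x ^ 2) * √(1 - p x ^ 2) →
      0 ≤ p x * √(1 - y x ^ 2) + y x * √(1 - p x ^ 2)) :
    max (leastHeight (y t) (u t) (w t) (p t) (a t) (b t)) m ≤
      max (leastHeight (y s) (u s) (w s) (p s) (a s) (b s)) m := by
  set G : ℝ → ℝ := fun x => leastHeight (y x) (u x) (w x) (p x) (a x) (b x) with hG
  have hGc : ContinuousOn G (Icc s t) := by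
    refine (h.cont_y.mul h'.cont_y).add ?_
    exact continuous_leastInner.comp_continuousOn
      (h.cont_u.prodMk (h.cont_w.neg.prodMk (h'.cont_u.prodMk h'.cont_w)))
  refine le_of_dini_nonpos (f := fun x => max (G x) m) hst
    (ContinuousOn.sup hGc continuousOn_const) ?_
  intro x hx ρ hρ
  have hx' := Ioo_subset_Icc_self hx
  -- it suffices to bound `G` by a function with nonpositive derivative that agrees with it at `x`
  have of_F : ∀ (F : ℝ → ℝ) (F' : ℝ), HasDerivAt F F' x → F' ≤ 0 → F x = G x →
      (∀ᶠ z in 𝓝[>] x, G z ≤ F z) →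
      ∀ᶠ z in 𝓝[>] x, max (G z) m ≤ max (G x) m + ρ * (z - x) := by
    intro F F' hF hF' hFx hGF
    filter_upwards [eventually_le_add_of_hasDerivAt hF hF' hρ, hGF, self_mem_nhdsWithin]
      with z h1 h2 h3
    have h3 : 0 < ρ * (z - x) := mul_pos hρ (sub_pos.2 h3)
    rw [hFx] at h1
    exact max_le (by linarith [le_max_left (G x) m]) (by linarith [le_max_right (G x) m])
  have hy := h.deriv_y x hx
  have hu := h.deriv_u x hx
  have hw' := h.deriv_w x hx
  have hp := h'.deriv_y x hx
  have ha := h'.deriv_u x hx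
  have hb := h'.deriv_w x hx
  have hyu := h.sq_sum x hx'
  have hpa := h'.sq_sum x hx'
  rcases le_or_gt 0 (u x * √(1 - p x ^ 2) + a x * √(1 - y x ^ 2)) with hE | hE
  · have e1 : a x ^ 2 + b x ^ 2 = 1 - p x ^ 2 := by linarith
    have e2 : u x ^ 2 + (-w x) ^ 2 = 1 - y x ^ 2 := by linarith [neg_sq (w x)]
    have hD := add_mul_sqrt_nonneg_imp (u := u x) (v := -w x) (a := a x) (b := b x)
      (by linarith [hw x hx]) (by rwa [e1, e2])
    obtain ⟨ε, hε, hεb⟩ : ∃ ε : ℝ, |ε| = 1 ∧ |b x| = ε * b x := by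
      rcases le_total 0 (b x) with h0 | h0
      · exact ⟨1, by simp, by rw [abs_of_nonneg h0, one_mul]⟩
      · exact ⟨-1, by simp, by rw [abs_of_nonpos h0]; ring⟩
    have hε2 : ε * ε = 1 := by
      rw [← abs_mul_abs_self, hε, one_mul]
    refine of_F (fun z => y z * p z + u z * a z + ε * (w z * b z)) _
      (((hy.mul hp).add (hu.mul ha)).add ((hw'.mul hb).const_mul ε)) ?_ ?_ ?_
    · have h1 : 0 ≤ k x - ε * k' x := by
        have : ε * k' x ≤ |k' x| := by
          calc ε * k' x ≤ |ε * k' x| := le_abs_self _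
            _ = |k' x| := by rw [abs_mul, hε, one_mul]
        linarith [hk x hx]
      rw [hεb] at hD
      have h2 := mul_nonneg h1 hD
      have : u x * p x + y x * a x + ((-y x + k x * w x) * a x + u x * (-p x + k' x * b x)) +
          ε * (-(k x * u x) * b x + w x * -(k' x * a x)) =
          -((k x - ε * k' x) * (-w x * a x + u x * (ε * b x))) := by
        linear_combination (-(k' x * u x * b x)) * hε2
      rw [this]
      linarith
    · simp only [hG, leastHeight, leastInner]
      rw [e1, e2, if_pos hE, abs_of_nonneg (by linarith [hw x hx] : 0 ≤ -w x), hεb]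
      ring
    · filter_upwards [Ioo_mem_nhdsGT hx.2] with z hz
      have hzw := hw z ⟨hx.1.trans hz.1, hz.2⟩
      have h1 := leastInner_le (u z) (-w z) (a z) (b z)
      rw [abs_of_nonneg (by linarith : 0 ≤ -w z)] at h1
      have h2 : ε * b z ≤ |b z| := by
        calc ε * b z ≤ |ε * b z| := le_abs_self _
          _ = |b z| := by rw [abs_mul, hε, one_mul]
      have h3 := mul_le_mul_of_nonneg_left h2 (by linarith : 0 ≤ -w z)
      simp only [hG, leastHeight]
      linarith
  · have hEz : ∀ᶠ z in 𝓝[>] x, u z * √(1 - p z ^ 2) + a z * √(1 - y z ^ 2) < 0 := by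
      have hc : ContinuousAt (fun z => u z * √(1 - p z ^ 2) + a z * √(1 - y z ^ 2)) x :=
        (hu.continuousAt.mul (continuousAt_const.sub (hp.continuousAt.pow 2)).sqrt).add
          (ha.continuousAt.mul (continuousAt_const.sub (hy.continuousAt.pow 2)).sqrt)
      exact (hc.eventually (gt_mem_nhds hE)).filter_mono nhdsWithin_le_nhds
    rcases lt_or_ge (G x) m with hGm | hGm
    · have hc : ContinuousAt G x := (hGc x hx').continuousAt (Icc_mem_nhds hx.1 hx.2)
      filter_upwards [(hc.eventually (gt_mem_nhds hGm)).filter_mono nhdsWithin_le_nhds,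
        self_mem_nhdsWithin] with z h1 h2
      have h3 : 0 < ρ * (z - x) := mul_pos hρ (sub_pos.2 h2)
      rw [max_eq_right h1.le]
      linarith [le_max_right (G x) m]
    · have hGx : G x = y x * p x - √(1 - y x ^ 2) * √(1 - p x ^ 2) :=
        leastHeight_of_neg hyu hpa hE
      have hy1 : 0 < 1 - y x ^ 2 := by
        by_contra! hn
        have hux : u x = 0 := by nlinarith [sq_nonneg (u x), sq_nonneg (w x)]
        rw [Real.sqrt_eq_zero_of_nonpos hn, hux] at hE
        simp at hE
      have hp1 : 0 < 1 - p x ^ 2 := by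
        by_contra! hn
        have hux : a x = 0 := by nlinarith [sq_nonneg (a x), sq_nonneg (b x)]
        rw [Real.sqrt_eq_zero_of_nonpos hn, hux] at hE
        simp at hE
      refine of_F _ _ (hasDerivAt_mul_sub_sqrt hy hp hy1 hp1) ?_ hGx.symm ?_
      · rw [hGx] at hGm
        exact div_nonpos_of_nonpos_of_nonneg
          (mul_nonpos_of_nonpos_of_nonneg hE.le (hm x hx hGm)) (by positivity)
      · filter_upwards [hEz, Ioo_mem_nhdsGT hx.2] with z h1 h2
        have hz : z ∈ Icc s t := ⟨hx.1.le.trans h2.1.le, h2.2.le⟩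
        exact (leastHeight_of_neg (h.sq_sum z hz) (h'.sq_sum z hz) h1).le

/-! ### Chains of moving frames -/

/-- A piecewise smooth curve `c` on the unit sphere with a moving frame `(c, T j, n j)` over each
closed piece `[p j, p (j + 1)]`, of geodesic curvature `k` inside the pieces; at the corner
`p (j + 1)` the frame turns about `c` by the signed angle `α (j + 1)`. The orientation of the
frames is left open, so that a curve run backwards gives a chain with the same curvatures. -/
structure FrameChain (N : ℕ) (p : ℕ → ℝ) (c : ℝ → E3) (T n : ℕ → ℝ → E3) (k : ℝ → ℝ)
    (α : ℕ → ℝ) : Prop where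
  lt : ∀ j < N, p j < p (j + 1)
  cont_c : ∀ j < N, ContinuousOn c (Icc (p j) (p (j + 1)))
  cont_T : ∀ j < N, ContinuousOn (T j) (Icc (p j) (p (j + 1)))
  cont_n : ∀ j < N, ContinuousOn (n j) (Icc (p j) (p (j + 1)))
  deriv_c : ∀ j < N, ∀ s ∈ Ioo (p j) (p (j + 1)), HasDerivAt c (T j s) s
  deriv_T : ∀ j < N, ∀ s ∈ Ioo (p j) (p (j + 1)), HasDerivAt (T j) (-c s + k s • n j s) s
  deriv_n : ∀ j < N, ∀ s ∈ Ioo (p j) (p (j + 1)), HasDerivAt (n j) (-(k s • T j s)) s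
  orthonormal : ∀ j < N, ∀ s ∈ Icc (p j) (p (j + 1)), Orthonormal ℝ ![c s, T j s, n j s]
  turn_T : ∀ j, j + 1 < N → T (j + 1) (p (j + 1)) =
    cos (α (j + 1)) • T j (p (j + 1)) + sin (α (j + 1)) • n j (p (j + 1))
  turn_n : ∀ j, j + 1 < N → n (j + 1) (p (j + 1)) =
    -sin (α (j + 1)) • T j (p (j + 1)) + cos (α (j + 1)) • n j (p (j + 1))

theorem partition_mono {N : ℕ} {p : ℕ → ℝ} (hp : ∀ j < N, p j < p (j + 1)) {i j : ℕ}
    (hij : i ≤ j) (hj : j ≤ N) : p i ≤ p j := by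
  induction j, hij using Nat.le_induction with
  | base => exact le_rfl
  | succ j _ ih => exact (ih (by omega)).trans (hp j (by omega)).le

theorem exists_piece {N : ℕ} {p : ℕ → ℝ} (hN : 0 < N) {s : ℝ} (hs : s ∈ Icc (p 0) (p N)) :
    ∃ j < N, s ∈ Icc (p j) (p (j + 1)) := by
  by_contra! h
  have : ∀ j ≤ N, p j ≤ s := by
    intro j
    induction j with
    | zero => exact fun _ => hs.1
    | succ j ih =>
      intro hj
      by_contra! hlt
      exact h j (by omega) ⟨ih (by omega), hlt.le⟩
  obtain ⟨M, rfl⟩ := Nat.exists_eq_succ_of_ne_zero hN.ne'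
  exact h M (by omega) ⟨this M (by omega), hs.2⟩

/-- A function given piecewise increases along the partition if it does so on each piece and
through each jump. -/
theorem chain_le {N : ℕ} {p : ℕ → ℝ} (hp : ∀ j < N, p j < p (j + 1)) {F : ℕ → ℝ → ℝ}
    {lo hi : ℝ} {i j : ℕ}
    (hpiece : ∀ l < N, i ≤ l → ∀ s t, p l ≤ s → s ≤ t → t ≤ p (l + 1) → lo ≤ s → t ≤ hi →
      F l s ≤ F l t)
    (hjump : ∀ l, l + 1 < N → i ≤ l → lo ≤ p (l + 1) → p (l + 1) ≤ hi →
      F l (p (l + 1)) ≤ F (l + 1) (p (l + 1)))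
    (hij : i ≤ j) (hj : j < N) {s t : ℝ} (hs : s ∈ Icc (p i) (p (i + 1)))
    (ht : t ∈ Icc (p j) (p (j + 1))) (hst : s ≤ t) (hlo : lo ≤ s) (hhi : t ≤ hi) :
    F i s ≤ F j t := by
  induction j, hij using Nat.le_induction generalizing t with
  | base => exact hpiece i hj le_rfl s t hs.1 hst ht.2 hlo hhi
  | succ j hij ih =>
    have h1 : s ≤ p (j + 1) := hs.2.trans (partition_mono hp (by omega) (by omega))
    have h2 : p j ≤ p (j + 1) := (hp j (by omega)).le
    exact (ih (by omega) (right_mem_Icc.2 h2) h1 (ht.1.trans hhi)).trans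
      ((hjump j hj hij (hlo.trans h1) (ht.1.trans hhi)).trans
        (hpiece (j + 1) hj (by omega) _ _ le_rfl ht.1 ht.2 (hlo.trans h1) hhi))

section Orthonormal

variable {x₁ x₂ x₃ : E3}

theorem orthonormal_triple_iff :
    Orthonormal ℝ ![x₁, x₂, x₃] ↔ ‖x₁‖ = 1 ∧ ‖x₂‖ = 1 ∧ ‖x₃‖ = 1 ∧
      inner ℝ x₁ x₂ = (0 : ℝ) ∧ inner ℝ x₁ x₃ = (0 : ℝ) ∧ inner ℝ x₂ x₃ = (0 : ℝ) := by
  rw [Orthonormal, Pairwise]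
  simp only [Fin.forall_fin_succ, Fin.isValue]
  simp [real_inner_comm]
  rw [real_inner_comm x₂ x₁, real_inner_comm x₃ x₁, real_inner_comm x₃ x₂]
  tauto

theorem Orthonormal.inner_eq (h : Orthonormal ℝ ![x₁, x₂, x₃]) (x z : E3) :
    (inner ℝ x z : ℝ) = inner ℝ x₁ x * inner ℝ x₁ z + inner ℝ x₂ x * inner ℝ x₂ z +
      inner ℝ x₃ x * inner ℝ x₃ z := by
  have hs := h.linearIndependent.span_eq_top_of_card_eq_finrank (by simp)
  have := (OrthonormalBasis.mk h hs.ge).sum_inner_mul_inner x z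
  rw [← this]
  simp [Fin.sum_univ_three, real_inner_comm]

theorem Orthonormal.eq_sum (h : Orthonormal ℝ ![x₁, x₂, x₃]) (x : E3) :
    x = (inner ℝ x₁ x : ℝ) • x₁ + (inner ℝ x₂ x : ℝ) • x₂ + (inner ℝ x₃ x : ℝ) • x₃ := by
  refine ext_inner_right ℝ fun z => ?_
  rw [Orthonormal.inner_eq h x z, inner_add_left, inner_add_left, real_inner_smul_left,
    real_inner_smul_left, real_inner_smul_left]

end Orthonormal

namespace FrameChain

variable {N : ℕ} {p : ℕ → ℝ} {c : ℝ → E3} {T n : ℕ → ℝ → E3} {k : ℝ → ℝ} {α : ℕ → ℝ}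

theorem hasDerivAt_inner_c (h : FrameChain N p c T n k α) {j : ℕ} (hj : j < N) {s : ℝ}
    (hs : s ∈ Ioo (p j) (p (j + 1))) (e : E3) :
    HasDerivAt (fun s => (inner ℝ (c s) e : ℝ)) (inner ℝ (T j s) e) s := by
  simpa using (h.deriv_c j hj s hs).inner ℝ (hasDerivAt_const s e)

theorem hasDerivAt_inner_T (h : FrameChain N p c T n k α) {j : ℕ} (hj : j < N) {s : ℝ}
    (hs : s ∈ Ioo (p j) (p (j + 1))) (e : E3) :
    HasDerivAt (fun s => (inner ℝ (T j s) e : ℝ)) (-inner ℝ (c s) e + k s * inner ℝ (n j s) e)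
      s := by
  simpa [inner_add_left, inner_neg_left, real_inner_smul_left] using
    (h.deriv_T j hj s hs).inner ℝ (hasDerivAt_const s e)

theorem hasDerivAt_inner_n (h : FrameChain N p c T n k α) {j : ℕ} (hj : j < N) {s : ℝ}
    (hs : s ∈ Ioo (p j) (p (j + 1))) (e : E3) :
    HasDerivAt (fun s => (inner ℝ (n j s) e : ℝ)) (-(k s * inner ℝ (T j s) e)) s := by
  simpa [inner_neg_left, real_inner_smul_left] using
    (h.deriv_n j hj s hs).inner ℝ (hasDerivAt_const s e)

theorem coords (h : FrameChain N p c T n k α) {j : ℕ} (hj : j < N) {e : E3} (he : ‖e‖ = 1) :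
    IsFrameCoords (p j) (p (j + 1)) k (fun s => inner ℝ (c s) e) (fun s => inner ℝ (T j s) e)
      (fun s => inner ℝ (n j s) e) where
  cont_y := (h.cont_c j hj).inner continuousOn_const
  cont_u := (h.cont_T j hj).inner continuousOn_const
  cont_w := (h.cont_n j hj).inner continuousOn_const
  deriv_y _ hs := h.hasDerivAt_inner_c hj hs e
  deriv_u _ hs := h.hasDerivAt_inner_T hj hs e
  deriv_w _ hs := h.hasDerivAt_inner_n hj hs e
  sq_sum s hs := by
    have := Orthonormal.inner_eq (h.orthonormal j hj s hs) e e
    rw [real_inner_self_eq_norm_sq, he] at this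
    linarith

theorem norm_c (h : FrameChain N p c T n k α) {j : ℕ} (hj : j < N) {s : ℝ}
    (hs : s ∈ Icc (p j) (p (j + 1))) : ‖c s‖ = 1 :=
  (orthonormal_triple_iff.1 (h.orthonormal j hj s hs)).1

theorem norm_c' (h : FrameChain N p c T n k α) (hN : 0 < N) {s : ℝ}
    (hs : s ∈ Icc (p 0) (p N)) : ‖c s‖ = 1 := by
  obtain ⟨j, hj, hs⟩ := exists_piece hN hs
  exact h.norm_c hj hs

theorem inner_turn_T (h : FrameChain N p c T n k α) {j : ℕ} (hj : j + 1 < N) (e : E3) :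
    (inner ℝ (T (j + 1) (p (j + 1))) e : ℝ) = cos (α (j + 1)) * inner ℝ (T j (p (j + 1))) e +
      sin (α (j + 1)) * inner ℝ (n j (p (j + 1))) e := by
  rw [h.turn_T j hj, inner_add_left, real_inner_smul_left, real_inner_smul_left]

theorem inner_turn_n (h : FrameChain N p c T n k α) {j : ℕ} (hj : j + 1 < N) (e : E3) :
    (inner ℝ (n (j + 1) (p (j + 1))) e : ℝ) = -sin (α (j + 1)) * inner ℝ (T j (p (j + 1))) e +
      cos (α (j + 1)) * inner ℝ (n j (p (j + 1))) e := by
  rw [h.turn_n j hj, inner_add_left, real_inner_smul_left, real_inner_smul_left]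

theorem continuousOn_c (h : FrameChain N p c T n k α) :
    ContinuousOn c (Icc (p 0) (p N)) := by
  have : ∀ j ≤ N, ContinuousOn c (Icc (p 0) (p j)) := by
    intro j
    induction j with
    | zero => simp
    | succ j ih =>
      intro hj
      rw [← Icc_union_Icc_eq_Icc (partition_mono h.lt (Nat.zero_le j) (by omega))
        (h.lt j (by omega)).le]
      exact (ih (by omega)).union_of_isClosed (h.cont_c j (by omega)) isClosed_Icc isClosed_Icc
  exact this N le_rfl

/-- Running a curve backwards keeps the curvatures and the turning angles, if the normals are
kept. -/
theorem reverse (h : FrameChain N p c T n k α) (L : ℝ) :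
    FrameChain N (fun j => L - p (N - j)) (fun s => c (L - s)) (fun j s => -T (N - 1 - j) (L - s))
      (fun j s => n (N - 1 - j) (L - s)) (fun s => k (L - s)) (fun j => α (N - j)) := by
  have hidx : ∀ j < N, N - j = N - 1 - j + 1 ∧ N - (j + 1) = N - 1 - j := fun j hj => by omega
  have hIcc : ∀ j < N, MapsTo (fun s => L - s) (Icc (L - p (N - j)) (L - p (N - (j + 1))))
      (Icc (p (N - 1 - j)) (p (N - 1 - j + 1))) := by
    intro j hj s hs
    rw [(hidx j hj).1, (hidx j hj).2] at hs
    exact ⟨by linarith [hs.2], by linarith [hs.1]⟩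
  have hIoo : ∀ j < N, ∀ s ∈ Ioo (L - p (N - j)) (L - p (N - (j + 1))),
      L - s ∈ Ioo (p (N - 1 - j)) (p (N - 1 - j + 1)) := by
    intro j hj s hs
    rw [(hidx j hj).1, (hidx j hj).2] at hs
    exact ⟨by linarith [hs.2], by linarith [hs.1]⟩
  have hsub : ∀ s : ℝ, HasDerivAt (fun s => L - s) (-1) s := fun s => by
    simpa using (hasDerivAt_id s).const_sub L
  refine ⟨?_, ?_, ?_, ?_, ?_, ?_, ?_, ?_, ?_, ?_⟩
  · intro j hj
    have := h.lt (N - 1 - j) (by omega)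
    simp only [(hidx j hj).1, (hidx j hj).2]
    linarith
  · intro j hj
    exact (h.cont_c _ (by omega)).comp (by fun_prop) (hIcc j hj)
  · intro j hj
    exact ((h.cont_T _ (by omega)).comp (by fun_prop) (hIcc j hj)).neg
  · intro j hj
    exact (h.cont_n _ (by omega)).comp (by fun_prop) (hIcc j hj)
  · intro j hj s hs
    exact ((h.deriv_c _ (by omega) _ (hIoo j hj s hs)).scomp s (hsub s)).congr_deriv (by simp)
  · intro j hj s hs
    exact ((h.deriv_T _ (by omega) _ (hIoo j hj s hs)).scomp s (hsub s)).neg.congr_deriv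
      (by simp [add_comm])
  · intro j hj s hs
    simpa [Function.comp_def] using (h.deriv_n _ (by omega) _ (hIoo j hj s hs)).scomp s (hsub s)
  · intro j hj s hs
    have := h.orthonormal _ (by omega) _ (hIcc j hj hs)
    rw [orthonormal_triple_iff] at this ⊢
    simpa using this
  · intro j hj
    have h1 : N - 1 - j = (N - 1 - (j + 1)) + 1 := by omega
    have h2 : N - (j + 1) = (N - 1 - (j + 1)) + 1 := by omega
    have ht := h.turn_T (N - 1 - (j + 1)) (by omega)
    have hn := h.turn_n (N - 1 - (j + 1)) (by omega)
    simp only [sub_sub_cancel]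
    rw [h2, h1, ht, hn]
    generalize N - 1 - (j + 1) = i at *
    generalize T i (p (i + 1)) = v
    generalize n i (p (i + 1)) = w
    generalize α (i + 1) = a
    have := Real.sin_sq_add_cos_sq a
    match_scalars <;> first | ring1 | linear_combination this
  · intro j hj
    have h1 : N - 1 - j = (N - 1 - (j + 1)) + 1 := by omega
    have h2 : N - (j + 1) = (N - 1 - (j + 1)) + 1 := by omega
    have ht := h.turn_T (N - 1 - (j + 1)) (by omega)
    have hn := h.turn_n (N - 1 - (j + 1)) (by omega)
    simp only [sub_sub_cancel]
    rw [h2, h1, ht, hn]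
    generalize N - 1 - (j + 1) = i at *
    generalize T i (p (i + 1)) = v
    generalize n i (p (i + 1)) = w
    generalize α (i + 1) = a
    have := Real.sin_sq_add_cos_sq a
    match_scalars <;> first | ring1 | linear_combination this | linear_combination -this

end FrameChain

namespace FrameChain

variable {N : ℕ} {p : ℕ → ℝ} {c c' : ℝ → E3} {T n T' n' : ℕ → ℝ → E3} {k k' : ℝ → ℝ}
  {α α' : ℕ → ℝ}

/-! ### Heights along a curve parametrized by arc length -/

/-- The latitude of a point of a unit speed curve changes with speed at most one. Scaling the
height by `ρ < 1` keeps it away from the poles, where `arcsin` is not differentiable. -/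
theorem abs_arcsin_sub_le (h : FrameChain N p c T n k α) {e : E3} (he : ‖e‖ = 1) (hN : 0 < N)
    {s t : ℝ} (hs : p 0 ≤ s) (hst : s ≤ t) (ht : t ≤ p N) :
    |arcsin (inner ℝ (c t) e) - arcsin (inner ℝ (c s) e)| ≤ t - s := by
  obtain ⟨i, hi, his⟩ := exists_piece hN ⟨hs, hst.trans ht⟩
  obtain ⟨j, hj, hjt⟩ := exists_piece hN ⟨hs.trans hst, ht⟩
  rcases lt_or_ge j i with hji | hij
  · have : p (j + 1) ≤ p i := partition_mono h.lt hji hi.le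
    have : s = t := le_antisymm hst (by linarith [hjt.2, his.1])
    simp [this]
  have key : ∀ σ : ℝ, |σ| = 1 → ∀ ρ ∈ Ioo (0 : ℝ) 1,
      s - σ * arcsin (ρ * inner ℝ (c s) e) ≤ t - σ * arcsin (ρ * inner ℝ (c t) e) := by
    intro σ hσ ρ hρ
    refine chain_le (lo := s) (hi := t) (F := fun _ x => x - σ * arcsin (ρ * inner ℝ (c x) e))
      h.lt ?_ (fun _ _ _ _ _ => le_rfl) hij hj his hjt hst le_rfl le_rfl
    intro l hl _ x₁ x₂ hx₁ hx hx₂ _ _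
    have hco := (h.coords hl he).mono hx₁ hx₂
    have hbd : ∀ x ∈ Icc x₁ x₂, (ρ * inner ℝ (c x) e) ^ 2 < 1 ∧
        |ρ * inner ℝ (T l x) e| ≤ √(1 - (ρ * inner ℝ (c x) e) ^ 2) := by
      intro x hx
      have h1 := hco.sq_sum x hx
      have hρ2 : ρ ^ 2 < 1 := by nlinarith [hρ.1, hρ.2]
      have h2 : inner ℝ (c x) e ^ 2 ≤ (1 : ℝ) := by
        nlinarith [sq_nonneg (inner ℝ (T l x) e : ℝ), sq_nonneg (inner ℝ (n l x) e : ℝ)]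
      constructor
      · rw [mul_pow]; nlinarith [sq_nonneg (inner ℝ (c x) e : ℝ)]
      · refine Real.abs_le_sqrt ?_
        rw [mul_pow, mul_pow]
        nlinarith [sq_nonneg (inner ℝ (n l x) e : ℝ), sq_nonneg ρ]
    refine le_of_hasDerivAt_nonneg (F := fun x => x - σ * arcsin (ρ * inner ℝ (c x) e))
      (F' := fun x => 1 - σ * (1 / √(1 - (ρ * inner ℝ (c x) e) ^ 2) * (ρ * inner ℝ (T l x) e)))
      hx ?_ ?_ ?_
    · exact continuousOn_id.sub (continuousOn_const.mul
        (Real.continuous_arcsin.comp_continuousOn (continuousOn_const.mul hco.cont_y)))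
    · intro x hx
      have h1 := (hbd x (Ioo_subset_Icc_self hx)).1
      have h2 : HasDerivAt (fun x => ρ * (inner ℝ (c x) e : ℝ)) (ρ * inner ℝ (T l x) e) x :=
        (hco.deriv_y x hx).const_mul ρ
      have h3 := (Real.hasDerivAt_arcsin (x := ρ * inner ℝ (c x) e)
        (by intro h0; rw [h0] at h1; norm_num at h1)
        (by intro h0; rw [h0] at h1; norm_num at h1)).comp x h2
      exact (hasDerivAt_id x).sub (h3.const_mul σ)
    · intro x hx
      obtain ⟨h1, h2⟩ := hbd x (Ioo_subset_Icc_self hx)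
      have h3 : 0 < √(1 - (ρ * inner ℝ (c x) e) ^ 2) := Real.sqrt_pos.2 (by linarith)
      have h4 : σ * (1 / √(1 - (ρ * inner ℝ (c x) e) ^ 2) * (ρ * inner ℝ (T l x) e)) ≤ 1 := by
        refine (le_abs_self _).trans ?_
        rw [abs_mul, hσ, one_mul, abs_mul, abs_of_pos (one_div_pos.2 h3), one_div,
          inv_mul_le_one₀ h3]
        exact h2
      linarith
  have lim : ∀ σ : ℝ, |σ| = 1 →
      s - σ * arcsin (inner ℝ (c s) e) ≤ t - σ * arcsin (inner ℝ (c t) e) := by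
    intro σ hσ
    have hc : ∀ x a : ℝ, Tendsto (fun ρ : ℝ => a - σ * arcsin (ρ * x)) (𝓝[<] 1)
        (𝓝 (a - σ * arcsin x)) := by
      intro x a
      have : Continuous fun ρ : ℝ => a - σ * arcsin (ρ * x) := by
        have := Real.continuous_arcsin
        fun_prop
      simpa using (this.tendsto 1).mono_left nhdsWithin_le_nhds
    refine le_of_tendsto_of_tendsto (hc _ _) (hc _ _) ?_
    filter_upwards [Ioo_mem_nhdsLT (show (0 : ℝ) < 1 by norm_num)] with ρ hρ using key σ hσ ρ hρ
  rw [abs_le]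
  have h1 := lim 1 (by simp)
  have h2 := lim (-1) (by simp)
  constructor <;> linarith

theorem arccos_inner_le (h : FrameChain N p c T n k α) (hN : 0 < N) {s t : ℝ} (hs : p 0 ≤ s)
    (hst : s ≤ t) (ht : t ≤ p N) : arccos (inner ℝ (c s) (c t)) ≤ t - s := by
  have he := h.norm_c' hN ⟨hs.trans hst, ht⟩
  have h1 := h.abs_arcsin_sub_le he hN hs hst ht
  rw [real_inner_self_eq_norm_sq, he, one_pow, Real.arcsin_one] at h1
  rw [Real.arccos_eq_pi_div_two_sub_arcsin]
  exact (le_abs_self _).trans h1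

/-- If the base latitude is `b` and the arcs have length `σ < π + b`, a height bound below `sin b`
forces the latitude difference `ρ` to be at most `π / 2`. -/
theorem exists_height_bound {σ y : ℝ} (hσy : σ < π + arcsin y) (hy : |y| ≤ 1) :
    ∃ m < y, ∀ ρ, -(π / 2) ≤ ρ → ρ ≤ σ → m ≤ -sin ρ → 0 ≤ cos ρ := by
  have hb := Real.neg_pi_div_two_le_arcsin y
  have hb' := Real.arcsin_le_pi_div_two y
  rcases le_or_gt σ (π / 2) with h | h
  · exact ⟨y - 1, by linarith, fun ρ h1 h2 _ =>
      Real.cos_nonneg_of_neg_pi_div_two_le_of_le h1 (h2.trans h)⟩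
  · have h1 : sin (σ - π) < y := by
      rw [← Real.sin_arcsin (abs_le.1 hy).1 (abs_le.1 hy).2]
      exact Real.sin_lt_sin_of_lt_of_le_pi_div_two (by linarith) hb' (by linarith)
    refine ⟨(sin (σ - π) + y) / 2, by linarith, fun ρ h2 h3 h4 => ?_⟩
    by_contra! hneg
    have h5 : π / 2 < ρ := by
      by_contra! h6
      exact absurd (Real.cos_nonneg_of_neg_pi_div_two_le_of_le h2 h6) (not_le.2 hneg)
    have h6 : sin (ρ - π) ≤ sin (σ - π) :=
      Real.sin_le_sin_of_le_of_le_pi_div_two (by linarith) (by linarith) (by linarith)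
    rw [Real.sin_sub_pi] at h6
    linarith

/-- **Comparison of heights.** Let both curves start at the parameter `s` on the equator of poles
`e` and `e'`, in directions that make angles `θ` and `θ'` with the poles. If the second curve
turns less than the first one, and the normals of the first one stay on the negative side of its
pole, then the second one ends at least as high as the first one. -/
theorem inner_end_le (h : FrameChain N p c T n k α) (h' : FrameChain N p c' T' n' k' α')
    (hk : ∀ j < N, ∀ x ∈ Ioo (p j) (p (j + 1)), |k' x| ≤ k x)
    (hα : ∀ j, j + 1 < N → |α' (j + 1)| ≤ α (j + 1)) (hαπ : ∀ j, j + 1 < N → α (j + 1) < π)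
    {i : ℕ} (hi : i < N) {s : ℝ} (hs : s ∈ Icc (p i) (p (i + 1))) {e e' : E3} (he : ‖e‖ = 1)
    {θ θ' : ℝ} (hθ : θ < π) (hθ' : |θ'| ≤ θ)
    (hc : inner ℝ (c s) e = (0 : ℝ)) (hT : inner ℝ (T i s) e = cos θ)
    (hn : inner ℝ (n i s) e = -sin θ)
    (he' : e' = cos θ' • T' i s - sin θ' • n' i s)
    (hw : ∀ j < N, i ≤ j → ∀ x ∈ Icc (p j) (p (j + 1)), s ≤ x → inner ℝ (n j x) e ≤ (0 : ℝ))
    (hlen : p N - s < π + arcsin (inner ℝ (c (p N)) e)) :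
    (inner ℝ (c (p N)) e : ℝ) ≤ inner ℝ (c' (p N)) e' := by
  have hN : 0 < N := by omega
  have hp0 : p 0 ≤ s := (partition_mono h.lt (Nat.zero_le i) hi.le).trans hs.1
  have hsN : s ≤ p N := hs.2.trans (partition_mono h.lt (by omega : i + 1 ≤ N) le_rfl)
  have hpN : p N ∈ Icc (p (N - 1)) (p (N - 1 + 1)) := by
    rw [Nat.sub_add_cancel hN]
    exact ⟨partition_mono h.lt (by omega) le_rfl, le_rfl⟩
  set z : E3 := c' (p N) with hz
  have hz1 : ‖z‖ = 1 := h'.norm_c' hN ⟨hp0.trans hsN, le_rfl⟩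
  have hc1 : ‖c (p N)‖ = 1 := h.norm_c' hN ⟨hp0.trans hsN, le_rfl⟩
  have hθ0 : 0 ≤ θ := (abs_nonneg _).trans hθ'
  obtain ⟨m, hm, hmX⟩ := exists_height_bound hlen (by
    simpa [hc1, he] using abs_real_inner_le_norm (c (p N)) e)
  set G : ℕ → ℝ → ℝ := fun j x => leastHeight (inner ℝ (c x) e) (inner ℝ (T j x) e)
    (inner ℝ (n j x) e) (inner ℝ (c' x) z) (inner ℝ (T' j x) z) (inner ℝ (n' j x) z) with hG
  have hmono : -max (G i s) m ≤ -max (G (N - 1) (p N)) m := by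
    refine chain_le (lo := s) (hi := p N) (F := fun j x => -max (G j x) m) h.lt ?_ ?_
      (by omega) (by omega) hs hpN hsN le_rfl le_rfl
    · intro j hj hij x₁ x₂ h1 h12 h2 hs1 hN2
      have hco := (h.coords hj he).mono h1 h2
      have hco' := (h'.coords hj hz1).mono h1 h2
      refine neg_le_neg (leastHeight_antitone_arc h12 hco hco'
        (fun x hx => hk j hj x (Ioo_subset_Ioo h1 h2 hx))
        (fun x hx => hw j hj hij x ⟨h1.trans hx.1.le, hx.2.le.trans h2⟩ (hs1.trans hx.1.le)) ?_)
      intro x hx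
      -- latitude of `c x` and distance from `c' x` to the end point
      set lat := arcsin (inner ℝ (c x) e)
      set dist := arccos (inner ℝ (c' x) z)
      have hb := abs_real_inner_le_norm (c x) e
      rw [h.norm_c hj ⟨h1.trans hx.1.le, hx.2.le.trans h2⟩, he, one_mul, abs_le] at hb
      have hb' := abs_real_inner_le_norm (c' x) z
      rw [h'.norm_c hj ⟨h1.trans hx.1.le, hx.2.le.trans h2⟩, hz1, one_mul, abs_le] at hb'
      have e1 : sin lat = inner ℝ (c x) e := Real.sin_arcsin hb.1 hb.2
      have e2 : cos dist = inner ℝ (c' x) z := Real.cos_arccos hb'.1 hb'.2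
      have e3 : cos lat = √(1 - inner ℝ (c x) e ^ 2) := Real.cos_arcsin _
      have e4 : sin dist = √(1 - inner ℝ (c' x) z ^ 2) := Real.sin_arccos _
      rw [← e3, ← e4, ← e1, ← e2]
      have h3 : dist ≤ p N - x := h'.arccos_inner_le hN
        (hp0.trans (hs1.trans hx.1.le)) (hx.2.le.trans hN2) le_rfl
      have h4 : -(x - s) ≤ lat := by
        have := h.abs_arcsin_sub_le he hN hp0 (hs1.trans hx.1.le) (hx.2.le.trans hN2)
        rw [hc, Real.arcsin_zero, sub_zero] at this
        exact (abs_le.1 this).1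
      have h6 : 0 ≤ dist := Real.arccos_nonneg _
      have h7 : lat ≤ π / 2 := Real.arcsin_le_pi_div_two _
      have h5 := hmX (dist - lat) (by linarith) (by linarith)
      rw [Real.sin_sub, Real.cos_sub] at h5
      intro h8
      linarith [h5 (by linarith)]
    · intro j hj hij hs1 hN2
      refine neg_le_neg (max_le_max_right _ ?_)
      have hmem : p (j + 1) ∈ Icc (p j) (p (j + 1)) := right_mem_Icc.2 (h.lt j (by omega)).le
      have hmem' : p (j + 1) ∈ Icc (p (j + 1)) (p (j + 1 + 1)) :=
        left_mem_Icc.2 (h.lt (j + 1) hj).le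
      have hw1 := hw j (by omega) hij _ hmem hs1
      have hw2 := hw (j + 1) hj (by omega) _ hmem' hs1
      rw [h.inner_turn_n hj] at hw2
      have := leastInner_turn_le (u := inner ℝ (T j (p (j + 1))) e)
        (v := -inner ℝ (n j (p (j + 1))) e) (a := inner ℝ (T' j (p (j + 1))) z)
        (b := inner ℝ (n' j (p (j + 1))) z) (α := α (j + 1)) (α' := α' (j + 1))
        ⟨(abs_nonneg _).trans (hα j hj), hαπ j hj⟩ (hα j hj) (by linarith) (by linarith)
      simp only [hG, leastHeight]
      rw [h.inner_turn_T hj, h.inner_turn_n hj, h'.inner_turn_T hj, h'.inner_turn_n hj]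
      have e1 : -(-sin (α (j + 1)) * inner ℝ (T j (p (j + 1))) e +
          cos (α (j + 1)) * inner ℝ (n j (p (j + 1))) e) =
          sin (α (j + 1)) * inner ℝ (T j (p (j + 1))) e +
          cos (α (j + 1)) * -inner ℝ (n j (p (j + 1))) e := by ring
      have e2 : cos (α (j + 1)) * inner ℝ (T j (p (j + 1))) e +
          sin (α (j + 1)) * inner ℝ (n j (p (j + 1))) e =
          cos (α (j + 1)) * inner ℝ (T j (p (j + 1))) e -
          sin (α (j + 1)) * -inner ℝ (n j (p (j + 1))) e := by ring
      rw [e1, e2]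
      linarith
  -- at the end the second arc is a point, so the height is that of `c (p N)`
  have hend : G (N - 1) (p N) = inner ℝ (c (p N)) e := by
    have hon := orthonormal_triple_iff.1 (h'.orthonormal (N - 1) (by omega) _ hpN)
    have h1 : inner ℝ (c' (p N)) z = (1 : ℝ) := by
      rw [hz, real_inner_self_eq_norm_sq, hon.1, one_pow]
    have h2 : inner ℝ (T' (N - 1) (p N)) z = (0 : ℝ) := by rw [real_inner_comm]; exact hon.2.2.2.1
    have h3 : inner ℝ (n' (N - 1) (p N)) z = (0 : ℝ) := by
      rw [real_inner_comm]; exact hon.2.2.2.2.1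
    simp [hG, leastHeight, leastInner, h1, h2, h3]
  have hstart : G i s ≤ inner ℝ z e' := by
    set a : ℝ := inner ℝ (T' i s) z
    set b : ℝ := inner ℝ (n' i s) z
    have h1 := leastInner_turn_le (u := 1) (v := 0) (a := cos θ' * a - sin θ' * b)
      (b := sin θ' * a + cos θ' * b) ⟨hθ0, hθ⟩ hθ' le_rfl
      (by simpa using Real.sin_nonneg_of_nonneg_of_le_pi hθ0 hθ.le)
    have h2 := leastInner_le 1 0 (cos θ' * a - sin θ' * b) (sin θ' * a + cos θ' * b)
    have h3 : cos θ' * (cos θ' * a - sin θ' * b) + sin θ' * (sin θ' * a + cos θ' * b) = a := by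
      linear_combination a * Real.sin_sq_add_cos_sq θ'
    have h4 : -sin θ' * (cos θ' * a - sin θ' * b) + cos θ' * (sin θ' * a + cos θ' * b) = b := by
      linear_combination b * Real.sin_sq_add_cos_sq θ'
    rw [h3, h4] at h1
    simp only [mul_one, mul_zero, sub_zero, add_zero, one_mul, abs_zero, zero_mul] at h1 h2
    have h5 : (inner ℝ z e' : ℝ) = cos θ' * a - sin θ' * b := by
      rw [he', inner_sub_right, real_inner_smul_right, real_inner_smul_right,
        real_inner_comm, real_inner_comm (n' i s)]
    simp only [hG, leastHeight]
    rw [hc, hT, hn, neg_neg, zero_mul, zero_add, h5]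
    exact h1.trans h2
  rw [hend, neg_le_neg_iff] at hmono
  rcases le_max_iff.1 ((le_max_left _ _).trans hmono) with h1 | h1
  · exact h1.trans hstart
  · exact absurd h1 (not_le.2 hm)

end FrameChain

/-! ### The cross product -/

theorem inner_eq_coords (u v : E3) : (inner ℝ u v : ℝ) = u 0 * v 0 + u 1 * v 1 + u 2 * v 2 := by
  simp [PiLp.inner_apply, Fin.sum_univ_three, mul_comm]

@[simp] theorem cross_apply_zero (u v : E3) : cross u v 0 = u 1 * v 2 - u 2 * v 1 := by
  simp [cross, cross_apply]

@[simp] theorem cross_apply_one (u v : E3) : cross u v 1 = u 2 * v 0 - u 0 * v 2 := by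
  simp [cross, cross_apply]

@[simp] theorem cross_apply_two (u v : E3) : cross u v 2 = u 0 * v 1 - u 1 * v 0 := by
  simp [cross, cross_apply]

theorem inner_cross_cyclic (u v w : E3) :
    (inner ℝ u (cross v w) : ℝ) = inner ℝ v (cross w u) := by
  simp only [inner_eq_coords, cross_apply_zero, cross_apply_one, cross_apply_two]; ring

theorem cross_swap (u v : E3) : cross v u = -cross u v := by
  ext i; fin_cases i <;> simp <;> ring

theorem cross_self (u : E3) : cross u u = 0 := by
  ext i; fin_cases i <;> simp <;> ring

theorem inner_self_cross (u v : E3) : (inner ℝ u (cross u v) : ℝ) = 0 := by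
  simp only [inner_eq_coords, cross_apply_zero, cross_apply_one, cross_apply_two]; ring

theorem inner_cross_self (u v : E3) : (inner ℝ v (cross u v) : ℝ) = 0 := by
  simp only [inner_eq_coords, cross_apply_zero, cross_apply_one, cross_apply_two]; ring

theorem inner_cross_cross (u v w x : E3) : (inner ℝ (cross u v) (cross w x) : ℝ) =
    inner ℝ u w * inner ℝ v x - inner ℝ u x * inner ℝ v w := by
  simp only [inner_eq_coords, cross_apply_zero, cross_apply_one, cross_apply_two]; ring

theorem cross_cross_eq (u v w : E3) :
    cross u (cross v w) = (inner ℝ u w : ℝ) • v - (inner ℝ u v : ℝ) • w := by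
  ext i
  fin_cases i <;> simp [inner_eq_coords] <;> ring

theorem cross_add (u v w : E3) : cross u (v + w) = cross u v + cross u w := by
  ext i; fin_cases i <;> simp <;> ring

theorem cross_smul (u v : E3) (r : ℝ) : cross u (r • v) = r • cross u v := by
  ext i; fin_cases i <;> simp <;> ring

/-- Expansion of a vector in the basis `u`, `v`, `u × v`, multiplied by `‖u × v‖²`. -/
theorem norm_cross_sq_smul (u v x : E3) :
    (inner ℝ (cross u v) (cross u v) : ℝ) • x = (inner ℝ x (cross u v) : ℝ) • cross u v +
      ((inner ℝ x u * inner ℝ v v - inner ℝ x v * inner ℝ u v : ℝ) • u +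
        (inner ℝ x v * inner ℝ u u - inner ℝ x u * inner ℝ u v : ℝ) • v) := by
  ext i
  simp only [inner_eq_coords, PiLp.add_apply, PiLp.smul_apply, smul_eq_mul, cross_apply_zero,
    cross_apply_one, cross_apply_two]
  fin_cases i <;> simp <;> ring

theorem cross_frame {x T : E3} (hx : ‖x‖ = 1) (hT : ‖T‖ = 1) (hxT : inner ℝ x T = (0 : ℝ)) :
    cross x (cross x T) = -T ∧ cross T (cross x T) = x ∧
      Orthonormal ℝ ![x, T, cross x T] := by
  have hx' : (inner ℝ x x : ℝ) = 1 := by rw [real_inner_self_eq_norm_sq, hx, one_pow]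
  have hT' : (inner ℝ T T : ℝ) = 1 := by rw [real_inner_self_eq_norm_sq, hT, one_pow]
  have hTx : (inner ℝ T x : ℝ) = 0 := by rw [real_inner_comm]; exact hxT
  refine ⟨by rw [cross_cross_eq, hx', hxT]; simp, by rw [cross_cross_eq, hT', hTx]; simp,
    orthonormal_triple_iff.2 ⟨hx, hT, ?_, hxT, inner_self_cross _ _, inner_cross_self _ _⟩⟩
  have : (inner ℝ (cross x T) (cross x T) : ℝ) = 1 := by
    rw [inner_cross_cross, hx', hT', hxT, hTx]; ring
  rw [real_inner_self_eq_norm_sq] at this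
  exact (pow_eq_one_iff_of_nonneg (norm_nonneg _) two_ne_zero).1 this

/-! ### The moving frame of a piecewise spherical curve -/

section Frame

variable {L : ℝ} {N : ℕ} {p : ℕ → ℝ} {c : ℝ → E3}

/-- The unit tangent over the `j`-th closed piece. -/
noncomputable def pieceTangent (p : ℕ → ℝ) (c : ℝ → E3) (j : ℕ) (s : ℝ) : E3 :=
  derivWithin c (Icc (p j) (p (j + 1))) s

/-- The left unit normal over the `j`-th closed piece. -/
noncomputable def pieceNormal (p : ℕ → ℝ) (c : ℝ → E3) (j : ℕ) (s : ℝ) : E3 :=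
  cross (c s) (pieceTangent p c j s)

theorem IsPartition.mem_Icc (hp : IsPartition L N p) {j : ℕ} (hj : j < N) {s : ℝ}
    (hs : s ∈ Icc (p j) (p (j + 1))) : s ∈ Icc 0 L := by
  have h1 := partition_mono hp.lt (Nat.zero_le j) hj.le
  have h2 := partition_mono hp.lt (by omega : j + 1 ≤ N) le_rfl
  rw [hp.zero] at h1
  rw [hp.last] at h2
  exact ⟨h1.trans hs.1, hs.2.trans h2⟩

theorem hasDerivWithinAt_piece (hc : IsPiecewiseSphericalCurve L N p c) {j : ℕ} (hj : j < N) {s : ℝ}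
    (hs : s ∈ Icc (p j) (p (j + 1))) :
    HasDerivWithinAt c (pieceTangent p c j s) (Icc (p j) (p (j + 1))) s :=
  ((hc.contDiffOn_one j hj).differentiableOn (by norm_num) s hs).hasDerivWithinAt

theorem hasDerivAt_piece (hc : IsPiecewiseSphericalCurve L N p c)
    {j : ℕ} (hj : j < N) {s : ℝ} (hs : s ∈ Ioo (p j) (p (j + 1))) :
    HasDerivAt c (pieceTangent p c j s) s :=
  (hasDerivWithinAt_piece hc hj (Ioo_subset_Icc_self hs)).hasDerivAt (Icc_mem_nhds hs.1 hs.2)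

theorem pieceTangent_eq_deriv {j : ℕ} {s : ℝ} (hs : s ∈ Ioo (p j) (p (j + 1))) :
    pieceTangent p c j s = deriv c s :=
  derivWithin_of_mem_nhds (Icc_mem_nhds hs.1 hs.2)

theorem pieceTangent_eq_rightTangent (hc : IsPiecewiseSphericalCurve L N p c) {j : ℕ}
    (hj : j < N) {s : ℝ} (hs : s ∈ Ico (p j) (p (j + 1))) :
    pieceTangent p c j s = rightTangent c s := by
  refine (HasDerivWithinAt.derivWithin ?_ (uniqueDiffWithinAt_Ici s)).symm
  exact (hasDerivWithinAt_piece hc hj (Ico_subset_Icc_self hs)).mono_of_mem_nhdsWithin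
    (mem_of_superset (Icc_mem_nhdsGE hs.2) (Icc_subset_Icc_left hs.1))

theorem pieceTangent_eq_leftTangent (hc : IsPiecewiseSphericalCurve L N p c) {j : ℕ}
    (hj : j < N) {s : ℝ} (hs : s ∈ Ioc (p j) (p (j + 1))) :
    pieceTangent p c j s = leftTangent c s := by
  refine (HasDerivWithinAt.derivWithin ?_ (uniqueDiffWithinAt_Iic s)).symm
  exact (hasDerivWithinAt_piece hc hj (Ioc_subset_Icc_self hs)).mono_of_mem_nhdsWithin
    (mem_of_superset (Icc_mem_nhdsLE hs.1) (Icc_subset_Icc_right hs.2))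

theorem continuousOn_pieceTangent (hp : IsPartition L N p)
    (hc : IsPiecewiseSphericalCurve L N p c) {j : ℕ} (hj : j < N) :
    ContinuousOn (pieceTangent p c j) (Icc (p j) (p (j + 1))) :=
  (hc.contDiffOn_one j hj).continuousOn_derivWithin (uniqueDiffOn_Icc (hp.lt j hj)) le_rfl

/-- A closed condition on the frame that holds inside a piece holds on the closed piece. -/
theorem eq_on_piece (hp : IsPartition L N p) {j : ℕ} (hj : j < N) {F : ℝ → ℝ} {r : ℝ}
    (hF : ContinuousOn F (Icc (p j) (p (j + 1)))) (h : ∀ s ∈ Ioo (p j) (p (j + 1)), F s = r)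
    {s : ℝ} (hs : s ∈ Icc (p j) (p (j + 1))) : F s = r := by
  have h1 : EqOn F (fun _ => r) (closure (Ioo (p j) (p (j + 1)))) := by
    refine EqOn.of_subset_closure (s := Ioo (p j) (p (j + 1))) h ?_ continuousOn_const
      subset_closure subset_rfl
    rwa [closure_Ioo (hp.lt j hj).ne]
  rw [closure_Ioo (hp.lt j hj).ne] at h1
  exact h1 hs

theorem norm_pieceTangent (hp : IsPartition L N p) (hc : IsPiecewiseSphericalCurve L N p c)
    {j : ℕ} (hj : j < N) {s : ℝ} (hs : s ∈ Icc (p j) (p (j + 1))) :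
    ‖pieceTangent p c j s‖ = 1 := by
  refine eq_on_piece hp hj (continuousOn_pieceTangent hp hc hj).norm ?_ hs
  intro x hx
  rw [pieceTangent_eq_deriv hx, hc.unit_speed j hj x hx]

theorem norm_curve (hp : IsPartition L N p) (hc : IsPiecewiseSphericalCurve L N p c)
    {j : ℕ} (hj : j < N) {s : ℝ} (hs : s ∈ Icc (p j) (p (j + 1))) : ‖c s‖ = 1 := by
  simpa using hc.mem_sphere s (hp.mem_Icc hj hs)

theorem inner_pieceTangent (hp : IsPartition L N p) (hc : IsPiecewiseSphericalCurve L N p c)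
    {j : ℕ} (hj : j < N) {s : ℝ} (hs : s ∈ Icc (p j) (p (j + 1))) :
    (inner ℝ (c s) (pieceTangent p c j s) : ℝ) = 0 := by
  refine eq_on_piece hp hj (F := fun s => inner ℝ (c s) (pieceTangent p c j s))
    ((hc.contDiffOn_one j hj).continuousOn.inner (continuousOn_pieceTangent hp hc hj)) ?_ hs
  intro x hx
  have h1 := (hasDerivAt_piece hc hj hx).inner ℝ (hasDerivAt_piece hc hj hx)
  have h2 : (fun t => (inner ℝ (c t) (c t) : ℝ)) =ᶠ[𝓝 x] fun _ => 1 := by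
    filter_upwards [Icc_mem_nhds hx.1 hx.2] with t ht
    rw [real_inner_self_eq_norm_sq, norm_curve hp hc hj ht, one_pow]
  have h3 := h1.unique ((hasDerivAt_const x (1 : ℝ)).congr_of_eventuallyEq h2)
  rw [real_inner_comm (c x) (pieceTangent p c j x)] at h3
  linarith

theorem orthonormal_piece (hp : IsPartition L N p) (hc : IsPiecewiseSphericalCurve L N p c)
    {j : ℕ} (hj : j < N) {s : ℝ} (hs : s ∈ Icc (p j) (p (j + 1))) :
    Orthonormal ℝ ![c s, pieceTangent p c j s, pieceNormal p c j s] :=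
  (cross_frame (norm_curve hp hc hj hs) (norm_pieceTangent hp hc hj hs)
    (inner_pieceTangent hp hc hj hs)).2.2

theorem hasDerivAt_pieceTangent (hp : IsPartition L N p)
    (hc : IsPiecewiseSphericalCurve L N p c) {j : ℕ} (hj : j < N) {s : ℝ}
    (hs : s ∈ Ioo (p j) (p (j + 1))) :
    HasDerivAt (pieceTangent p c j) (-c s + geodesicCurvature c s • pieceNormal p c j s) s := by
  have h1 : DifferentiableAt ℝ (deriv c) s :=
    (((hc.contDiffOn_two j hj).deriv_of_isOpen (m := 1) isOpen_Ioo (by norm_num)).differentiableOn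
      (by norm_num) s hs).differentiableAt (isOpen_Ioo.mem_nhds hs)
  have heq : pieceTangent p c j =ᶠ[𝓝 s] deriv c := by
    filter_upwards [isOpen_Ioo.mem_nhds hs] with x hx using pieceTangent_eq_deriv hx
  have h2 : HasDerivAt (pieceTangent p c j) (deriv (deriv c) s) s :=
    h1.hasDerivAt.congr_of_eventuallyEq heq
  have hT : (inner ℝ (pieceTangent p c j s) (deriv (deriv c) s) : ℝ) = 0 := by
    have h3 := h2.inner ℝ h2
    have h4 : (fun t => (inner ℝ (pieceTangent p c j t) (pieceTangent p c j t) : ℝ)) =ᶠ[𝓝 s]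
        fun _ => 1 := by
      filter_upwards [Icc_mem_nhds hs.1 hs.2] with t ht
      rw [real_inner_self_eq_norm_sq, norm_pieceTangent hp hc hj ht, one_pow]
    have h5 := h3.unique ((hasDerivAt_const s (1 : ℝ)).congr_of_eventuallyEq h4)
    rw [real_inner_comm (pieceTangent p c j s) (deriv (deriv c) s)] at h5
    linarith
  have hcT : (inner ℝ (c s) (deriv (deriv c) s) : ℝ) = -1 := by
    have h3 := (hasDerivAt_piece hc hj hs).inner ℝ h2
    have h4 : (fun t => (inner ℝ (c t) (pieceTangent p c j t) : ℝ)) =ᶠ[𝓝 s] fun _ => 0 := by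
      filter_upwards [Icc_mem_nhds hs.1 hs.2] with t ht using inner_pieceTangent hp hc hj ht
    have h5 := h3.unique ((hasDerivAt_const s (0 : ℝ)).congr_of_eventuallyEq h4)
    rw [real_inner_self_eq_norm_sq, norm_pieceTangent hp hc hj (Ioo_subset_Icc_self hs)] at h5
    linarith
  have hn : (inner ℝ (pieceNormal p c j s) (deriv (deriv c) s) : ℝ) = geodesicCurvature c s := by
    rw [pieceNormal, pieceTangent_eq_deriv hs, real_inner_comm]
    rfl
  have := Orthonormal.eq_sum (orthonormal_piece hp hc hj (Ioo_subset_Icc_self hs))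
    (deriv (deriv c) s)
  rw [hT, hcT, hn] at this
  rw [this] at h2
  exact h2.congr_deriv (by simp)

theorem hasDerivAt_cross {f g : ℝ → E3} {f' g' : E3} {s : ℝ} (hf : HasDerivAt f f' s)
    (hg : HasDerivAt g g' s) :
    HasDerivAt (fun x => cross (f x) (g x)) (cross (f s) g' + cross f' (g s)) s := by
  have h : ∀ {v : ℝ → E3} {v' : E3}, HasDerivAt v v' s →
      ∀ i, HasDerivAt (fun x => v x i) (v' i) s :=
    fun hv i => (EuclideanSpace.proj (𝕜 := ℝ) i).hasFDerivAt.comp_hasDerivAt s hv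
  have h1 : HasDerivAt (fun x => WithLp.ofLp (cross (f x) (g x)))
      (WithLp.ofLp (cross (f s) g' + cross f' (g s))) s := by
    refine hasDerivAt_pi.2 fun i => ?_
    fin_cases i
    · simpa using! (((h hf 1).mul (h hg 2)).sub ((h hf 2).mul (h hg 1))).congr_deriv
        (g' := (cross (f s) g' + cross f' (g s)) 0) (by simp; ring)
    · simpa using! (((h hf 2).mul (h hg 0)).sub ((h hf 0).mul (h hg 2))).congr_deriv
        (g' := (cross (f s) g' + cross f' (g s)) 1) (by simp; ring)
    · simpa using! (((h hf 0).mul (h hg 1)).sub ((h hf 1).mul (h hg 0))).congr_deriv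
        (g' := (cross (f s) g' + cross f' (g s)) 2) (by simp; ring)
  exact (PiLp.continuousLinearEquiv 2 ℝ (fun _ : Fin 3 => ℝ)).symm.hasFDerivAt.comp_hasDerivAt s h1

theorem continuousOn_cross {f g : ℝ → E3} {S : Set ℝ} (hf : ContinuousOn f S)
    (hg : ContinuousOn g S) : ContinuousOn (fun x => cross (f x) (g x)) S := by
  have h : ∀ (v : ℝ → E3), ContinuousOn v S → ∀ i, ContinuousOn (fun x => v x i) S :=
    fun v hv i => (EuclideanSpace.proj (𝕜 := ℝ) i).continuous.comp_continuousOn hv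
  unfold SphericalSchur.cross
  refine (PiLp.continuous_toLp 2 _).comp_continuousOn (continuousOn_pi.2 fun i => ?_)
  fin_cases i
  · simpa [cross_apply] using! ((h f hf 1).mul (h g hg 2)).sub ((h f hf 2).mul (h g hg 1))
  · simpa [cross_apply] using! ((h f hf 2).mul (h g hg 0)).sub ((h f hf 0).mul (h g hg 2))
  · simpa [cross_apply] using! ((h f hf 0).mul (h g hg 1)).sub ((h f hf 1).mul (h g hg 0))

theorem hasDerivAt_pieceNormal (hp : IsPartition L N p)
    (hc : IsPiecewiseSphericalCurve L N p c) {j : ℕ} (hj : j < N) {s : ℝ}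
    (hs : s ∈ Ioo (p j) (p (j + 1))) :
    HasDerivAt (pieceNormal p c j) (-(geodesicCurvature c s • pieceTangent p c j s)) s := by
  have h1 := hasDerivAt_cross (hasDerivAt_piece hc hj hs) (hasDerivAt_pieceTangent hp hc hj hs)
  refine h1.congr_deriv ?_
  have hs' := Ioo_subset_Icc_self hs
  have h2 := (cross_frame (norm_curve hp hc hj hs') (norm_pieceTangent hp hc hj hs')
    (inner_pieceTangent hp hc hj hs')).1
  rw [cross_add, cross_smul, pieceNormal, h2, cross_self, ← neg_one_smul ℝ (c s), cross_smul,
    cross_self]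
  simp

/-- At a corner the frame turns about the point of the curve. -/
theorem piece_turn (hp : IsPartition L N p) (hc : IsPiecewiseSphericalCurve L N p c) {j : ℕ}
    (hj : j + 1 < N) {a : ℝ}
    (h1 : inner ℝ (pieceTangent p c j (p (j + 1))) (pieceTangent p c (j + 1) (p (j + 1))) = cos a)
    (h2 : inner ℝ (pieceNormal p c j (p (j + 1))) (pieceTangent p c (j + 1) (p (j + 1))) =
      sin a) :
    pieceTangent p c (j + 1) (p (j + 1)) = cos a • pieceTangent p c j (p (j + 1)) +
        sin a • pieceNormal p c j (p (j + 1)) ∧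
      pieceNormal p c (j + 1) (p (j + 1)) = -sin a • pieceTangent p c j (p (j + 1)) +
        cos a • pieceNormal p c j (p (j + 1)) := by
  have hm : p (j + 1) ∈ Icc (p j) (p (j + 1)) := right_mem_Icc.2 (hp.lt j (by omega)).le
  have hm' : p (j + 1) ∈ Icc (p (j + 1)) (p (j + 1 + 1)) :=
    left_mem_Icc.2 (hp.lt (j + 1) hj).le
  have h3 : pieceTangent p c (j + 1) (p (j + 1)) = cos a • pieceTangent p c j (p (j + 1)) +
      sin a • pieceNormal p c j (p (j + 1)) := by
    have := Orthonormal.eq_sum (orthonormal_piece hp hc (by omega) hm)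
      (pieceTangent p c (j + 1) (p (j + 1)))
    rw [inner_pieceTangent hp hc hj hm', h1, h2, zero_smul, zero_add] at this
    exact this
  refine ⟨h3, ?_⟩
  rw [pieceNormal, h3, cross_add, cross_smul, cross_smul]
  have h4 := (cross_frame (norm_curve hp hc (by omega) hm)
    (norm_pieceTangent hp hc (by omega) hm) (inner_pieceTangent hp hc (by omega) hm)).1
  rw [← pieceNormal] at h4 ⊢
  rw [h4]
  module

theorem turningAngle_eq (hp : IsPartition L N p) (hc : IsPiecewiseSphericalCurve L N p c)
    {j : ℕ} (hj : j + 1 < N) : turningAngle c (p (j + 1)) =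
      InnerProductGeometry.angle (pieceTangent p c j (p (j + 1)))
        (pieceTangent p c (j + 1) (p (j + 1))) := by
  rw [turningAngle, ← pieceTangent_eq_rightTangent hc hj
    (left_mem_Ico.2 (hp.lt (j + 1) hj)), ← pieceTangent_eq_leftTangent hc (by omega)
    (right_mem_Ioc.2 (hp.lt j (by omega)))]

theorem inner_tangents (hp : IsPartition L N p) (hc : IsPiecewiseSphericalCurve L N p c)
    {j : ℕ} (hj : j + 1 < N) :
    (inner ℝ (pieceTangent p c j (p (j + 1))) (pieceTangent p c (j + 1) (p (j + 1))) : ℝ) =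
        cos (turningAngle c (p (j + 1))) ∧
      |inner ℝ (pieceNormal p c j (p (j + 1))) (pieceTangent p c (j + 1) (p (j + 1)))| =
        sin (turningAngle c (p (j + 1))) := by
  have hm : p (j + 1) ∈ Icc (p j) (p (j + 1)) := right_mem_Icc.2 (hp.lt j (by omega)).le
  have hm' : p (j + 1) ∈ Icc (p (j + 1)) (p (j + 1 + 1)) :=
    left_mem_Icc.2 (hp.lt (j + 1) hj).le
  have h1 : (inner ℝ (pieceTangent p c j (p (j + 1))) (pieceTangent p c (j + 1) (p (j + 1))) : ℝ)
      = cos (turningAngle c (p (j + 1))) := by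
    rw [turningAngle_eq hp hc hj, InnerProductGeometry.cos_angle,
      norm_pieceTangent hp hc hj hm', norm_pieceTangent hp hc (by omega) hm]
    simp
  refine ⟨h1, ?_⟩
  have h2 := Orthonormal.inner_eq (orthonormal_piece hp hc (by omega) hm)
    (pieceTangent p c (j + 1) (p (j + 1))) (pieceTangent p c (j + 1) (p (j + 1)))
  rw [inner_pieceTangent hp hc hj hm', h1, real_inner_self_eq_norm_sq,
    norm_pieceTangent hp hc hj hm'] at h2
  have h3 : 0 ≤ sin (turningAngle c (p (j + 1))) :=
    Real.sin_nonneg_of_nonneg_of_le_pi (InnerProductGeometry.angle_nonneg _ _)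
      (InnerProductGeometry.angle_le_pi _ _)
  rw [← abs_of_nonneg h3, ← sq_eq_sq_iff_abs_eq_abs, Real.sin_sq]
  linarith

/-- A piecewise spherical curve is a chain of frames, whose turning angles may be any numbers with
the right sine and cosine. -/
theorem frameChain_of_turn (hp : IsPartition L N p) (hc : IsPiecewiseSphericalCurve L N p c)
    {α : ℕ → ℝ} (hα : ∀ j, j + 1 < N →
      inner ℝ (pieceTangent p c j (p (j + 1))) (pieceTangent p c (j + 1) (p (j + 1))) =
          cos (α (j + 1)) ∧
        inner ℝ (pieceNormal p c j (p (j + 1))) (pieceTangent p c (j + 1) (p (j + 1))) =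
          sin (α (j + 1))) :
    FrameChain N p c (pieceTangent p c) (pieceNormal p c) (geodesicCurvature c) α where
  lt := hp.lt
  cont_c _ hj := (hc.contDiffOn_one _ hj).continuousOn
  cont_T _ hj := continuousOn_pieceTangent hp hc hj
  cont_n _ hj := continuousOn_cross (hc.contDiffOn_one _ hj).continuousOn
    (continuousOn_pieceTangent hp hc hj)
  deriv_c _ hj _ hs := hasDerivAt_piece hc hj hs
  deriv_T _ hj _ hs := hasDerivAt_pieceTangent hp hc hj hs
  deriv_n _ hj _ hs := hasDerivAt_pieceNormal hp hc hj hs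
  orthonormal _ hj _ hs := orthonormal_piece hp hc hj hs
  turn_T j hj := (piece_turn hp hc hj (hα j hj).1 (hα j hj).2).1
  turn_n j hj := (piece_turn hp hc hj (hα j hj).1 (hα j hj).2).2

/-- The turning angles in a chain of frames are the unsigned ones of the curve, with signs. -/
theorem exists_frameChain (hp : IsPartition L N p) (hc : IsPiecewiseSphericalCurve L N p c) :
    ∃ α : ℕ → ℝ, (∀ j, j + 1 < N → |α (j + 1)| = turningAngle c (p (j + 1))) ∧
      FrameChain N p c (pieceTangent p c) (pieceNormal p c) (geodesicCurvature c) α := by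
  have : ∀ i, ∃ a : ℝ, ∀ j, j + 1 = i → j + 1 < N → |a| = turningAngle c (p (j + 1)) ∧
      inner ℝ (pieceTangent p c j (p (j + 1))) (pieceTangent p c (j + 1) (p (j + 1))) = cos a ∧
      inner ℝ (pieceNormal p c j (p (j + 1))) (pieceTangent p c (j + 1) (p (j + 1))) = sin a := by
    intro i
    rcases Nat.eq_zero_or_pos i with rfl | hi
    · exact ⟨0, fun j hj => by omega⟩
    obtain ⟨l, rfl⟩ := Nat.exists_eq_succ_of_ne_zero hi.ne'
    by_cases hl : l + 1 < N
    · obtain ⟨h1, h2⟩ := inner_tangents hp hc hl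
      have h3 : 0 ≤ turningAngle c (p (l + 1)) := InnerProductGeometry.angle_nonneg _ _
      rcases abs_choice
        (inner ℝ (pieceNormal p c l (p (l + 1))) (pieceTangent p c (l + 1) (p (l + 1)))) with h | h
      · refine ⟨turningAngle c (p (l + 1)), fun j hj _ => ?_⟩
        obtain rfl : j = l := by omega
        exact ⟨abs_of_nonneg h3, h1, by rw [← h2, h]⟩
      · refine ⟨-turningAngle c (p (l + 1)), fun j hj _ => ?_⟩
        obtain rfl : j = l := by omega
        exact ⟨by rw [abs_neg, abs_of_nonneg h3], by rw [h1, Real.cos_neg],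
          by rw [Real.sin_neg, ← h2, h, neg_neg]⟩
    · exact ⟨0, fun j hj h => by omega⟩
  choose α hα using this
  exact ⟨α, fun j hj => (hα (j + 1) j rfl hj).1,
    frameChain_of_turn hp hc fun j hj => (hα (j + 1) j rfl hj).2⟩

end Frame

namespace FrameChain

variable {N : ℕ} {p : ℕ → ℝ} {c : ℝ → E3} {T n : ℕ → ℝ → E3} {k : ℝ → ℝ} {α : ℕ → ℝ}

/-! ### Straight pieces -/

theorem inner_self_eq_sq_sum (h : FrameChain N p c T n k α) {j : ℕ} (hj : j < N) {s : ℝ}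
    (hs : s ∈ Icc (p j) (p (j + 1))) (e : E3) : inner ℝ (c s) e ^ 2 + inner ℝ (T j s) e ^ 2 +
      inner ℝ (n j s) e ^ 2 = (inner ℝ e e : ℝ) := by
  rw [Orthonormal.inner_eq (h.orthonormal j hj s hs) e e]
  ring

/-- A piece without curvature is an arc of a great circle. -/
theorem inner_c_of_curvature_zero (h : FrameChain N p c T n k α) {j : ℕ} (hj : j < N)
    (hk : ∀ x ∈ Ioo (p j) (p (j + 1)), k x = 0) (e : E3) {x x' : ℝ}
    (hx : x ∈ Icc (p j) (p (j + 1))) (hx' : x' ∈ Icc (p j) (p (j + 1))) :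
    (inner ℝ (c x') e : ℝ) = cos (x' - x) * inner ℝ (c x) e + sin (x' - x) * inner ℝ (T j x) e ∧
      (inner ℝ (T j x') e : ℝ) =
        -sin (x' - x) * inner ℝ (c x) e + cos (x' - x) * inner ℝ (T j x) e := by
  have cy : ContinuousOn (fun z => (inner ℝ (c z) e : ℝ)) (Icc (p j) (p (j + 1))) :=
    (h.cont_c j hj).inner continuousOn_const
  have cu : ContinuousOn (fun z => (inner ℝ (T j z) e : ℝ)) (Icc (p j) (p (j + 1))) :=
    (h.cont_T j hj).inner continuousOn_const
  have dy := fun z hz => h.hasDerivAt_inner_c hj (s := z) hz e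
  have du := fun z hz => h.hasDerivAt_inner_T hj (s := z) hz e
  have const : ∀ F : ℝ → ℝ, ContinuousOn F (Icc (p j) (p (j + 1))) →
      (∀ z ∈ Ioo (p j) (p (j + 1)), HasDerivAt F 0 z) → F x = F x' := by
    intro F hF hd
    have : ∀ a b, a ∈ Icc (p j) (p (j + 1)) → b ∈ Icc (p j) (p (j + 1)) → a ≤ b → F a = F b := by
      intro a b ha hb hab
      have hd' : ∀ z ∈ Ioo a b, HasDerivAt F 0 z := fun z hz => hd z (Ioo_subset_Ioo ha.1 hb.2 hz)
      have hF' := hF.mono (Icc_subset_Icc ha.1 hb.2)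
      refine le_antisymm
        (le_of_hasDerivAt_nonneg (F' := fun _ => 0) hab hF' hd' fun _ _ => le_rfl) ?_
      have := le_of_hasDerivAt_nonneg (F := fun z => -F z) (F' := fun _ => 0) hab hF'.neg
        (fun z hz => by simpa using! (hd' z hz).neg) fun _ _ => le_rfl
      linarith
    rcases le_total x x' with hle | hle
    · exact this x x' hx hx' hle
    · exact (this x' x hx' hx hle).symm
  have h1 := const (fun z => cos z * inner ℝ (c z) e - sin z * inner ℝ (T j z) e)
    ((Real.continuous_cos.continuousOn.mul cy).sub (Real.continuous_sin.continuousOn.mul cu))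
    (fun z hz => by
      refine (((Real.hasDerivAt_cos z).mul (dy z hz)).sub
        ((Real.hasDerivAt_sin z).mul (du z hz))).congr_deriv ?_
      rw [hk z hz]; ring)
  have h2 := const (fun z => sin z * inner ℝ (c z) e + cos z * inner ℝ (T j z) e)
    ((Real.continuous_sin.continuousOn.mul cy).add (Real.continuous_cos.continuousOn.mul cu))
    (fun z hz => by
      refine (((Real.hasDerivAt_sin z).mul (dy z hz)).add
        ((Real.hasDerivAt_cos z).mul (du z hz))).congr_deriv ?_
      rw [hk z hz]; ring)
  have h3 := Real.sin_sq_add_cos_sq x'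
  rw [Real.cos_sub, Real.sin_sub]
  constructor
  · linear_combination (-(inner ℝ (c x') e : ℝ)) * h3 - cos x' * h1 - sin x' * h2
  · linear_combination (-(inner ℝ (T j x') e : ℝ)) * h3 + sin x' * h1 - cos x' * h2

theorem planar_piece (h : FrameChain N p c T n k α) {j : ℕ} (hj : j < N) {m : E3} (hm : m ≠ 0)
    (hpl : ∀ x ∈ Icc (p j) (p (j + 1)), (inner ℝ (c x) m : ℝ) = 0) :
    (∀ x ∈ Ioo (p j) (p (j + 1)), k x = 0) ∧
      ∀ x ∈ Icc (p j) (p (j + 1)), (inner ℝ (T j x) m : ℝ) = 0 := by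
  have hu : ∀ x ∈ Ioo (p j) (p (j + 1)), (inner ℝ (T j x) m : ℝ) = 0 := by
    intro x hx
    refine (h.hasDerivAt_inner_c hj hx m).unique
      ((hasDerivAt_const x (0 : ℝ)).congr_of_eventuallyEq ?_)
    filter_upwards [Icc_mem_nhds hx.1 hx.2] with z hz using hpl z hz
  have hk : ∀ x ∈ Ioo (p j) (p (j + 1)), k x = 0 := by
    intro x hx
    have h1 := (h.hasDerivAt_inner_T hj hx m).unique
      ((hasDerivAt_const x (0 : ℝ)).congr_of_eventuallyEq (by
        filter_upwards [isOpen_Ioo.mem_nhds hx] with z hz using hu z hz))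
    have hx' := Ioo_subset_Icc_self hx
    rw [hpl x hx', neg_zero, zero_add] at h1
    refine (mul_eq_zero.1 h1).resolve_right fun h2 => hm ?_
    have h3 := h.inner_self_eq_sq_sum hj hx' m
    rw [hpl x hx', hu x hx, h2] at h3
    exact inner_self_eq_zero.1 (by rw [← h3]; norm_num : (inner ℝ m m : ℝ) = 0)
  refine ⟨hk, fun x hx => ?_⟩
  have hlt := h.lt j hj
  have hmid : (p j + p (j + 1)) / 2 ∈ Ioo (p j) (p (j + 1)) := ⟨by linarith, by linarith⟩
  rw [(h.inner_c_of_curvature_zero hj hk m (Ioo_subset_Icc_self hmid) hx).2,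
    hpl _ (Ioo_subset_Icc_self hmid), hu _ hmid]
  ring

/-- A curve without curvature and without corners is an arc of a great circle, so its end points
are at distance equal to its length. -/
theorem inner_ends_of_straight (h : FrameChain N p c T n k α) (hN : 0 < N)
    (hk : ∀ j < N, ∀ x ∈ Ioo (p j) (p (j + 1)), k x = 0)
    (hα : ∀ j, j + 1 < N → α (j + 1) = 0) :
    (inner ℝ (c (p 0)) (c (p N)) : ℝ) = cos (p N - p 0) := by
  have key : ∀ j < N,
      (∀ e : E3, (inner ℝ (c (p (j + 1))) e : ℝ) = cos (p (j + 1) - p 0) * inner ℝ (c (p 0)) e +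
        sin (p (j + 1) - p 0) * inner ℝ (T 0 (p 0)) e) ∧
      (∀ e : E3, (inner ℝ (T j (p (j + 1))) e : ℝ) = -sin (p (j + 1) - p 0) * inner ℝ (c (p 0)) e +
        cos (p (j + 1) - p 0) * inner ℝ (T 0 (p 0)) e) := by
    intro j
    induction j with
    | zero =>
      intro hj
      have hl := (h.lt 0 hj).le
      exact ⟨fun e => (h.inner_c_of_curvature_zero hj (hk 0 hj) e (left_mem_Icc.2 hl)
        (right_mem_Icc.2 hl)).1, fun e => (h.inner_c_of_curvature_zero hj (hk 0 hj) e
        (left_mem_Icc.2 hl) (right_mem_Icc.2 hl)).2⟩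
    | succ j ih =>
      intro hj
      obtain ⟨h1, h2⟩ := ih (by omega)
      have hl := (h.lt (j + 1) hj).le
      have h3 := fun e => h.inner_c_of_curvature_zero hj (hk (j + 1) hj) e (left_mem_Icc.2 hl)
        (right_mem_Icc.2 hl)
      have h4 : ∀ e : E3,
          (inner ℝ (T (j + 1) (p (j + 1))) e : ℝ) = inner ℝ (T j (p (j + 1))) e := by
        intro e
        rw [h.inner_turn_T hj, hα j hj]
        simp
      have h5 : p (j + 1 + 1) - p 0 = (p (j + 1 + 1) - p (j + 1)) + (p (j + 1) - p 0) := by ring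
      refine ⟨fun e => ?_, fun e => ?_⟩
      · rw [(h3 e).1, h4, h1, h2, h5, Real.cos_add, Real.sin_add]
        ring
      · rw [(h3 e).2, h4, h1, h2, h5, Real.cos_add, Real.sin_add]
        ring
  obtain ⟨M, rfl⟩ := Nat.exists_eq_succ_of_ne_zero hN.ne'
  have h0 : p 0 ∈ Icc (p 0) (p (0 + 1)) := left_mem_Icc.2 (h.lt 0 hN).le
  have hon := orthonormal_triple_iff.1 (h.orthonormal 0 hN _ h0)
  rw [real_inner_comm, Nat.succ_eq_add_one, (key M (by omega)).1, real_inner_self_eq_norm_sq,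
    hon.1, real_inner_comm, hon.2.2.2.1]
  ring

end FrameChain

/-! ### Convex chains -/

/-- A simple convex curve of length at most `π` with its left normals: each frame gives a great
circle of support, the curvature is nonnegative, and the corners turn left. -/
structure IsConvexChain (N : ℕ) (p : ℕ → ℝ) (c : ℝ → E3) (T n : ℕ → ℝ → E3) (k : ℝ → ℝ)
    (α : ℕ → ℝ) : Prop extends FrameChain N p c T n k α where
  pos : 0 < N
  length_le : p N - p 0 ≤ π
  n_eq : ∀ j < N, ∀ s ∈ Icc (p j) (p (j + 1)), n j s = cross (c s) (T j s)
  support : ∀ j < N, ∀ s ∈ Icc (p j) (p (j + 1)), ∀ t ∈ Icc (p 0) (p N),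
    (0 : ℝ) ≤ inner ℝ (n j s) (c t)
  k_nonneg : ∀ j < N, ∀ s ∈ Ioo (p j) (p (j + 1)), 0 ≤ k s
  turn_mem : ∀ j, j + 1 < N → α (j + 1) ∈ Icc 0 π
  simple : ∀ s ∈ Icc (p 0) (p N), ∀ t ∈ Icc (p 0) (p N), s < t → c s = c t → s = p 0 ∧ t = p N

namespace IsConvexChain

variable {N : ℕ} {p : ℕ → ℝ} {c : ℝ → E3} {T n : ℕ → ℝ → E3} {k : ℝ → ℝ} {α : ℕ → ℝ}

theorem mem_Icc (h : IsConvexChain N p c T n k α) {j : ℕ} (hj : j < N) {s : ℝ}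
    (hs : s ∈ Icc (p j) (p (j + 1))) : s ∈ Icc (p 0) (p N) :=
  ⟨(partition_mono h.lt (Nat.zero_le j) hj.le).trans hs.1,
    hs.2.trans (partition_mono h.lt (by omega) le_rfl)⟩

/-- A simple curve has no cusps: at a turn by `π` the curve would lie on one great circle, and
run back along itself. -/
theorem turn_lt_pi (h : IsConvexChain N p c T n k α) {j : ℕ} (hj : j + 1 < N) :
    α (j + 1) < π := by
  refine lt_of_le_of_ne (h.turn_mem j hj).2 fun hπ => ?_
  have hlt := h.lt j (by omega)
  have hlt' := h.lt (j + 1) hj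
  have hq : p (j + 1) ∈ Icc (p j) (p (j + 1)) := right_mem_Icc.2 hlt.le
  have hq' : p (j + 1) ∈ Icc (p (j + 1)) (p (j + 1 + 1)) := left_mem_Icc.2 hlt'.le
  set m := n j (p (j + 1)) with hm
  have hm0 : m ≠ 0 := by
    have := (orthonormal_triple_iff.1 (h.orthonormal j (by omega) _ hq)).2.2.1
    rw [← norm_ne_zero_iff, this]
    norm_num
  have hpl : ∀ t ∈ Icc (p 0) (p N), (inner ℝ (c t) m : ℝ) = 0 := by
    intro t ht
    have h1 := h.support j (by omega) _ hq t ht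
    have h2 := h.support (j + 1) hj _ hq' t ht
    rw [h.inner_turn_n hj, hπ, Real.sin_pi, Real.cos_pi] at h2
    rw [real_inner_comm]
    linarith
  have hk := (h.planar_piece (j := j) (by omega) hm0 fun x hx =>
    hpl x (h.mem_Icc (by omega) hx)).1
  have hk' := (h.planar_piece hj hm0 fun x hx => hpl x (h.mem_Icc hj hx)).1
  obtain ⟨ε, hε, hε1, hε2⟩ : ∃ ε > 0, ε < p (j + 1) - p j ∧ ε < p (j + 1 + 1) - p (j + 1) := by
    obtain ⟨ε, h1, h2⟩ := exists_between
      (lt_min (sub_pos.2 hlt) (sub_pos.2 hlt') : (0 : ℝ) < min (p (j + 1) - p j) _)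
    exact ⟨ε, h1, h2.trans_le (min_le_left _ _), h2.trans_le (min_le_right _ _)⟩
  have hx : p (j + 1) - ε ∈ Icc (p j) (p (j + 1)) := ⟨by linarith, by linarith⟩
  have hx' : p (j + 1) + ε ∈ Icc (p (j + 1)) (p (j + 1 + 1)) := ⟨by linarith, by linarith⟩
  have heq : c (p (j + 1) - ε) = c (p (j + 1) + ε) := by
    refine ext_inner_right ℝ fun e => ?_
    rw [(h.inner_c_of_curvature_zero (j := j) (by omega) hk e hq hx).1,
      (h.inner_c_of_curvature_zero hj hk' e hq' hx').1, h.inner_turn_T hj, hπ, Real.sin_pi,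
      Real.cos_pi, sub_sub_cancel_left, add_sub_cancel_left, Real.cos_neg, Real.sin_neg]
    ring
  have h0 := partition_mono h.lt (Nat.zero_le j) (by omega)
  have := h.simple _ (h.mem_Icc (by omega) hx) _ (h.mem_Icc hj hx') (by linarith) heq
  linarith [this.1]

theorem straight_of_planar (h : IsConvexChain N p c T n k α) {m : E3} (hm : m ≠ 0)
    (hpl : ∀ t ∈ Icc (p 0) (p N), (inner ℝ (c t) m : ℝ) = 0) :
    (∀ j < N, ∀ x ∈ Ioo (p j) (p (j + 1)), k x = 0) ∧ ∀ j, j + 1 < N → α (j + 1) = 0 := by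
  have hpc := fun j (hj : j < N) => h.planar_piece hj hm fun x hx => hpl x (h.mem_Icc hj hx)
  refine ⟨fun j hj => (hpc j hj).1, fun j hj => ?_⟩
  have hq : p (j + 1) ∈ Icc (p j) (p (j + 1)) := right_mem_Icc.2 (h.lt j (by omega)).le
  have hq' : p (j + 1) ∈ Icc (p (j + 1)) (p (j + 1 + 1)) := left_mem_Icc.2 (h.lt _ hj).le
  have h1 := (hpc (j + 1) hj).2 _ hq'
  have h2 := (hpc j (by omega)).2 _ hq
  rw [h.inner_turn_T hj, h2, mul_zero, zero_add] at h1
  have h3 : (inner ℝ (n j (p (j + 1))) m : ℝ) ≠ 0 := by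
    intro h3
    have h4 := h.inner_self_eq_sq_sum (by omega) hq m
    rw [h2, h3, hpl _ (h.mem_Icc (by omega) hq)] at h4
    exact hm (inner_self_eq_zero.1 (by rw [← h4]; norm_num : (inner ℝ m m : ℝ) = 0))
  have h5 := (mul_eq_zero.1 h1).resolve_right h3
  by_contra h6
  exact (Real.sin_pos_of_pos_of_lt_pi (lt_of_le_of_ne (h.turn_mem j hj).1 (Ne.symm h6))
    (h.turn_lt_pi hj)).ne' h5

/-- If the initial direction at `s` points straight to a later point of the curve, then the curve
runs straight to it: the great circle of support at any parameter forces the curve not to turn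
away, and there is no room to turn the other way; simplicity excludes going on beyond the
point. -/
theorem straight_to (h : IsConvexChain N p c T n k α) {i : ℕ} (hi : i < N) {s t : ℝ}
    (hs : s ∈ Icc (p i) (p (i + 1))) (hst : s < t) (ht : t ≤ p N) (hne : c s ≠ c t)
    (hT : sin (arccos (inner ℝ (c s) (c t))) ≤ inner ℝ (T i s) (c t)) :
    ∀ j < N, i ≤ j → ∀ x ∈ Icc (p j) (p (j + 1)), s ≤ x → x ≤ t →
      inner ℝ (T j x) (c t) = sin (t - x) ∧ inner ℝ (n j x) (c t) = (0 : ℝ) := by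
  have hs0 := (h.mem_Icc hi hs).1
  have htI : t ∈ Icc (p 0) (p N) := ⟨hs0.trans hst.le, ht⟩
  have hct : ‖c t‖ = 1 := h.norm_c' h.pos htI
  have hcs : ‖c s‖ = 1 := h.norm_c hi hs
  set r := arccos (inner ℝ (c s) (c t)) with hr
  have hr0 : 0 ≤ r := Real.arccos_nonneg _
  have hrt : r ≤ t - s := h.arccos_inner_le h.pos hs0 hst.le ht
  have hrπ : r ≤ π := Real.arccos_le_pi _
  have hcr : cos r = inner ℝ (c s) (c t) := by
    have hb := abs_real_inner_le_norm (c s) (c t)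
    rw [hcs, hct, one_mul, abs_le] at hb
    exact Real.cos_arccos hb.1 hb.2
  have hge : ∀ j < N, i ≤ j → ∀ x ∈ Icc (p j) (p (j + 1)), s ≤ x → x ≤ s + r →
      1 ≤ sin (r - (x - s)) * inner ℝ (T j x) (c t) +
        cos (r - (x - s)) * inner ℝ (c x) (c t) := by
    intro j hj hij x hx hsx hxr
    have hmono := chain_le (lo := s) (hi := s + r)
      (F := fun j x => sin (r - (x - s)) * inner ℝ (T j x) (c t) +
        cos (r - (x - s)) * inner ℝ (c x) (c t)) h.lt ?_ ?_ hij hj hs hx hsx le_rfl hxr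
    · simp only [sub_self, sub_zero, hcr] at hmono
      refine le_trans ?_ hmono
      have h1 : 0 ≤ sin r := Real.sin_nonneg_of_nonneg_of_le_pi hr0 hrπ
      rw [← hcr]
      nlinarith [Real.sin_sq_add_cos_sq r]
    · intro l hl _ x₁ x₂ h1 h12 h2 hlo hhi
      have hco := (h.coords hl hct).mono h1 h2
      refine le_of_hasDerivAt_nonneg
        (F := fun x => sin (r - (x - s)) * inner ℝ (T l x) (c t) +
          cos (r - (x - s)) * inner ℝ (c x) (c t))
        (F' := fun x => sin (r - (x - s)) * (k x * inner ℝ (n l x) (c t))) h12 ?_ ?_ ?_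
      · exact (Continuous.continuousOn (by fun_prop)).mul hco.cont_u |>.add
          ((Continuous.continuousOn (by fun_prop)).mul hco.cont_y)
      · intro x hx
        have hlin : HasDerivAt (fun x => r - (x - s)) (-1) x := by
          simpa using ((hasDerivAt_id x).sub_const s).const_sub r
        refine ((hlin.sin.mul (hco.deriv_u x hx)).add
          (hlin.cos.mul (hco.deriv_y x hx))).congr_deriv ?_
        ring
      · intro x hx
        have hx1 : x ∈ Ioo (p l) (p (l + 1)) := Ioo_subset_Ioo h1 h2 hx
        exact mul_nonneg (Real.sin_nonneg_of_nonneg_of_le_pi (by linarith [hx.2])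
          (by linarith [hx.1])) (mul_nonneg (h.k_nonneg l hl x hx1)
          (h.support l hl x (Ioo_subset_Icc_self hx1) t htI))
    · intro l hl _ hlo hhi
      have hq : p (l + 1) ∈ Icc (p l) (p (l + 1)) := right_mem_Icc.2 (h.lt l (by omega)).le
      have hq' : p (l + 1) ∈ Icc (p (l + 1)) (p (l + 1 + 1)) := left_mem_Icc.2 (h.lt _ hl).le
      have hA := h.support l (by omega) _ hq t htI
      have hA' := h.support (l + 1) hl _ hq' t htI
      have hturn := h.inner_turn_T hl (c t)
      rw [h.inner_turn_n hl] at hA'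
      have hα := h.turn_mem l hl
      have hsα := Real.sin_nonneg_of_mem_Icc hα
      have hcα : 0 < 1 + cos (α (l + 1)) := by
        have := Real.cos_lt_cos_of_nonneg_of_le_pi hα.1 le_rfl (h.turn_lt_pi hl)
        rw [Real.cos_pi] at this
        linarith
      -- `(1 + cos α) (a₊ - a₋) = sin α (A₊ + A₋)`
      have hle : (inner ℝ (T l (p (l + 1))) (c t) : ℝ) ≤
          inner ℝ (T (l + 1) (p (l + 1))) (c t) := by
        rw [hturn, ← sub_nonneg]
        refine nonneg_of_mul_nonneg_right ?_ hcα
        refine (mul_nonneg hsα (add_nonneg hA hA')).trans_eq ?_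
        linear_combination
          (-inner ℝ (T l (p (l + 1))) (c t) : ℝ) * Real.sin_sq_add_cos_sq (α (l + 1))
      have := mul_le_mul_of_nonneg_left hle (Real.sin_nonneg_of_nonneg_of_le_pi
        (by linarith : 0 ≤ r - (p (l + 1) - s)) (by linarith))
      linarith
  have hall : ∀ j < N, i ≤ j → ∀ x ∈ Icc (p j) (p (j + 1)), s ≤ x → x ≤ s + r →
      inner ℝ (c x) (c t) = cos (r - (x - s)) ∧ inner ℝ (T j x) (c t) = sin (r - (x - s)) ∧
        inner ℝ (n j x) (c t) = (0 : ℝ) := by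
    intro j hj hij x hx hsx hxr
    have h1 := hge j hj hij x hx hsx hxr
    have h2 := h.inner_self_eq_sq_sum hj hx (c t)
    rw [real_inner_self_eq_norm_sq, hct] at h2
    have h3 := Real.sin_sq_add_cos_sq (r - (x - s))
    have h4 : (inner ℝ (c x) (c t) - cos (r - (x - s))) ^ 2 +
        (inner ℝ (T j x) (c t) - sin (r - (x - s))) ^ 2 + inner ℝ (n j x) (c t) ^ 2 ≤ (0 : ℝ) := by
      nlinarith
    refine ⟨?_, ?_, ?_⟩
    · nlinarith [sq_nonneg (inner ℝ (c x) (c t) - cos (r - (x - s)) : ℝ),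
        sq_nonneg (inner ℝ (T j x) (c t) - sin (r - (x - s)) : ℝ),
        sq_nonneg (inner ℝ (n j x) (c t) : ℝ)]
    · nlinarith [sq_nonneg (inner ℝ (c x) (c t) - cos (r - (x - s)) : ℝ),
        sq_nonneg (inner ℝ (T j x) (c t) - sin (r - (x - s)) : ℝ),
        sq_nonneg (inner ℝ (n j x) (c t) : ℝ)]
    · nlinarith [sq_nonneg (inner ℝ (c x) (c t) - cos (r - (x - s)) : ℝ),
        sq_nonneg (inner ℝ (T j x) (c t) - sin (r - (x - s)) : ℝ),
        sq_nonneg (inner ℝ (n j x) (c t) : ℝ)]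
  have hrpos : 0 < r := by
    refine lt_of_le_of_ne hr0 fun h0 => hne ?_
    rw [← h0, Real.cos_zero] at hcr
    exact (inner_eq_one_iff_of_norm_eq_one hcs hct).1 hcr.symm
  -- the straight arc reaches `c t` at the parameter `s + r`
  have hreach : c (s + r) = c t := by
    have hmem : s + r ∈ Icc (p 0) (p N) := ⟨by linarith, by linarith⟩
    obtain ⟨j, hj, hjx⟩ := exists_piece h.pos hmem
    have hij : i ≤ j := by
      by_contra! hji
      have : p (j + 1) ≤ p i := partition_mono h.lt hji hi.le
      linarith [hjx.2, hs.1]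
    have h1 := (hall j hj hij _ hjx (by linarith) le_rfl).1
    rw [show r - (s + r - s) = 0 by ring, Real.cos_zero] at h1
    exact (inner_eq_one_iff_of_norm_eq_one (h.norm_c' h.pos hmem) hct).1 h1
  have hsr : s + r = t := by
    refine le_antisymm (by linarith) (not_lt.1 fun hlt => ?_)
    have := (h.simple _ ⟨by linarith, by linarith⟩ _ htI hlt hreach).1
    linarith
  intro j hj hij x hx hsx hxt
  have h1 := hall j hj hij x hx hsx (by linarith)
  have h2 : r - (x - s) = t - x := by linarith
  rw [h2] at h1
  exact h1.2

end IsConvexChain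

theorem nonpos_of_hasDerivAt_of_le_left {f u : ℝ → ℝ} {a b : ℝ} (hab : a < b)
    (hf : ContinuousOn f (Icc a b)) (hu : ContinuousOn u (Icc a b))
    (hd : ∀ x ∈ Ioo a b, HasDerivAt f (u x) x) (hle : ∀ x ∈ Icc a b, f x ≤ f a) : u a ≤ 0 := by
  by_contra! hpos
  have h1 : ∀ᶠ x in 𝓝[Icc a b] a, 0 < u x :=
    (hu a (left_mem_Icc.2 hab.le)).eventually (lt_mem_nhds hpos)
  rw [nhdsWithin_Icc_eq_nhdsGE hab] at h1
  obtain ⟨r, hr, hsub⟩ := (mem_nhdsGE_iff_exists_mem_Ioc_Ico_subset hab).1 h1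
  have h2 : StrictMonoOn f (Icc a r) := by
    refine strictMonoOn_of_deriv_pos (convex_Icc _ _)
      (hf.mono (Icc_subset_Icc_right hr.2)) fun x hx => ?_
    rw [interior_Icc] at hx
    rw [(hd x ⟨hx.1, hx.2.trans_le hr.2⟩).deriv]
    exact hsub (Ioo_subset_Ico_self hx)
  have h3 := h2 (left_mem_Icc.2 hr.1.le) (right_mem_Icc.2 hr.1.le) hr.1
  linarith [hle r ⟨hr.1.le, hr.2⟩]

theorem nonneg_of_hasDerivAt_of_le_right {f u : ℝ → ℝ} {a b : ℝ} (hab : a < b)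
    (hf : ContinuousOn f (Icc a b)) (hu : ContinuousOn u (Icc a b))
    (hd : ∀ x ∈ Ioo a b, HasDerivAt f (u x) x) (hle : ∀ x ∈ Icc a b, f x ≤ f b) : 0 ≤ u b := by
  have hneg : MapsTo (fun x : ℝ => -x) (Icc (-b) (-a)) (Icc a b) := fun x hx =>
    ⟨by linarith [hx.2], by linarith [hx.1]⟩
  have := nonpos_of_hasDerivAt_of_le_left (f := fun x => f (-x)) (u := fun x => -u (-x))
    (neg_lt_neg hab) (hf.comp continuous_neg.continuousOn hneg)
    (hu.comp continuous_neg.continuousOn hneg).neg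
    (fun x hx => by
      have := (hd (-x) ⟨by linarith [hx.2], by linarith [hx.1]⟩).comp x (hasDerivAt_neg x)
      simpa [Function.comp_def] using this)
    (fun x hx => by simpa using hle (-x) (hneg hx))
  simpa using this

theorem exists_piece_Ico {N : ℕ} {p : ℕ → ℝ} {s : ℝ} (hs : s ∈ Ico (p 0) (p N)) :
    ∃ j < N, s ∈ Ico (p j) (p (j + 1)) := by
  by_contra! h
  have : ∀ j ≤ N, p j ≤ s := by
    intro j
    induction j with
    | zero => exact fun _ => hs.1
    | succ j ih =>
      intro hj
      by_contra! hlt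
      exact h j (by omega) ⟨ih (by omega), hlt⟩
  exact (this N le_rfl).not_gt hs.2

theorem exists_piece_Ioc {N : ℕ} {p : ℕ → ℝ} {s : ℝ} (hs : s ∈ Ioc (p 0) (p N)) :
    ∃ j < N, s ∈ Ioc (p j) (p (j + 1)) := by
  by_contra! h
  have : ∀ j ≤ N, p j < s := by
    intro j
    induction j with
    | zero => exact fun _ => hs.1
    | succ j ih =>
      intro hj
      by_contra! hlt
      exact h j (by omega) ⟨ih (by omega), hlt⟩
  exact (this N le_rfl).not_ge hs.2

namespace IsConvexChain

variable {N : ℕ} {p : ℕ → ℝ} {c : ℝ → E3} {T n : ℕ → ℝ → E3} {k : ℝ → ℝ} {α : ℕ → ℝ}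

/-! ### The order of points on a convex curve -/

/-- A curve that runs straight from its initial to its end point neither bends nor turns. -/
theorem straight_of_le_inner (h : IsConvexChain N p c T n k α) (hne : c (p 0) ≠ c (p N))
    (hT : sin (arccos (inner ℝ (c (p 0)) (c (p N)))) ≤ inner ℝ (T 0 (p 0)) (c (p N))) :
    (∀ j < N, ∀ x ∈ Ioo (p j) (p (j + 1)), k x = 0) ∧ ∀ j, j + 1 < N → α (j + 1) = 0 := by
  have hl0 := h.lt 0 h.pos
  have hlen := h.length_le
  have h0N : p 0 < p N := hl0.trans_le (partition_mono h.lt (by have := h.pos; omega) le_rfl)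
  have hst := fun j (hj : j < N) x hx => h.straight_to h.pos (left_mem_Icc.2 hl0.le) h0N le_rfl
    hne hT j hj (Nat.zero_le j) x hx (h.mem_Icc hj hx).1 (h.mem_Icc hj hx).2
  refine ⟨fun j hj x hx => ?_, fun j hj => ?_⟩
  · have hx' := Ioo_subset_Icc_self hx
    have h1 := (h.hasDerivAt_inner_n hj hx (c (p N))).unique
      ((hasDerivAt_const x (0 : ℝ)).congr_of_eventuallyEq (by
        filter_upwards [isOpen_Ioo.mem_nhds hx] with z hz
        exact (hst j hj z (Ioo_subset_Icc_self hz)).2))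
    rw [(hst j hj x hx').1, neg_eq_zero] at h1
    refine (mul_eq_zero.1 h1).resolve_right (Real.sin_pos_of_pos_of_lt_pi ?_ ?_).ne'
    · have := partition_mono h.lt (show j + 1 ≤ N by omega) le_rfl
      linarith [hx.2]
    · have := partition_mono h.lt (Nat.zero_le j) (by omega)
      linarith [hx.1]
  · have hq : p (j + 1) ∈ Icc (p j) (p (j + 1)) := right_mem_Icc.2 (h.lt j (by omega)).le
    have hq' : p (j + 1) ∈ Icc (p (j + 1)) (p (j + 1 + 1)) := left_mem_Icc.2 (h.lt _ hj).le
    have h1 := (hst (j + 1) hj _ hq').2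
    rw [h.inner_turn_n hj, (hst j (by omega) _ hq).1, (hst j (by omega) _ hq).2, mul_zero,
      add_zero, neg_mul, neg_eq_zero] at h1
    have hpos : 0 < sin (p N - p (j + 1)) := by
      refine Real.sin_pos_of_pos_of_lt_pi ?_ ?_
      · have := partition_mono h.lt (show j + 1 + 1 ≤ N by omega) le_rfl
        linarith [h.lt (j + 1) hj]
      · have := partition_mono h.lt (Nat.zero_le j) (by omega)
        linarith [h.lt j (by omega)]
    have h2 := (mul_eq_zero.1 h1).resolve_right hpos.ne'
    by_contra h3
    exact (Real.sin_pos_of_pos_of_lt_pi (lt_of_le_of_ne (h.turn_mem j hj).1 (Ne.symm h3))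
      (h.turn_lt_pi hj)).ne' h2

theorem exists_support (h : IsConvexChain N p c T n k α) {s : ℝ} (hs : s ∈ Icc (p 0) (p N)) :
    ∃ m : E3, m ≠ 0 ∧ inner ℝ m (c s) = (0 : ℝ) ∧
      ∀ t ∈ Icc (p 0) (p N), (0 : ℝ) ≤ inner ℝ m (c t) := by
  obtain ⟨j, hj, hjs⟩ := exists_piece h.pos hs
  have ho := orthonormal_triple_iff.1 (h.orthonormal j hj s hjs)
  refine ⟨n j s, ?_, by rw [real_inner_comm]; exact ho.2.2.2.2.1, h.support j hj s hjs⟩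
  rw [← norm_ne_zero_iff, ho.2.2.1]
  norm_num

theorem inner_lt_one (h : IsConvexChain N p c T n k α) {s t : ℝ} (hs : p 0 ≤ s) (hst : s < t)
    (ht : t ≤ p N) (hne : ¬(s = p 0 ∧ t = p N)) :
    (inner ℝ (c s) (c t) : ℝ) ^ 2 < 1 := by
  have hsI : s ∈ Icc (p 0) (p N) := ⟨hs, hst.le.trans ht⟩
  have htI : t ∈ Icc (p 0) (p N) := ⟨hs.trans hst.le, ht⟩
  have h1 := h.norm_c' h.pos hsI
  have h2 := h.norm_c' h.pos htI
  have hlt : (inner ℝ (c s) (c t) : ℝ) < 1 :=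
    (inner_lt_one_iff_real_of_norm_eq_one h1 h2).2 fun heq => hne (h.simple s hsI t htI hst heq)
  have hgt : -1 < (inner ℝ (c s) (c t) : ℝ) := by
    by_contra! hle
    have h3 := h.arccos_inner_le h.pos hs hst.le ht
    rw [Real.arccos_of_le_neg_one hle] at h3
    have := h.length_le
    exact hne ⟨by linarith, by linarith⟩
  rw [sq_lt_one_iff_abs_lt_one, abs_lt]
  exact ⟨hgt, hlt⟩

/-- If three points of a convex curve lie on one great circle, the curve lies on one side of that
circle: one of the three circles of support agrees with it. -/
theorem one_signed_of_collinear (h : IsConvexChain N p c T n k α) {s₀ s₁ s₂ : ℝ} (h0 : p 0 ≤ s₀)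
    (h02 : s₀ < s₂) (h21 : s₂ < s₁) (h1 : s₁ ≤ p N)
    (hne : (inner ℝ (c s₁) (c s₀) : ℝ) ^ 2 < 1)
    (hf : inner ℝ (c s₂) (cross (c s₁) (c s₀)) = (0 : ℝ)) :
    (∀ t ∈ Icc (p 0) (p N), (0 : ℝ) ≤ inner ℝ (c t) (cross (c s₁) (c s₀))) ∨
      ∀ t ∈ Icc (p 0) (p N), inner ℝ (c t) (cross (c s₁) (c s₀)) ≤ (0 : ℝ) := by
  have hI0 : s₀ ∈ Icc (p 0) (p N) := ⟨h0, by linarith⟩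
  have hI1 : s₁ ∈ Icc (p 0) (p N) := ⟨by linarith, h1⟩
  have hI2 : s₂ ∈ Icc (p 0) (p N) := ⟨by linarith, by linarith⟩
  have e0 : (inner ℝ (c s₀) (c s₀) : ℝ) = 1 := by
    rw [real_inner_self_eq_norm_sq, h.norm_c' h.pos hI0, one_pow]
  have e1 : (inner ℝ (c s₁) (c s₁) : ℝ) = 1 := by
    rw [real_inner_self_eq_norm_sq, h.norm_c' h.pos hI1, one_pow]
  have e2 : (inner ℝ (c s₂) (c s₂) : ℝ) = 1 := by
    rw [real_inner_self_eq_norm_sq, h.norm_c' h.pos hI2, one_pow]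
  have l0 := h.inner_lt_one h0 h02 (by linarith) (by rintro ⟨-, h⟩; linarith)
  have l1 := h.inner_lt_one (by linarith) h21 h1 (by rintro ⟨h, -⟩; linarith)
  rw [real_inner_comm] at l0
  set d : ℝ := inner ℝ (c s₁) (c s₀) with hd
  set a : ℝ := inner ℝ (c s₂) (c s₀) with ha
  set b : ℝ := inner ℝ (c s₂) (c s₁) with hb
  have hD : (inner ℝ (cross (c s₁) (c s₀)) (cross (c s₁) (c s₀)) : ℝ) = 1 - d ^ 2 := by
    rw [inner_cross_cross, e0, e1, real_inner_comm (c s₁) (c s₀), ← hd]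
    ring
  have hDpos : 0 < 1 - d ^ 2 := by linarith
  -- `(1 - d²) c₂ = (b - a d) c₁ + (a - b d) c₀`
  have hexp : ∀ m : E3, (1 - d ^ 2) * inner ℝ m (c s₂) =
      (b - a * d) * inner ℝ m (c s₁) + (a - b * d) * (inner ℝ m (c s₀) : ℝ) := by
    intro m
    have := congrArg (fun v => (inner ℝ m v : ℝ)) (norm_cross_sq_smul (c s₁) (c s₀) (c s₂))
    simp only [hf, hD, e0, e1, inner_add_right, real_inner_smul_right, ← hd, ← ha, ← hb] at this
    linarith
  have x1 := hexp (c s₀)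
  have x2 := hexp (c s₁)
  have x3 := hexp (c s₂)
  rw [real_inner_comm, ← ha, real_inner_comm, ← hd, e0] at x1
  rw [real_inner_comm, ← hb, e1, ← hd] at x2
  rw [e2, ← hb, ← ha] at x3
  have hX : a - b * d ≠ 0 := by
    intro hX
    rw [hX] at x3
    have h5 : a = b * d := by linarith
    rw [h5] at x3
    have : (1 - d ^ 2) * (1 - b ^ 2) = 0 := by linarith
    rcases mul_eq_zero.1 this with h6 | h6 <;> linarith
  have hZ : b - a * d ≠ 0 := by
    intro hZ
    rw [hZ] at x3
    have h5 : b = a * d := by linarith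
    rw [h5] at x3
    have : (1 - d ^ 2) * (1 - a ^ 2) = 0 := by linarith
    rcases mul_eq_zero.1 this with h6 | h6 <;> linarith
  obtain ⟨m, hm0, hm, hc0, hc1⟩ : ∃ m : E3, m ≠ 0 ∧
      (∀ t ∈ Icc (p 0) (p N), (0 : ℝ) ≤ inner ℝ m (c t)) ∧
      inner ℝ m (c s₀) = (0 : ℝ) ∧ inner ℝ m (c s₁) = (0 : ℝ) := by
    rcases lt_or_gt_of_ne hX with hX | hX <;> rcases lt_or_gt_of_ne hZ with hZ | hZ
    · obtain ⟨m, hm0, hms, hm⟩ := h.exists_support hI2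
      have h5 := hexp m
      rw [hms, mul_zero] at h5
      have g0 := mul_nonpos_of_nonpos_of_nonneg hX.le (hm _ hI0)
      have g1 := mul_nonpos_of_nonpos_of_nonneg hZ.le (hm _ hI1)
      exact ⟨m, hm0, hm, (mul_eq_zero.1 (by linarith)).resolve_left hX.ne,
        (mul_eq_zero.1 (by linarith)).resolve_left hZ.ne⟩
    · obtain ⟨m, hm0, hms, hm⟩ := h.exists_support hI1
      have h5 := hexp m
      rw [hms, mul_zero] at h5
      have g0 := hm _ hI0
      have g2 := mul_nonneg hDpos.le (hm _ hI2)
      exact ⟨m, hm0, hm, le_antisymm (nonpos_of_mul_nonneg_right (by linarith) hX) g0, hms⟩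
    · obtain ⟨m, hm0, hms, hm⟩ := h.exists_support hI0
      have h5 := hexp m
      rw [hms, mul_zero] at h5
      have g1 := hm _ hI1
      have g2 := mul_nonneg hDpos.le (hm _ hI2)
      exact ⟨m, hm0, hm, hms, le_antisymm (nonpos_of_mul_nonneg_right (by linarith) hZ) g1⟩
    · obtain ⟨m, hm0, hms, hm⟩ := h.exists_support hI2
      have h5 := hexp m
      rw [hms, mul_zero] at h5
      have g0 := mul_nonneg hX.le (hm _ hI0)
      have g1 := mul_nonneg hZ.le (hm _ hI1)
      exact ⟨m, hm0, hm, (mul_eq_zero.1 (by linarith)).resolve_left hX.ne',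
        (mul_eq_zero.1 (by linarith)).resolve_left hZ.ne'⟩
  have hmν := norm_cross_sq_smul (c s₁) (c s₀) m
  rw [hD, hc0, hc1] at hmν
  simp only [zero_mul, sub_zero, zero_smul, add_zero] at hmν
  have hν : ∀ t, (1 - d ^ 2) * inner ℝ m (c t) =
      inner ℝ m (cross (c s₁) (c s₀)) * inner ℝ (c t) (cross (c s₁) (c s₀)) := by
    intro t
    rw [← real_inner_smul_left, hmν, real_inner_smul_left,
      real_inner_comm (cross (c s₁) (c s₀)) (c t)]
  have hq : (inner ℝ m (cross (c s₁) (c s₀)) : ℝ) ≠ 0 := by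
    intro h5
    rw [h5, zero_smul] at hmν
    exact hm0 ((smul_eq_zero.1 hmν).resolve_left hDpos.ne')
  rcases lt_or_gt_of_ne hq with hq | hq
  · right
    intro t ht
    have := mul_nonneg hDpos.le (hm t ht)
    rw [hν] at this
    exact nonpos_of_mul_nonneg_right this hq
  · left
    intro t ht
    have := mul_nonneg hDpos.le (hm t ht)
    rw [hν] at this
    exact nonneg_of_mul_nonneg_right this hq

/-- Points met in succession on a convex curve form a positively oriented triple. -/
theorem det_nonneg (h : IsConvexChain N p c T n k α) {s₀ s₁ : ℝ} (h0 : p 0 ≤ s₀)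
    (h1 : s₁ ≤ p N) (hne : (inner ℝ (c s₁) (c s₀) : ℝ) ^ 2 < 1) {x : ℝ} (hx : x ∈ Icc s₀ s₁) :
    (0 : ℝ) ≤ inner ℝ (c x) (cross (c s₁) (c s₀)) := by
  by_contra! hneg
  set f : ℝ → ℝ := fun t => inner ℝ (c t) (cross (c s₁) (c s₀)) with hf
  have f0 : f s₀ = 0 := inner_cross_self _ _
  have f1 : f s₁ = 0 := inner_self_cross _ _
  have hx0 : s₀ < x := lt_of_le_of_ne hx.1 (by rintro rfl; exact hneg.ne f0)
  have hx1 : x < s₁ := lt_of_le_of_ne hx.2 (by rintro rfl; exact hneg.ne f1)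
  have hcont : ContinuousOn f (Icc (p 0) (p N)) := h.continuousOn_c.inner continuousOn_const
  have hle : ∀ y ∈ Icc s₀ s₁, f y ≤ 0 := by
    intro y hy
    by_contra! hpos
    have hy0 : s₀ < y := lt_of_le_of_ne hy.1 (by rintro rfl; exact hpos.ne' f0)
    have hy1 : y < s₁ := lt_of_le_of_ne hy.2 (by rintro rfl; exact hpos.ne' f1)
    have hsub : uIcc x y ⊆ Icc (p 0) (p N) := by
      refine uIcc_subset_Icc ⟨?_, ?_⟩ ⟨?_, ?_⟩ <;> linarith
    obtain ⟨z, hz, hz0⟩ := intermediate_value_uIcc (hcont.mono hsub)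
      (show (0 : ℝ) ∈ uIcc (f x) (f y) from mem_uIcc_of_le hneg.le hpos.le)
    have hz' : z ∈ Ioo s₀ s₁ := by
      rcases mem_uIcc.1 hz with h2 | h2
      · exact ⟨by linarith, by linarith⟩
      · exact ⟨by linarith, by linarith⟩
    rcases h.one_signed_of_collinear h0 hz'.1 hz'.2 h1 hne hz0 with h2 | h2
    · exact (h2 x ⟨by linarith, by linarith⟩).not_gt hneg
    · exact (h2 y ⟨by linarith, by linarith⟩).not_gt hpos
  obtain ⟨i, hi, his⟩ := exists_piece_Ico (show s₀ ∈ Ico (p 0) (p N) from ⟨h0, by linarith⟩)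
  have his' := Ico_subset_Icc_self his
  have hI1 : s₁ ∈ Icc (p 0) (p N) := ⟨by linarith, h1⟩
  -- `f` does not increase at `s₀`, so the initial direction points to `c s₁`
  have hT0 : (inner ℝ (T i s₀) (cross (c s₁) (c s₀)) : ℝ) ≤ 0 := by
    have hmin : s₀ < min (p (i + 1)) s₁ := lt_min his.2 (by linarith)
    have hs1 : Icc s₀ (min (p (i + 1)) s₁) ⊆ Icc (p i) (p (i + 1)) :=
      Icc_subset_Icc his.1 (min_le_left _ _)
    refine nonpos_of_hasDerivAt_of_le_left (f := f)
      (u := fun t => inner ℝ (T i t) (cross (c s₁) (c s₀))) hmin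
      (((h.cont_c i hi).inner continuousOn_const).mono hs1)
      (((h.cont_T i hi).inner continuousOn_const).mono hs1) (fun t ht => ?_) fun t ht => ?_
    · exact h.hasDerivAt_inner_c hi ⟨his.1.trans_lt ht.1, ht.2.trans_le (min_le_left _ _)⟩ _
    · rw [f0]
      exact hle t ⟨ht.1, ht.2.trans (min_le_right _ _)⟩
  have hTn : (inner ℝ (T i s₀) (cross (c s₁) (c s₀)) : ℝ) = inner ℝ (n i s₀) (c s₁) := by
    rw [h.n_eq i hi _ his', inner_cross_cyclic, real_inner_comm]
  have hn0 : (inner ℝ (n i s₀) (c s₁) : ℝ) = 0 :=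
    le_antisymm (hTn ▸ hT0) (h.support i hi _ his' _ hI1)
  have hsum := h.inner_self_eq_sq_sum hi his' (c s₁)
  rw [real_inner_self_eq_norm_sq, h.norm_c' h.pos hI1, hn0] at hsum
  have hrep := Orthonormal.eq_sum (h.orthonormal i hi _ his') (c s₁)
  rw [hn0, zero_smul, add_zero] at hrep
  rcases le_or_gt 0 (inner ℝ (T i s₀) (c s₁) : ℝ) with ha | ha
  · obtain ⟨j, hj, hjx⟩ := exists_piece h.pos (show x ∈ Icc (p 0) (p N) by
      exact ⟨by linarith, by linarith⟩)
    have hij : i ≤ j := by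
      by_contra! hji
      have : p (j + 1) ≤ p i := partition_mono h.lt hji hi.le
      linarith [hjx.2, his.1]
    have hstr := h.straight_to hi his' (by linarith) h1
      (fun heq => by
        rw [heq, real_inner_self_eq_norm_sq, h.norm_c' h.pos hI1] at hne
        norm_num at hne)
      (by
        rw [Real.sin_arccos]
        refine (Real.sqrt_le_left ha).2 ?_
        linarith) j hj hij x hjx hx0.le hx1.le
    have hpos : 0 < sin (s₁ - x) :=
      Real.sin_pos_of_pos_of_lt_pi (by linarith) (by linarith [h.length_le])
    have hrep' := Orthonormal.eq_sum (h.orthonormal j hj _ hjx) (c s₁)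
    rw [hstr.1, hstr.2, zero_smul, add_zero] at hrep'
    have hfx : f x = sin (s₁ - x) * inner ℝ (n j x) (c s₀) := by
      have e1 : f x = inner ℝ (c s₀) (cross (c x) (c s₁)) := by
        simp only [hf]
        rw [inner_cross_cyclic, inner_cross_cyclic]
      rw [e1, hrep', cross_add, cross_smul, cross_smul, inner_add_right, real_inner_smul_right,
        real_inner_smul_right, ← h.n_eq j hj x hjx, real_inner_comm (c s₀) (n j x)]
      rw [SphericalSchur.cross_self]
      simp
    have := mul_nonneg hpos.le (h.support j hj x hjx s₀ ⟨h0, by linarith⟩)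
    rw [← hfx] at this
    exact this.not_gt hneg
  · have hfx : f x = -inner ℝ (T i s₀) (c s₁) * inner ℝ (n i s₀) (c x) := by
      simp only [hf]
      rw [cross_swap, inner_neg_right]
      nth_rewrite 1 [hrep]
      rw [cross_add, cross_smul, cross_smul, inner_add_right, real_inner_smul_right,
        real_inner_smul_right, ← h.n_eq i hi _ his', real_inner_comm (n i s₀) (c x)]
      rw [SphericalSchur.cross_self]
      simp
    have := mul_nonneg (neg_nonneg.2 ha.le)
      (h.support i hi _ his' x ⟨by linarith, by linarith⟩)
    rw [← hfx] at this
    exact this.not_gt hneg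

end IsConvexChain

namespace FrameChain

variable {N : ℕ} {p : ℕ → ℝ} {c : ℝ → E3} {T n : ℕ → ℝ → E3} {k : ℝ → ℝ} {α : ℕ → ℝ}

/-! ### Monotone ratios along the dual curve -/

/-- The curve of normals of a convex curve runs monotonically around the axis perpendicular to
`z` and `x`, as long as the curve stays on one side of the plane of `z` and `x`. -/
theorem inner_n_div_le (h : FrameChain N p c T n k α)
    (hk : ∀ j < N, ∀ s ∈ Ioo (p j) (p (j + 1)), 0 ≤ k s)
    (hα : ∀ j, j + 1 < N → 0 ≤ sin (α (j + 1))) {z x : E3} {i : ℕ} {s : ℝ}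
    (hs : s ∈ Icc (p i) (p (i + 1)))
    (hx : ∀ j < N, i ≤ j → ∀ y ∈ Icc (p j) (p (j + 1)), s ≤ y → (0 : ℝ) < inner ℝ (n j y) x)
    (hzx : ∀ j < N, i ≤ j → ∀ y ∈ Icc (p j) (p (j + 1)), s ≤ y →
      inner ℝ (n j y) z * inner ℝ (T j y) x ≤ inner ℝ (T j y) z * (inner ℝ (n j y) x : ℝ))
    {j : ℕ} (hj : j < N) (hij : i ≤ j) {y : ℝ} (hy : y ∈ Icc (p j) (p (j + 1))) (hsy : s ≤ y) :
    (inner ℝ (n j y) z / inner ℝ (n j y) x : ℝ) ≤ inner ℝ (n i s) z / inner ℝ (n i s) x := by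
  rw [← neg_le_neg_iff]
  refine chain_le (lo := s) (hi := y) (F := fun j y => -(inner ℝ (n j y) z / inner ℝ (n j y) x : ℝ))
    h.lt ?_ ?_ hij hj hs hy hsy le_rfl le_rfl
  · intro l hl hil a b ha hab hb hsa _
    have hsub : Icc a b ⊆ Icc (p l) (p (l + 1)) := Icc_subset_Icc ha hb
    have hpos : ∀ w ∈ Icc a b, (0 : ℝ) < inner ℝ (n l w) x := fun w hw =>
      hx l hl hil w (hsub hw) (hsa.trans hw.1)
    have hcont := fun v : E3 => ((h.cont_n l hl).mono hsub).inner
      (continuousOn_const (c := v)) (𝕜 := ℝ)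
    refine le_of_hasDerivAt_nonneg (F := fun y => -(inner ℝ (n l y) z / inner ℝ (n l y) x : ℝ))
      (F' := fun w => k w * (inner ℝ (T l w) z * inner ℝ (n l w) x -
        inner ℝ (n l w) z * inner ℝ (T l w) x) / inner ℝ (n l w) x ^ 2) hab
      ((hcont z).div (hcont x) fun w hw => (hpos w hw).ne').neg (fun w hw => ?_) fun w hw => ?_
    · have hw' : w ∈ Ioo (p l) (p (l + 1)) := Ioo_subset_Ioo ha hb hw
      refine ((h.hasDerivAt_inner_n hl hw' z).div (h.hasDerivAt_inner_n hl hw' x)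
        (hpos w (Ioo_subset_Icc_self hw)).ne').neg.congr_deriv ?_
      ring
    · have hw' := Ioo_subset_Icc_self hw
      exact div_nonneg (mul_nonneg (hk l hl w (Ioo_subset_Ioo ha hb hw))
        (sub_nonneg.2 (hzx l hl hil w (hsub hw') (hsa.trans hw'.1)))) (sq_nonneg _)
  · intro l hl hil hsl _
    have hq : p (l + 1) ∈ Icc (p l) (p (l + 1)) := right_mem_Icc.2 (h.lt l (by omega)).le
    have hq' : p (l + 1) ∈ Icc (p (l + 1)) (p (l + 1 + 1)) := left_mem_Icc.2 (h.lt _ hl).le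
    refine neg_le_neg ?_
    rw [div_le_div_iff₀ (hx (l + 1) hl (by omega) _ hq' hsl) (hx l (by omega) hil _ hq hsl),
      h.inner_turn_n hl, h.inner_turn_n hl]
    have := mul_le_mul_of_nonneg_left (hzx l (by omega) hil _ hq hsl) (hα l hl)
    linarith

/-- Let the frame at `s` be the frame `(e, m)` turned by an angle `θ`, where `e` lies in the plane
of `z` and `z₀`. If the curve stays on the positive side of the planes of `z`, `z₀` and of `z`,
`v`, its normals stay on the negative side of `e`. The vector `v` serves to keep a denominator
positive at parameters where the tangent great circle contains `z` and `z₀`. -/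
theorem inner_n_nonpos (h : FrameChain N p c T n k α)
    (hk : ∀ j < N, ∀ s ∈ Ioo (p j) (p (j + 1)), 0 ≤ k s)
    (hα : ∀ j, j + 1 < N → 0 ≤ sin (α (j + 1))) {z z₀ v e m : E3} {i : ℕ} (hi : i < N) {s θ M : ℝ}
    (hs : s ∈ Icc (p i) (p (i + 1))) (hθ : 0 ≤ sin θ)
    (hT : T i s = cos θ • e + sin θ • m) (hn : n i s = -sin θ • e + cos θ • m) (hM : 0 < M)
    (he : M • e = (inner ℝ m z₀ : ℝ) • z - (inner ℝ m z : ℝ) • z₀) (hmv : inner ℝ m v = (0 : ℝ))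
    (hmz : (0 : ℝ) < inner ℝ m z + inner ℝ m z₀)
    (hpos : ∀ j < N, i ≤ j → ∀ y ∈ Icc (p j) (p (j + 1)), s ≤ y → ∀ ε : ℝ, 0 < ε →
      (0 : ℝ) < inner ℝ (n j y) (z + z₀ + ε • v))
    (hz : ∀ j < N, i ≤ j → ∀ y ∈ Icc (p j) (p (j + 1)), s ≤ y →
      inner ℝ (n j y) z * inner ℝ (T j y) z₀ ≤ inner ℝ (T j y) z * (inner ℝ (n j y) z₀ : ℝ))
    (hv : ∀ j < N, i ≤ j → ∀ y ∈ Icc (p j) (p (j + 1)), s ≤ y →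
      inner ℝ (n j y) z * inner ℝ (T j y) v ≤ inner ℝ (T j y) z * (inner ℝ (n j y) v : ℝ))
    {j : ℕ} (hj : j < N) (hij : i ≤ j) {y : ℝ} (hy : y ∈ Icc (p j) (p (j + 1))) (hsy : s ≤ y) :
    inner ℝ (n j y) e ≤ (0 : ℝ) := by
  have key : ∀ ε : ℝ, 0 < ε →
      (M * inner ℝ (n j y) e : ℝ) ≤ ε * (inner ℝ m z * inner ℝ (n j y) v) := by
    intro ε hε
    have hzx : ∀ j < N, i ≤ j → ∀ y ∈ Icc (p j) (p (j + 1)), s ≤ y →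
        inner ℝ (n j y) z * inner ℝ (T j y) (z + z₀ + ε • v) ≤
          inner ℝ (T j y) z * (inner ℝ (n j y) (z + z₀ + ε • v) : ℝ) := by
      intro j hj hij y hy hsy
      simp only [inner_add_right, real_inner_smul_right]
      have := mul_le_mul_of_nonneg_left (hv j hj hij y hy hsy) hε.le
      linarith [hz j hj hij y hy hsy]
    have h1 := h.inner_n_div_le hk hα (z := z) hs
      (fun j hj hij y hy hsy => hpos j hj hij y hy hsy ε hε) hzx hj hij hy hsy
    have hmx : (inner ℝ m (z + z₀ + ε • v) : ℝ) = inner ℝ m z + inner ℝ m z₀ := by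
      rw [inner_add_right, inner_add_right, real_inner_smul_right, hmv]
      ring
    have h2 : (inner ℝ (n i s) z / inner ℝ (n i s) (z + z₀ + ε • v) : ℝ) ≤
        inner ℝ m z / (inner ℝ m z + inner ℝ m z₀) := by
      rw [div_le_div_iff₀ (hpos i hi le_rfl s hs le_rfl ε hε) hmz, ← hmx]
      have h3 := hzx i hi le_rfl s hs le_rfl
      rw [hT, hn] at h3
      rw [hn]
      generalize z + z₀ + ε • v = x at h3 ⊢
      simp only [inner_add_left, real_inner_smul_left] at h3 ⊢
      have h4 := mul_le_mul_of_nonneg_left h3 hθ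
      have h5 := Real.sin_sq_add_cos_sq θ
      have h6 : sin θ * ((cos θ * inner ℝ e z + sin θ * inner ℝ m z) *
          (-sin θ * inner ℝ e x + cos θ * inner ℝ m x)) -
          sin θ * ((-sin θ * inner ℝ e z + cos θ * inner ℝ m z) *
          (cos θ * inner ℝ e x + sin θ * inner ℝ m x)) =
          sin θ * (inner ℝ e z * inner ℝ m x - inner ℝ m z * inner ℝ e x : ℝ) := by
        linear_combination sin θ * (inner ℝ e z * inner ℝ m x - inner ℝ m z * inner ℝ e x : ℝ) * h5
      linarith
    have h3 := h1.trans h2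
    rw [div_le_div_iff₀ (hpos j hj hij y hy hsy ε hε) hmz] at h3
    have h4 : (M * inner ℝ (n j y) e : ℝ) =
        inner ℝ m z₀ * inner ℝ (n j y) z - inner ℝ m z * inner ℝ (n j y) z₀ := by
      rw [← real_inner_smul_right, he, inner_sub_right, real_inner_smul_right,
        real_inner_smul_right]
    simp only [inner_add_right, real_inner_smul_right] at h3
    linarith
  have h0 : (M * inner ℝ (n j y) e : ℝ) ≤ 0 := by
    have hlim : Tendsto (fun ε : ℝ => ε * (inner ℝ m z * inner ℝ (n j y) v)) (𝓝[>] 0) (𝓝 0) := by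
      have : Tendsto (fun ε : ℝ => ε * (inner ℝ m z * inner ℝ (n j y) v : ℝ)) (𝓝 0) (𝓝 (0 * _)) :=
        tendsto_id.mul_const _
      rw [zero_mul] at this
      exact this.mono_left nhdsWithin_le_nhds
    exact ge_of_tendsto hlim (by filter_upwards [self_mem_nhdsWithin] with ε hε using key ε hε)
  exact nonpos_of_mul_nonpos_right h0 hM

end FrameChain

namespace FrameChain

variable {N : ℕ} {p : ℕ → ℝ} {c c' : ℝ → E3} {T n T' n' : ℕ → ℝ → E3} {k k' : ℝ → ℝ}
  {α α' : ℕ → ℝ}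

/-- Comparison of heights over the axis `e`, for a curve seen from the frame `(e, m)` at its point
`c s`: here `e` lies in the plane of the end point and of `z₀`, and the positivity assumptions
express convexity. -/
theorem inner_end_le_of_frame (h : FrameChain N p c T n k α) (h' : FrameChain N p c' T' n' k' α')
    (hk : ∀ j < N, ∀ x ∈ Ioo (p j) (p (j + 1)), |k' x| ≤ k x)
    (hα : ∀ j, j + 1 < N → |α' (j + 1)| ≤ α (j + 1)) (hαπ : ∀ j, j + 1 < N → α (j + 1) < π)
    {i : ℕ} (hi : i < N) {s : ℝ} (hs : s ∈ Icc (p i) (p (i + 1))) {z₀ e m e' : E3} {θ θ' M : ℝ}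
    (hθ : θ < π) (hθ' : |θ'| ≤ θ) (ho : Orthonormal ℝ ![c s, e, m])
    (hT : T i s = cos θ • e + sin θ • m) (hn : n i s = -sin θ • e + cos θ • m)
    (he' : e' = cos θ' • T' i s - sin θ' • n' i s) (hM : 0 < M)
    (he : M • e = (inner ℝ m z₀ : ℝ) • c (p N) - (inner ℝ m (c (p N)) : ℝ) • z₀)
    (hmz : (0 : ℝ) < inner ℝ m (c (p N)) + inner ℝ m z₀)
    (hpos : ∀ j < N, i ≤ j → ∀ y ∈ Icc (p j) (p (j + 1)), s ≤ y → ∀ ε : ℝ, 0 < ε →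
      (0 : ℝ) < inner ℝ (n j y) (c (p N) + z₀ + ε • c s))
    (hz : ∀ j < N, i ≤ j → ∀ y ∈ Icc (p j) (p (j + 1)), s ≤ y →
      inner ℝ (n j y) (c (p N)) * inner ℝ (T j y) z₀ ≤
        inner ℝ (T j y) (c (p N)) * (inner ℝ (n j y) z₀ : ℝ))
    (hv : ∀ j < N, i ≤ j → ∀ y ∈ Icc (p j) (p (j + 1)), s ≤ y →
      inner ℝ (n j y) (c (p N)) * inner ℝ (T j y) (c s) ≤
        inner ℝ (T j y) (c (p N)) * (inner ℝ (n j y) (c s) : ℝ))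
    (hlen : p N - s < π + arcsin (inner ℝ (c (p N)) e)) :
    (inner ℝ (c (p N)) e : ℝ) ≤ inner ℝ (c' (p N)) e' := by
  obtain ⟨-, he1, hm1, hce, hcm, hem⟩ := orthonormal_triple_iff.1 ho
  have hee : (inner ℝ e e : ℝ) = 1 := by rw [real_inner_self_eq_norm_sq, he1, one_pow]
  have hme : (inner ℝ m e : ℝ) = 0 := by rw [real_inner_comm]; exact hem
  have hsin := Real.sin_nonneg_of_nonneg_of_le_pi ((abs_nonneg _).trans hθ') hθ.le
  refine h.inner_end_le h' hk hα hαπ hi hs he1 hθ hθ' hce ?_ ?_ he' ?_ hlen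
  · rw [hT, inner_add_left, real_inner_smul_left, real_inner_smul_left, hee, hme]
    ring
  · rw [hn, inner_add_left, real_inner_smul_left, real_inner_smul_left, hee, hme]
    ring
  · intro j hj hij y hy hsy
    exact h.inner_n_nonpos (fun j hj x hx => (abs_nonneg _).trans (hk j hj x hx))
      (fun j hj => Real.sin_nonneg_of_nonneg_of_le_pi ((abs_nonneg _).trans (hα j hj))
        (hαπ j hj).le) hi hs hsin hT hn hM he (by rw [real_inner_comm]; exact hcm) hmz hpos hz hv
      hj hij hy hsy

/-- The mirror image of `inner_end_le_of_frame`, from the point `c s` to the initial point. -/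
theorem inner_start_le_of_frame (h : FrameChain N p c T n k α)
    (h' : FrameChain N p c' T' n' k' α')
    (hk : ∀ j < N, ∀ x ∈ Ioo (p j) (p (j + 1)), |k' x| ≤ k x)
    (hα : ∀ j, j + 1 < N → |α' (j + 1)| ≤ α (j + 1)) (hαπ : ∀ j, j + 1 < N → α (j + 1) < π)
    {i : ℕ} (hi : i < N) {s : ℝ} (hs : s ∈ Icc (p i) (p (i + 1))) {z₀ e m e' : E3} {θ θ' M : ℝ}
    (hθ : θ < π) (hθ' : |θ'| ≤ θ) (ho : Orthonormal ℝ ![c s, e, m])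
    (hT : T i s = cos θ • e - sin θ • m) (hn : n i s = sin θ • e + cos θ • m)
    (he' : e' = cos θ' • T' i s + sin θ' • n' i s) (hM : 0 < M)
    (he : M • e = (inner ℝ m (c (p 0)) : ℝ) • z₀ - (inner ℝ m z₀ : ℝ) • c (p 0))
    (hmz : (0 : ℝ) < inner ℝ m (c (p 0)) + inner ℝ m z₀)
    (hpos : ∀ j ≤ i, ∀ y ∈ Icc (p j) (p (j + 1)), y ≤ s → ∀ ε : ℝ, 0 < ε →
      (0 : ℝ) < inner ℝ (n j y) (c (p 0) + z₀ + ε • c s))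
    (hz : ∀ j ≤ i, ∀ y ∈ Icc (p j) (p (j + 1)), y ≤ s →
      inner ℝ (T j y) (c (p 0)) * inner ℝ (n j y) z₀ ≤
        inner ℝ (n j y) (c (p 0)) * (inner ℝ (T j y) z₀ : ℝ))
    (hv : ∀ j ≤ i, ∀ y ∈ Icc (p j) (p (j + 1)), y ≤ s →
      inner ℝ (T j y) (c (p 0)) * inner ℝ (n j y) (c s) ≤
        inner ℝ (n j y) (c (p 0)) * (inner ℝ (T j y) (c s) : ℝ))
    (hlen : s - p 0 < π - arcsin (inner ℝ (c (p 0)) e)) :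
    (inner ℝ (c' (p 0)) e' : ℝ) ≤ inner ℝ (c (p 0)) e := by
  have hrev : ∀ P : ℕ → ℝ → Prop, (∀ j ≤ i, ∀ y ∈ Icc (p j) (p (j + 1)), y ≤ s → P j y) →
      ∀ j < N, N - 1 - i ≤ j → ∀ y ∈ Icc (0 - p (N - j)) (0 - p (N - (j + 1))), 0 - s ≤ y →
        P (N - 1 - j) (0 - y) := by
    intro P H j hj hij y hy hsy
    rw [show N - j = N - 1 - j + 1 by omega, show N - (j + 1) = N - 1 - j by omega] at hy
    exact H _ (by omega) _ ⟨by linarith [hy.2], by linarith [hy.1]⟩ (by linarith)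
  have hidx : N - 1 - (N - 1 - i) = i := by omega
  have hs0 : (0 : ℝ) - (0 - s) = s := by ring
  have hp0 : (0 : ℝ) - (0 - p (N - N)) = p 0 := by simp
  have key := (h.reverse 0).inner_end_le_of_frame (h'.reverse 0)
    (i := N - 1 - i) (s := 0 - s) (z₀ := z₀) (e := -e) (m := m) (e' := -e') (θ := θ) (θ' := θ')
    (M := M) ?_ ?_ ?_ (by omega) ?_ hθ hθ' ?_ ?_ ?_ ?_ hM ?_ ?_ ?_ ?_ ?_ ?_
  · simp only [hp0, inner_neg_right] at key
    linarith
  · intro j hj x hx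
    rw [show N - j = N - 1 - j + 1 by omega, show N - (j + 1) = N - 1 - j by omega] at hx
    exact hk (N - 1 - j) (by omega) _ ⟨by linarith [hx.2], by linarith [hx.1]⟩
  · intro j hj
    rw [show N - (j + 1) = N - 1 - (j + 1) + 1 by omega]
    exact hα _ (by omega)
  · intro j hj
    rw [show N - (j + 1) = N - 1 - (j + 1) + 1 by omega]
    exact hαπ _ (by omega)
  · rw [show N - (N - 1 - i) = i + 1 by omega, show N - (N - 1 - i + 1) = i by omega]
    exact ⟨by linarith [hs.2], by linarith [hs.1]⟩
  · rw [hs0]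
    rw [orthonormal_triple_iff] at ho ⊢
    simpa using ho
  · rw [hidx, hs0, hT]
    module
  · rw [hidx, hs0, hn]
    module
  · rw [hidx, hs0, he']
    module
  · rw [hp0, smul_neg, he]
    module
  · rw [hp0]
    exact hmz
  · simp only [hp0, hs0]
    exact hrev (fun j y => ∀ ε : ℝ, 0 < ε → (0 : ℝ) < inner ℝ (n j y) (c (p 0) + z₀ + ε • c s)) hpos
  · simp only [hp0, inner_neg_left]
    refine hrev (fun j y => inner ℝ (n j y) (c (p 0)) * -inner ℝ (T j y) z₀ ≤
        -inner ℝ (T j y) (c (p 0)) * (inner ℝ (n j y) z₀ : ℝ)) fun j hj y hy hys => ?_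
    linarith [hz j hj y hy hys]
  · simp only [hp0, hs0, inner_neg_left]
    refine hrev (fun j y => inner ℝ (n j y) (c (p 0)) * -inner ℝ (T j y) (c s) ≤
        -inner ℝ (T j y) (c (p 0)) * (inner ℝ (n j y) (c s) : ℝ)) fun j hj y hy hys => ?_
    linarith [hv j hj y hy hys]
  · rw [hp0, inner_neg_right, Real.arcsin_neg]
    simp only [Nat.sub_self]
    linarith

end FrameChain

/-- If `u` and `v` lie with the pole `e` on one great circle, on the same side of `e`, then moving
`u` down and `v` up, seen from the pole, increases their distance. -/
theorem inner_le_of_heights {u v e u' v' e' : E3} (hu : ‖u'‖ = 1) (hv : ‖v'‖ = 1)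
    (he : ‖e'‖ = 1)
    (hcos : cos (arccos (inner ℝ u e) - arccos (inner ℝ v e)) = inner ℝ u v)
    (h1 : (inner ℝ u' e' : ℝ) ≤ inner ℝ u e) (h2 : (inner ℝ u e : ℝ) ≤ inner ℝ v e)
    (h3 : (inner ℝ v e : ℝ) ≤ inner ℝ v' e') : (inner ℝ u' v' : ℝ) ≤ inner ℝ u v := by
  have hang : ∀ {x z : E3}, ‖x‖ = 1 → ‖z‖ = 1 →
      InnerProductGeometry.angle x z = arccos (inner ℝ x z) := by
    intro x z hx hz
    rw [InnerProductGeometry.angle, hx, hz]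
    simp
  have htri := InnerProductGeometry.angle_le_angle_add_angle u' v' e'
  rw [hang hu he, hang hv he] at htri
  have ha := Real.arccos_le_arccos h1
  have hb := Real.arccos_le_arccos h2
  have hd := Real.arccos_le_arccos h3
  have hcos' : (inner ℝ u' v' : ℝ) = cos (InnerProductGeometry.angle u' v') := by
    rw [InnerProductGeometry.cos_angle, hu, hv]
    simp
  rw [hcos', ← hcos]
  exact Real.cos_le_cos_of_nonneg_of_le_pi (sub_nonneg.2 hb)
    (InnerProductGeometry.angle_le_pi _ _) (by linarith)

/-- A pole on the great circle through `z` and `x`, given by the dual coordinates `a` and `b`. -/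
theorem cos_sub_arccos_of_pole {x z e : E3} (hx : ‖x‖ = 1) (hz : ‖z‖ = 1) (he : ‖e‖ = 1)
    {a b M : ℝ} (hM : 0 < M) (ha : 0 ≤ a) (hb : 0 ≤ b) (hMe : M • e = b • z - a • x) :
    cos (arccos (inner ℝ x e) - arccos (inner ℝ z e)) = inner ℝ x z := by
  have ex : (inner ℝ x x : ℝ) = 1 := by rw [real_inner_self_eq_norm_sq, hx, one_pow]
  have ez : (inner ℝ z z : ℝ) = 1 := by rw [real_inner_self_eq_norm_sq, hz, one_pow]
  set d : ℝ := inner ℝ x z with hd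
  have hd' : (inner ℝ z x : ℝ) = d := real_inner_comm _ _
  have m1 : M * inner ℝ x e = b * d - a := by
    rw [← real_inner_smul_right, hMe, inner_sub_right, real_inner_smul_right,
      real_inner_smul_right, ex, ← hd]
    ring
  have m2 : M * inner ℝ z e = b - a * d := by
    rw [← real_inner_smul_right, hMe, inner_sub_right, real_inner_smul_right,
      real_inner_smul_right, ez, hd']
    ring
  have m3 : M ^ 2 = a ^ 2 + b ^ 2 - 2 * a * b * d := by
    have : (inner ℝ (M • e) (M • e) : ℝ) = M ^ 2 := by
      rw [real_inner_self_eq_norm_sq, norm_smul, he, mul_one, Real.norm_eq_abs, sq_abs]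
    rw [← this, hMe]
    simp only [inner_sub_left, inner_sub_right, real_inner_smul_left, real_inner_smul_right, ex, ez,
      hd', ← hd]
    ring
  have b1 := abs_real_inner_le_norm x e
  have b2 := abs_real_inner_le_norm z e
  have b3 := abs_real_inner_le_norm x z
  rw [hx, he, one_mul, abs_le] at b1
  rw [hz, he, one_mul, abs_le] at b2
  rw [hx, hz, one_mul, abs_le, ← hd] at b3
  have hd2 : 0 ≤ 1 - d ^ 2 := by nlinarith
  have s1 : √(1 - (inner ℝ x e : ℝ) ^ 2) = b * √(1 - d ^ 2) / M := by
    rw [Real.sqrt_eq_iff_mul_self_eq (by nlinarith) (by positivity), div_mul_div_comm,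
      eq_div_iff (by positivity)]
    have := Real.mul_self_sqrt hd2
    linear_combination m3 - b ^ 2 * this - (M * inner ℝ x e + b * d - a) * m1
  have s2 : √(1 - (inner ℝ z e : ℝ) ^ 2) = a * √(1 - d ^ 2) / M := by
    rw [Real.sqrt_eq_iff_mul_self_eq (by nlinarith) (by positivity), div_mul_div_comm,
      eq_div_iff (by positivity)]
    have := Real.mul_self_sqrt hd2
    linear_combination m3 - a ^ 2 * this - (M * inner ℝ z e + b - a * d) * m2
  rw [Real.cos_sub, Real.cos_arccos b1.1 b1.2, Real.cos_arccos b2.1 b2.2, Real.sin_arccos,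
    Real.sin_arccos, s1, s2, div_mul_div_comm]
  have := Real.mul_self_sqrt hd2
  field_simp
  linear_combination (M * inner ℝ z e) * m1 + (b * d - a) * m2 + a * b * this - d * m3

theorem exists_split_angle {α α' θ : ℝ} (h : |α'| ≤ α) (hθ : θ ∈ Icc 0 α) :
    ∃ θ', |θ'| ≤ θ ∧ |α' - θ'| ≤ α - θ := by
  obtain ⟨h1, h2⟩ := abs_le.1 h
  obtain ⟨h3, h4⟩ := hθ
  rcases le_total α' θ with h5 | h5
  · rcases le_total (-θ) α' with h6 | h6
    · exact ⟨α', abs_le.2 ⟨h6, h5⟩, by simpa using h4⟩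
    · exact ⟨-θ, by rw [abs_neg, abs_of_nonneg h3], abs_le.2 ⟨by linarith, by linarith⟩⟩
  · exact ⟨θ, by rw [abs_of_nonneg h3], abs_le.2 ⟨by linarith, by linarith⟩⟩

namespace IsConvexChain

variable {N : ℕ} {p : ℕ → ℝ} {c c' : ℝ → E3} {T n T' n' : ℕ → ℝ → E3} {k k' : ℝ → ℝ}
  {α α' : ℕ → ℝ}

/-! ### The point farthest from the chord -/

theorem inner_T_nonneg_of_max (h : IsConvexChain N p c T n k α) {ν : E3} {s : ℝ}
    (hmax : ∀ x ∈ Icc (p 0) (p N), (inner ℝ (c x) ν : ℝ) ≤ inner ℝ (c s) ν) {j : ℕ} (hj : j < N)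
    (hs : s ∈ Ioc (p j) (p (j + 1))) : (0 : ℝ) ≤ inner ℝ (T j s) ν := by
  have hsub : Icc (p j) s ⊆ Icc (p j) (p (j + 1)) := Icc_subset_Icc_right hs.2
  exact nonneg_of_hasDerivAt_of_le_right (f := fun t => inner ℝ (c t) ν)
    (u := fun t => inner ℝ (T j t) ν) hs.1 (((h.cont_c j hj).mono hsub).inner continuousOn_const)
    (((h.cont_T j hj).mono hsub).inner continuousOn_const)
    (fun x hx => h.hasDerivAt_inner_c hj ⟨hx.1, hx.2.trans_le hs.2⟩ ν)
    fun x hx => hmax x (h.mem_Icc hj (hsub hx))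

theorem inner_T_nonpos_of_max (h : IsConvexChain N p c T n k α) {ν : E3} {s : ℝ}
    (hmax : ∀ x ∈ Icc (p 0) (p N), (inner ℝ (c x) ν : ℝ) ≤ inner ℝ (c s) ν) {j : ℕ} (hj : j < N)
    (hs : s ∈ Ico (p j) (p (j + 1))) : inner ℝ (T j s) ν ≤ (0 : ℝ) := by
  have hsub : Icc s (p (j + 1)) ⊆ Icc (p j) (p (j + 1)) := Icc_subset_Icc_left hs.1
  exact nonpos_of_hasDerivAt_of_le_left (f := fun t => inner ℝ (c t) ν)
    (u := fun t => inner ℝ (T j t) ν) hs.2 (((h.cont_c j hj).mono hsub).inner continuousOn_const)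
    (((h.cont_T j hj).mono hsub).inner continuousOn_const)
    (fun x hx => h.hasDerivAt_inner_c hj ⟨hs.1.trans_lt hx.1, hx.2⟩ ν)
    fun x hx => hmax x (h.mem_Icc hj (hsub hx))

/-- At an interior point where the height over a plane is maximal, some direction `e` between the
two one-sided tangents is parallel to the plane. It splits the turning angle of the corner, and a
second curve that turns less at that corner has a direction `e'` that splits its turning angle
accordingly. -/
theorem exists_pole (h : IsConvexChain N p c T n k α) (h' : FrameChain N p c' T' n' k' α')
    (hα : ∀ j, j + 1 < N → |α' (j + 1)| ≤ α (j + 1)) {ν : E3} {s : ℝ} (hs : s ∈ Ioo (p 0) (p N))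
    (hmax : ∀ x ∈ Icc (p 0) (p N), (inner ℝ (c x) ν : ℝ) ≤ inner ℝ (c s) ν) :
    ∃ e m e' : E3, m = cross (c s) e ∧ Orthonormal ℝ ![c s, e, m] ∧ ‖e'‖ = 1 ∧
      inner ℝ e ν = (0 : ℝ) ∧ (∀ t ∈ Icc (p 0) (p N), (0 : ℝ) ≤ inner ℝ m (c t)) ∧
      (∃ i < N, s ∈ Icc (p i) (p (i + 1)) ∧ ∃ θ θ' : ℝ, θ < π ∧ |θ'| ≤ θ ∧
        T i s = cos θ • e - sin θ • m ∧ n i s = sin θ • e + cos θ • m ∧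
        e' = cos θ' • T' i s + sin θ' • n' i s) ∧
      ∃ i < N, s ∈ Icc (p i) (p (i + 1)) ∧ ∃ θ θ' : ℝ, θ < π ∧ |θ'| ≤ θ ∧
        T i s = cos θ • e + sin θ • m ∧ n i s = -sin θ • e + cos θ • m ∧
        e' = cos θ' • T' i s - sin θ' • n' i s := by
  obtain ⟨i, hi, his⟩ := exists_piece_Ioc (Ioo_subset_Ioc_self hs)
  have his' := Ioc_subset_Icc_self his
  have hu := h.inner_T_nonneg_of_max hmax hi his
  rcases his.2.lt_or_eq with hlt | heq
  · have hu' := h.inner_T_nonpos_of_max hmax hi ⟨his.1.le, hlt⟩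
    refine ⟨T i s, n i s, T' i s, h.n_eq i hi s his', h.orthonormal i hi s his',
      (orthonormal_triple_iff.1 (h'.orthonormal i hi s his')).2.1, le_antisymm hu' hu,
      h.support i hi s his', ⟨i, hi, his', 0, 0, pi_pos, by simp, by simp, by simp, by simp⟩,
      ⟨i, hi, his', 0, 0, pi_pos, by simp, by simp, by simp, by simp⟩⟩
  · have hi1 : i + 1 < N := by
      by_contra! hle
      rw [heq, show i + 1 = N by omega] at hs
      exact lt_irrefl _ hs.2
    have hsr : s ∈ Ico (p (i + 1)) (p (i + 1 + 1)) := by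
      rw [heq]
      exact left_mem_Ico.2 (h.lt _ hi1)
    have hsr' := Ico_subset_Icc_self hsr
    have hu' := h.inner_T_nonpos_of_max hmax hi1 hsr
    have tT := h.turn_T i hi1
    have tn := h.turn_n i hi1
    have tT' := h'.turn_T i hi1
    have tn' := h'.turn_n i hi1
    rw [← heq] at tT tn tT' tn'
    have hα0 := h.turn_mem i hi1
    obtain ⟨θ, hθ, hθν⟩ : ∃ θ ∈ Icc 0 (α (i + 1)),
        cos θ * inner ℝ (T i s) ν + sin θ * inner ℝ (n i s) ν = (0 : ℝ) := by
      refine intermediate_value_Icc' (f := fun θ : ℝ => cos θ * inner ℝ (T i s) ν +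
        sin θ * (inner ℝ (n i s) ν : ℝ)) hα0.1 (Continuous.continuousOn (by fun_prop)) ⟨?_, ?_⟩
      · rw [tT, inner_add_left, real_inner_smul_left, real_inner_smul_left] at hu'
        exact hu'
      · simpa using hu
    obtain ⟨θ', hθ', hθα'⟩ := exists_split_angle (hα i hi1) hθ
    have hαπ := h.turn_lt_pi hi1
    obtain ⟨o1, o2, o3, o4, o5, o6⟩ := orthonormal_triple_iff.1 (h.orthonormal i hi s his')
    obtain ⟨o1', o2', o3', o4', o5', o6'⟩ :=
      orthonormal_triple_iff.1 (h'.orthonormal i hi s his')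
    have hrot : ∀ {x z : E3} (φ : ℝ), ‖x‖ = 1 → ‖z‖ = 1 → inner ℝ x z = (0 : ℝ) →
        ‖cos φ • x + sin φ • z‖ = 1 := by
      intro x z φ hx hz hxz
      rw [← pow_eq_one_iff_of_nonneg (norm_nonneg _) two_ne_zero, norm_add_sq_real, norm_smul,
        norm_smul, hx, hz, real_inner_smul_left, real_inner_smul_right, hxz]
      simp
    have hm : -sin θ • T i s + cos θ • n i s = cross (c s) (cos θ • T i s + sin θ • n i s) := by
      have := (cross_frame o1 o2 o4).1
      rw [← h.n_eq i hi s his'] at this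
      rw [cross_add, cross_smul, cross_smul, this, ← h.n_eq i hi s his']
      module
    have hce : inner ℝ (c s) (cos θ • T i s + sin θ • n i s) = (0 : ℝ) := by
      rw [inner_add_right, real_inner_smul_right, real_inner_smul_right, o4, o5]
      ring
    have hsc := Real.sin_sq_add_cos_sq θ
    have hsc' := Real.sin_sq_add_cos_sq θ'
    refine ⟨cos θ • T i s + sin θ • n i s, -sin θ • T i s + cos θ • n i s,
      cos θ' • T' i s + sin θ' • n' i s, hm, ?_, hrot θ' o2' o3' o6', ?_, ?_,
      ⟨i, hi, his', θ, θ', hθ.2.trans_lt hαπ, hθ', ?_, ?_, rfl⟩,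
      ⟨i + 1, hi1, hsr', α (i + 1) - θ, α' (i + 1) - θ', by linarith [hθ.1], hθα', ?_, ?_, ?_⟩⟩
    · rw [hm]
      exact (cross_frame o1 (hrot θ o2 o3 o6) hce).2.2
    · rw [inner_add_left, real_inner_smul_left, real_inner_smul_left, hθν]
    · intro t ht
      have g1 := h.support i hi s his' t ht
      have g2 := h.support (i + 1) hi1 s hsr' t ht
      rcases hα0.1.lt_or_eq with hpos | hzero
      · -- `sin α m` is a nonnegative combination of the two one-sided normals
        have hsα := Real.sin_pos_of_pos_of_lt_pi hpos hαπ
        have hsθ := Real.sin_nonneg_of_nonneg_of_le_pi hθ.1 (hθ.2.trans hαπ.le)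
        have hsαθ : 0 ≤ sin (α (i + 1) - θ) :=
          Real.sin_nonneg_of_nonneg_of_le_pi (by linarith [hθ.2]) (by linarith [hθ.1])
        refine nonneg_of_mul_nonneg_right (a := sin (α (i + 1))) ?_ hsα
        refine (add_nonneg (mul_nonneg hsαθ g1) (mul_nonneg hsθ g2)).trans_eq ?_
        rw [tn, Real.sin_sub]
        simp only [inner_add_left, real_inner_smul_left]
        ring
      · have : θ = 0 := le_antisymm (hzero ▸ hθ.2) hθ.1
        rw [this]
        simpa using g1
    · match_scalars <;> first | ring1 | linear_combination -hsc
    · match_scalars <;> first | ring1 | linear_combination -hsc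
    · rw [tT, Real.cos_sub, Real.sin_sub]
      match_scalars
      · linear_combination -cos (α (i + 1)) * hsc
      · linear_combination -sin (α (i + 1)) * hsc
    · rw [tn, Real.cos_sub, Real.sin_sub]
      match_scalars
      · linear_combination sin (α (i + 1)) * hsc
      · linear_combination -cos (α (i + 1)) * hsc
    · rw [tT', tn', Real.cos_sub, Real.sin_sub]
      have := Real.sin_sq_add_cos_sq (α' (i + 1))
      match_scalars
      · linear_combination -cos θ' * this
      · linear_combination -sin θ' * this

end IsConvexChain

namespace IsConvexChain

variable {N : ℕ} {p : ℕ → ℝ} {c c' : ℝ → E3} {T n T' n' : ℕ → ℝ → E3} {k k' : ℝ → ℝ}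
  {α α' : ℕ → ℝ}

/-- A minor of the coordinates of `z` and `x` in the frame is the determinant of `c s`, `z`, `x`. -/
theorem minor_eq_det (h : IsConvexChain N p c T n k α) {j : ℕ} (hj : j < N) {s : ℝ}
    (hs : s ∈ Icc (p j) (p (j + 1))) (z x : E3) :
    (inner ℝ (T j s) z * inner ℝ (n j s) x - inner ℝ (n j s) z * inner ℝ (T j s) x : ℝ) =
      inner ℝ (c s) (cross z x) := by
  obtain ⟨o1, o2, o3, o4, o5, o6⟩ := orthonormal_triple_iff.1 (h.orthonormal j hj s hs)
  have := (cross_frame o1 o2 o4).2.1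
  rw [← h.n_eq j hj s hs] at this
  rw [← this, inner_cross_cross]
  ring

/-- Comparison of the end points of a convex curve, that does not lie in the plane of its end
points, with those of a less curved one. -/
theorem inner_ends_le_of_not_planar (h : IsConvexChain N p c T n k α)
    (h' : FrameChain N p c' T' n' k' α')
    (hk : ∀ j < N, ∀ x ∈ Ioo (p j) (p (j + 1)), |k' x| ≤ k x)
    (hα : ∀ j, j + 1 < N → |α' (j + 1)| ≤ α (j + 1))
    (hne : (inner ℝ (c (p N)) (c (p 0)) : ℝ) ^ 2 < 1)
    (hf : ∃ x ∈ Icc (p 0) (p N), (0 : ℝ) < inner ℝ (c x) (cross (c (p N)) (c (p 0)))) :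
    (inner ℝ (c' (p 0)) (c' (p N)) : ℝ) ≤ inner ℝ (c (p 0)) (c (p N)) := by
  have h0N : p 0 ≤ p N := partition_mono h.lt (Nat.zero_le N) le_rfl
  have hI0 : p 0 ∈ Icc (p 0) (p N) := left_mem_Icc.2 h0N
  have hIN : p N ∈ Icc (p 0) (p N) := right_mem_Icc.2 h0N
  have n0 := h.norm_c' h.pos hI0
  have nN := h.norm_c' h.pos hIN
  set ν := cross (c (p N)) (c (p 0)) with hν
  obtain ⟨s, hsI, hmax⟩ := isCompact_Icc.exists_isMaxOn (nonempty_Icc.2 h0N)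
    (h.continuousOn_c.inner (continuousOn_const (c := ν)) (𝕜 := ℝ))
  replace hmax : ∀ x ∈ Icc (p 0) (p N), (inner ℝ (c x) ν : ℝ) ≤ inner ℝ (c s) ν :=
    fun x hx => hmax hx
  obtain ⟨x₀, hx₀, hpos₀⟩ := hf
  have hM : (0 : ℝ) < inner ℝ (c s) ν := hpos₀.trans_le (hmax x₀ hx₀)
  have hs : s ∈ Ioo (p 0) (p N) := by
    refine ⟨lt_of_le_of_ne hsI.1 ?_, lt_of_le_of_ne hsI.2 ?_⟩
    · rintro rfl
      exact hM.ne' (inner_cross_self _ _)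
    · rintro rfl
      exact hM.ne' (inner_self_cross _ _)
  obtain ⟨e, m, e', hm, ho, he'1, heν, hmc, ⟨il, hil, hsl, θl, θl', hθl, hθl', hTl, hnl, hel⟩,
    ⟨ir, hir, hsr, θr, θr', hθr, hθr', hTr, hnr, her⟩⟩ := h.exists_pole h' hα hs hmax
  obtain ⟨o1, o2, o3, o4, o5, o6⟩ := orthonormal_triple_iff.1 ho
  set M : ℝ := inner ℝ (c s) ν with hMdef
  set x : ℝ := inner ℝ (c (p 0)) (c (p N)) with hx
  -- both sides are `m × ν`
  have hMe : M • e = (inner ℝ m (c (p 0)) : ℝ) • c (p N) -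
      (inner ℝ m (c (p N)) : ℝ) • c (p 0) := by
    rw [← cross_cross_eq, ← hν]
    have h1 := Orthonormal.eq_sum ho ν
    rw [heν, zero_smul, add_zero, ← hMdef] at h1
    have h3 : cross m (c s) = e := by
      rw [cross_swap, hm, (cross_frame o1 o2 o4).1, neg_neg]
    rw [h1, cross_add, cross_smul, cross_smul, SphericalSchur.cross_self, h3, smul_zero, add_zero]
  set A : ℝ := inner ℝ m (c (p N)) with hA
  set B : ℝ := inner ℝ m (c (p 0)) with hB
  have hA0 : 0 ≤ A := hmc _ hIN
  have hB0 : 0 ≤ B := hmc _ hI0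
  have hAB : 0 < A + B := by
    refine lt_of_le_of_ne (add_nonneg hA0 hB0) fun h0 => ?_
    rw [show A = 0 by linarith, show B = 0 by linarith, zero_smul, zero_smul, sub_zero] at hMe
    have := (smul_eq_zero.1 hMe).resolve_left hM.ne'
    rw [this, norm_zero] at o2
    exact zero_ne_one o2
  have hxN : (inner ℝ (c (p N)) (c (p 0)) : ℝ) = x := real_inner_comm _ _
  rw [hxN] at hne
  have hx1 : x < 1 := (abs_lt.1 (sq_lt_one_iff_abs_lt_one x |>.1 hne)).2
  have e0 : (inner ℝ (c (p 0)) (c (p 0)) : ℝ) = 1 := by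
    rw [real_inner_self_eq_norm_sq, n0, one_pow]
  have eN : (inner ℝ (c (p N)) (c (p N)) : ℝ) = 1 := by
    rw [real_inner_self_eq_norm_sq, nN, one_pow]
  -- the end point lies above the initial point
  have hlt : (inner ℝ (c (p 0)) e : ℝ) < inner ℝ (c (p N)) e := by
    refine lt_of_mul_lt_mul_left ?_ hM.le
    rw [← real_inner_smul_right, ← real_inner_smul_right, hMe, inner_sub_right, inner_sub_right]
    simp only [real_inner_smul_right, e0, eN, hxN, ← hx]
    linarith [mul_pos hAB (sub_pos.2 hx1)]
  have harc : arcsin (inner ℝ (c (p 0)) e) < arcsin (inner ℝ (c (p N)) e) := by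
    have b0 := abs_real_inner_le_norm (c (p 0)) e
    have bN := abs_real_inner_le_norm (c (p N)) e
    rw [n0, o2, one_mul, abs_le] at b0
    rw [nN, o2, one_mul, abs_le] at bN
    exact Real.strictMonoOn_arcsin ⟨b0.1, b0.2⟩ ⟨bN.1, bN.2⟩ hlt
  have hl1 := h.abs_arcsin_sub_le o2 h.pos le_rfl hs.1.le hs.2.le
  have hl2 := h.abs_arcsin_sub_le o2 h.pos hs.1.le hs.2.le le_rfl
  rw [o4, Real.arcsin_zero, zero_sub, abs_neg, abs_le] at hl1
  rw [o4, Real.arcsin_zero, sub_zero, abs_le] at hl2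
  have hlen := h.length_le
  have hsupp : ∀ j < N, ∀ y ∈ Icc (p j) (p (j + 1)), ∀ ε : ℝ, 0 < ε →
      (0 : ℝ) < inner ℝ (n j y) (c (p N) + c (p 0) + ε • c s) := by
    intro j hj y hy ε hε
    have g0 := h.support j hj y hy _ hI0
    have gN := h.support j hj y hy _ hIN
    have gs := h.support j hj y hy _ hsI
    rw [inner_add_right, inner_add_right, real_inner_smul_right]
    refine lt_of_le_of_ne (by positivity) fun hzero => ?_
    have gs' : (inner ℝ (n j y) (c s) : ℝ) = 0 :=
      (mul_eq_zero.1 (le_antisymm (by linarith) (mul_nonneg hε.le gs))).resolve_left hε.ne'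
    -- a normal perpendicular to three independent vectors vanishes
    have h1 := norm_cross_sq_smul (c (p N)) (c (p 0)) (n j y)
    rw [show (inner ℝ (n j y) (c (p N)) : ℝ) = 0 by linarith [mul_nonneg hε.le gs],
      show (inner ℝ (n j y) (c (p 0)) : ℝ) = 0 by linarith [mul_nonneg hε.le gs], ← hν,
      inner_cross_cross, e0, eN, ← hx, hxN] at h1
    simp only [zero_mul, sub_zero, zero_smul, add_zero, one_mul] at h1
    have hD : 1 - x * x ≠ 0 := by nlinarith
    have h2 := congrArg (fun v => (inner ℝ v (c s) : ℝ)) h1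
    simp only [real_inner_smul_left, gs', mul_zero] at h2
    rw [real_inner_comm (c s) ν, ← hMdef] at h2
    rw [(mul_eq_zero.1 h2.symm).resolve_right hM.ne', zero_smul] at h1
    have h3 := (smul_eq_zero.1 h1).resolve_left hD
    have h4 := (orthonormal_triple_iff.1 (h.orthonormal j hj y hy)).2.2.1
    rw [h3, norm_zero] at h4
    exact zero_ne_one h4
  have hdet : ∀ y ∈ Icc (p 0) (p N), (0 : ℝ) ≤ inner ℝ (c y) (cross (c (p N)) (c (p 0))) :=
    fun y hy => h.det_nonneg le_rfl le_rfl (by rw [hxN]; exact hne) hy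
  have hdetN : ∀ y ∈ Icc s (p N), (0 : ℝ) ≤ inner ℝ (c y) (cross (c (p N)) (c s)) :=
    fun y hy => h.det_nonneg hs.1.le le_rfl (by
      rw [real_inner_comm]
      exact h.inner_lt_one hs.1.le hs.2 le_rfl fun h => hs.1.ne' h.1) hy
  have hdet0 : ∀ y ∈ Icc (p 0) s, (0 : ℝ) ≤ inner ℝ (c y) (cross (c s) (c (p 0))) :=
    fun y hy => h.det_nonneg le_rfl hs.2.le (by
      rw [real_inner_comm]
      exact h.inner_lt_one le_rfl hs.1 hs.2.le fun h => hs.2.ne h.2) hy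
  have hαπ := fun j hj => h.turn_lt_pi (j := j) hj
  have right := h.inner_end_le_of_frame h' hk hα hαπ hir hsr (z₀ := c (p 0)) hθr hθr' ho hTr hnr
    her hM hMe hAB (fun j hj _ y hy _ => hsupp j hj y hy)
    (fun j hj _ y hy _ => by
      have := hdet y (h.mem_Icc hj hy)
      rw [← h.minor_eq_det hj hy] at this
      linarith)
    (fun j hj _ y hy hsy => by
      have := hdetN y ⟨hsy, (h.mem_Icc hj hy).2⟩
      rw [← h.minor_eq_det hj hy] at this
      linarith) (by linarith)
  have left := h.inner_start_le_of_frame h' hk hα hαπ hil hsl (z₀ := c (p N)) hθl hθl' ho hTl hnl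
    hel hM hMe (by linarith)
    (fun j hj y hy _ ε hε => by
      rw [add_comm (c (p 0))]
      exact hsupp j (by omega) y hy ε hε)
    (fun j hj y hy _ => by
      have := hdet y (h.mem_Icc (by omega) hy)
      rw [← h.minor_eq_det (by omega) hy] at this
      linarith)
    (fun j hj y hy hys => by
      have := hdet0 y ⟨(h.mem_Icc (by omega) hy).1, hys⟩
      rw [← h.minor_eq_det (by omega) hy] at this
      linarith) (by linarith)
  exact inner_le_of_heights (h'.norm_c' h.pos hI0) (h'.norm_c' h.pos hIN) he'1
    (cos_sub_arccos_of_pole n0 nN o2 hM hA0 hB0 hMe) left hlt.le right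

end IsConvexChain

/-! ### The comparison theorem -/

theorem IsConvexChain.inner_ends_le {N : ℕ} {p : ℕ → ℝ} {c c' : ℝ → E3}
    {T n T' n' : ℕ → ℝ → E3} {k k' : ℝ → ℝ} {α α' : ℕ → ℝ} (h : IsConvexChain N p c T n k α)
    (h' : FrameChain N p c' T' n' k' α')
    (hk : ∀ j < N, ∀ x ∈ Ioo (p j) (p (j + 1)), |k' x| ≤ k x)
    (hα : ∀ j, j + 1 < N → |α' (j + 1)| ≤ α (j + 1)) :
    (inner ℝ (c' (p 0)) (c' (p N)) : ℝ) ≤ inner ℝ (c (p 0)) (c (p N)) := by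
  have h0N : p 0 ≤ p N := partition_mono h.lt (Nat.zero_le N) le_rfl
  have hI0 : p 0 ∈ Icc (p 0) (p N) := left_mem_Icc.2 h0N
  have hIN : p N ∈ Icc (p 0) (p N) := right_mem_Icc.2 h0N
  have n0 := h.norm_c' h.pos hI0
  have nN := h.norm_c' h.pos hIN
  have hstraight : ((∀ j < N, ∀ x ∈ Ioo (p j) (p (j + 1)), k x = 0) ∧
      ∀ j, j + 1 < N → α (j + 1) = 0) →
      (inner ℝ (c' (p 0)) (c' (p N)) : ℝ) ≤ inner ℝ (c (p 0)) (c (p N)) := by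
    rintro ⟨h1, h2⟩
    rw [h.inner_ends_of_straight h.pos h1 h2, h'.inner_ends_of_straight h.pos]
    · intro j hj x hx
      have := hk j hj x hx
      rw [h1 j hj x hx] at this
      exact abs_nonpos_iff.1 this
    · intro j hj
      have := hα j hj
      rw [h2 j hj] at this
      exact abs_nonpos_iff.1 this
  have hb := abs_real_inner_le_norm (c (p 0)) (c (p N))
  rw [n0, nN, one_mul, abs_le] at hb
  rcases hb.2.eq_or_lt with h1 | h1
  · rw [h1]
    refine (real_inner_le_norm _ _).trans ?_
    rw [h'.norm_c' h.pos hI0, h'.norm_c' h.pos hIN, one_mul]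
  rcases hb.1.eq_or_lt with h2 | h2
  · -- between antipodal end points every initial direction points straight to the end
    refine hstraight (h.straight_of_le_inner (fun heq => ?_) ?_)
    · rw [heq, real_inner_self_eq_norm_sq, nN] at h1
      norm_num at h1
    · rw [← h2, Real.arccos_neg_one, Real.sin_pi]
      have hneg : c (p N) = -c (p 0) := by
        have := (inner_eq_one_iff_of_norm_eq_one (by rw [norm_neg, n0]) nN (𝕜 := ℝ)
          (x := -c (p 0))).1 (by rw [inner_neg_left, ← h2, neg_neg])
        exact this.symm
      have hq : p 0 ∈ Icc (p 0) (p (0 + 1)) := left_mem_Icc.2 (h.lt 0 h.pos).le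
      rw [hneg, inner_neg_right, real_inner_comm,
        (orthonormal_triple_iff.1 (h.orthonormal 0 h.pos _ hq)).2.2.2.1, neg_zero]
  have hne : (inner ℝ (c (p N)) (c (p 0)) : ℝ) ^ 2 < 1 := by
    rw [real_inner_comm, sq_lt_one_iff_abs_lt_one, abs_lt]
    exact ⟨h2, h1⟩
  by_cases hf : ∃ x ∈ Icc (p 0) (p N), (0 : ℝ) < inner ℝ (c x) (cross (c (p N)) (c (p 0)))
  · exact h.inner_ends_le_of_not_planar h' hk hα hne hf
  · push Not at hf
    refine hstraight (h.straight_of_planar (m := cross (c (p N)) (c (p 0))) (fun hzero => ?_)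
      fun t ht => le_antisymm (hf t ht) (h.det_nonneg le_rfl le_rfl hne ht))
    have h3 := inner_cross_cross (c (p N)) (c (p 0)) (c (p N)) (c (p 0))
    rw [hzero, inner_zero_left, real_inner_self_eq_norm_sq, real_inner_self_eq_norm_sq, n0, nN,
      real_inner_comm (c (p N)) (c (p 0))] at h3
    linarith

theorem IsConvex.inner_pieceNormal_nonneg {L : ℝ} {N : ℕ} {p : ℕ → ℝ} {c : ℝ → E3}
    (hconvex : IsConvex L c) (hp : IsPartition L N p) (hc : IsPiecewiseSphericalCurve L N p c)
    {j : ℕ} (hj : j < N) {s : ℝ} (hs : s ∈ Icc (p j) (p (j + 1))) {t : ℝ} (ht : t ∈ Icc 0 L) :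
    (0 : ℝ) ≤ inner ℝ (pieceNormal p c j s) (c t) := by
  have hsL := hp.mem_Icc hj hs
  rw [real_inner_comm, pieceNormal]
  rcases hs.2.lt_or_eq with hlt | heq
  · rw [pieceTangent_eq_rightTangent hc hj ⟨hs.1, hlt⟩]
    exact (hconvex s hsL t ht).1
      (hlt.trans_le (hp.mem_Icc hj (right_mem_Icc.2 (hp.lt j hj).le)).2)
  · have hlt : p j < s := heq ▸ hp.lt j hj
    rw [pieceTangent_eq_leftTangent hc hj ⟨hlt, hs.2⟩]
    exact (hconvex s hsL t ht).2
      ((hp.mem_Icc hj (left_mem_Icc.2 (hp.lt j hj).le)).1.trans_lt hlt)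

/-- A convex curve turns left at its corners. -/
theorem IsConvex.inner_turn_nonneg {L : ℝ} {N : ℕ} {p : ℕ → ℝ} {c : ℝ → E3}
    (hconvex : IsConvex L c) (hp : IsPartition L N p) (hc : IsPiecewiseSphericalCurve L N p c)
    {j : ℕ} (hj : j + 1 < N) : (0 : ℝ) ≤
      inner ℝ (pieceNormal p c j (p (j + 1))) (pieceTangent p c (j + 1) (p (j + 1))) := by
  have hq : p (j + 1) ∈ Icc (p j) (p (j + 1)) := right_mem_Icc.2 (hp.lt j (by omega)).le
  have h0 : (inner ℝ (pieceNormal p c j (p (j + 1))) (c (p (j + 1))) : ℝ) = 0 := by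
    rw [real_inner_comm]
    exact inner_self_cross _ _
  have hle : ∀ x ∈ Icc (p (j + 1)) (p (j + 1 + 1)),
      (0 : ℝ) ≤ inner ℝ (pieceNormal p c j (p (j + 1))) (c x) := fun x hx =>
    hconvex.inner_pieceNormal_nonneg hp hc (by omega) hq (hp.mem_Icc hj hx)
  generalize pieceNormal p c j (p (j + 1)) = m at h0 hle ⊢
  rw [← neg_nonpos]
  refine nonpos_of_hasDerivAt_of_le_left (f := fun t => -(inner ℝ m (c t) : ℝ))
    (u := fun t => -(inner ℝ m (pieceTangent p c (j + 1) t) : ℝ)) (hp.lt (j + 1) hj)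
    (continuousOn_const.inner (hc.contDiffOn_one (j + 1) hj).continuousOn).neg
    (continuousOn_const.inner (continuousOn_pieceTangent hp hc hj)).neg (fun x hx => ?_)
    fun x hx => ?_
  · have := ((hasDerivAt_const x m).inner ℝ (hasDerivAt_piece hc hj hx)).neg
    simpa using! this
  · rw [h0, neg_zero, neg_nonpos]
    exact hle x hx

theorem IsConvex.isConvexChain {L : ℝ} {N : ℕ} {p : ℕ → ℝ} {c : ℝ → E3} (hconvex : IsConvex L c)
    (hL : L ≤ π) (hN : 0 < N) (hp : IsPartition L N p) (hc : IsPiecewiseSphericalCurve L N p c)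
    (hsimple : IsSimple L c)
    (hk : ∀ j < N, ∀ s ∈ Ioo (p j) (p (j + 1)), 0 ≤ geodesicCurvature c s) :
    IsConvexChain N p c (pieceTangent p c) (pieceNormal p c) (geodesicCurvature c)
      (fun j => turningAngle c (p j)) where
  toFrameChain := frameChain_of_turn hp hc fun j hj =>
    ⟨(inner_tangents hp hc hj).1,
      (abs_of_nonneg (hconvex.inner_turn_nonneg hp hc hj)).symm.trans (inner_tangents hp hc hj).2⟩
  pos := hN
  length_le := by rwa [hp.zero, hp.last, sub_zero]
  n_eq _ _ _ _ := rfl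
  support j hj s hs t ht := by
    rw [hp.zero, hp.last] at ht
    exact hconvex.inner_pieceNormal_nonneg hp hc hj hs ht
  k_nonneg := hk
  turn_mem _ _ := ⟨InnerProductGeometry.angle_nonneg _ _, InnerProductGeometry.angle_le_pi _ _⟩
  simple := by
    rw [hp.zero, hp.last]
    exact hsimple

end SphericalSchur

theorem theorem1p2 (L : ℝ) (hL : L ≤ Real.pi) (N : ℕ) (p : ℕ → ℝ)
    (hp : SphericalSchur.IsPartition L N p)
    (c c' : ℝ → EuclideanSpace ℝ (Fin 3))
    (hc : SphericalSchur.IsPiecewiseSphericalCurve L N p c)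
    (hc' : SphericalSchur.IsPiecewiseSphericalCurve L N p c')
    (hsimple : SphericalSchur.IsSimple L c)
    (hconvex : SphericalSchur.IsConvex L c)
    (hcurv : ∀ j < N, ∀ s ∈ Set.Ioo (p j) (p (j + 1)),
      |SphericalSchur.geodesicCurvature c' s| ≤ SphericalSchur.geodesicCurvature c s)
    (hangle : ∀ j, 0 < j → j < N →
      SphericalSchur.turningAngle c' (p j) ≤ SphericalSchur.turningAngle c (p j)) :
    ‖c 0 - c L‖ ≤ ‖c' 0 - c' L‖ := by
  rcases Nat.eq_zero_or_pos N with rfl | hN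
  · rw [← hp.last, hp.zero, sub_self, sub_self]
  have hL0 : 0 ≤ L := by
    rw [← hp.zero, ← hp.last]
    exact SphericalSchur.partition_mono hp.lt (Nat.zero_le N) le_rfl
  have h := hconvex.isConvexChain hL hN hp hc hsimple
    fun j hj s hs => (abs_nonneg _).trans (hcurv j hj s hs)
  obtain ⟨α', hα', h'⟩ := SphericalSchur.exists_frameChain hp hc'
  have key := h.inner_ends_le h' hcurv fun j hj => by
    rw [hα' j hj]
    exact hangle (j + 1) (Nat.succ_pos j) hj
  rw [hp.zero, hp.last] at key
  have hnorm : ∀ x : ℝ → EuclideanSpace ℝ (Fin 3),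
      SphericalSchur.IsPiecewiseSphericalCurve L N p x →
      ‖x 0 - x L‖ ^ 2 = 2 - 2 * (inner ℝ (x 0) (x L) : ℝ) := by
    intro x hx
    have h0 : ‖x 0‖ = 1 := by simpa using hx.mem_sphere 0 ⟨le_rfl, hL0⟩
    have h1 : ‖x L‖ = 1 := by simpa using hx.mem_sphere L ⟨hL0, le_rfl⟩
    rw [norm_sub_sq_real, h0, h1]
    ring
  refine (sq_le_sq₀ (norm_nonneg _) (norm_nonneg _)).1 ?_
  rw [hnorm c hc, hnorm c' hc']
  linarith
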